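/- **Setting.** Let $\mathcal A\in\{0,1\}^{n\times n}$ be the zero/nonzero structure of a linear system $\mathbf x_{k+1}=A\mathbf x_k$; its digraph on the states $x_1,\dots,x_n$ has an edge $x_j\to x_i$ whenever $\mathcal A_{ij}\neq 0$. A numerical realization of a structure is a real matrix that vanishes at the zeros of the structure (the other entries are free). Assume that $\mathcal A$ is structurally full rank, i.e. some numerical realization is invertible (equivalently, $\mathcal A$ is structurally cyclic: a family of disjoint cycles spans all states). For $\mathcal H\in\{0,1\}^{m\times n}$, where $\mathcal H_{ij}=1$ means that sensor $i$ measures $x_j$, the pair $(A,H)$ is structurally observable if some numerical realization of $(\mathcal A,\mathcal H)$ is observable. Every sensor takes exactly one measurement, and $m$ is the minimum number of such sensors for which structural observability is possible. A parent SCC is a strongly connected component of the digraph without outgoing edges. Let $c\in\mathbb R^{m\times n}$ be the cost matrix, $c_{ij}$ being the cost of sensor $i$ measuring $x_j$. **Problem P1.** Minimize $\sum_{i=1}^m\sum_{j=1}^n c_{ij}\mathcal H_{ij}$ over $\mathcal H\in\{0,1\}^{m\times n}$ subject to: $(A,H)$ is structurally observable, $\sum_{i}\mathcal H_{ij}\le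 1$ for all $j$, and $\sum_{j}\mathcal H_{ij}=1$ for all $i$. **LSAP.** For $C\in\mathbb R^{m\times m}$, minimize $\sum_{i,j=1}^m C_{ij}\mathcal Z_{ij}$ over $\mathcal Z\in\{0,1\}^{m\times m}$ subject to $\sum_j \mathcal Z_{ij}=1$ for all $i$ and $\sum_i \mathcal Z_{ij}=1$ for all $j$. **Theorem.** 1. (Reduction.) There are exactly $m$ parent SCCs, the constraint $\sum_i\mathcal H_{ij}\le 1$ in P1 is implied by the other constraints, and P1 has an optimal solution. Let $SCC_1,\dots,SCC_m$ be any enumeration of the parent SCCs without repetition, and put $C_{ij}=\min\{c_{il}: x_l\in SCC_j\}$. Then P1 is equivalent to the LSAP with cost matrix $C$: - (a) for every feasible $\mathcal H$ of P1, the matrix $\mathcal Z(\mathcal H)_{ij}=\sum_{x_l\in SCC_j}\mathcal H_{il}$ is feasible for the LSAP and its cost is at most the cost of $\mathcal H$; - (b) for every choice of states $x_{\ell(i,j)}\in SCC_j$ with $c_{i\,\ell(i,j)}=C_{ij}$ and every feasible $\mathcal Z$ of the LSAP, the matrix $\mathcal H$ in which sensor $i$ measures $x_{\ell(i,j)}$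 exactly when $\mathcal Z_{ij}=1$ is feasible for P1, has the same cost as $\mathcal Z$, satisfies $\mathcal Z(\mathcal H)=\mathcal Z$, and is optimal for P1 if and only if $\mathcal Z$ is optimal for the LSAP; - (c) $\mathcal H$ is optimal for P1 if and only if $\mathcal H$ is feasible, $\mathcal Z(\mathcal H)$ is optimal for the LSAP, and the costs of $\mathcal H$ and $\mathcal Z(\mathcal H)$ are equal; and the two problems have the same optimal value. 2. (Complexity.) In a random access machine model in which integers can be incremented, decremented and compared, real numbers can be added, subtracted and compared, and memory cells can be read and written, each at unit cost: - (a) one fixed program computes, for all $m$ and all $C\in\mathbb R^{m\times m}$, an exact optimal solution of the LSAP in $O(m^3)$ steps; - (b) one fixed program computes, for all $\mathcal A$, $m$ and $c$ as above, an exact optimal solution of P1 from $\mathcal A$ and $c$ in $O(n^2+m^3)$ steps, i.e. $O(m^3)$ besides $O(n^2)$ for reading the data, decomposing the digraph and forming $C$. -/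

import Mathlib

namespace SensingLSAP

/-! ### Structured systems -/

/-- A matrix all of whose entries are `0` or `1`. -/
def IsZeroOne {m n : ℕ} (M : Matrix (Fin m) (Fin n) ℕ) : Prop :=
  ∀ i j, M i j = 0 ∨ M i j = 1

/-- `R` is a numerical realization of the structure `M`: the zeros of `M` are fixed zeros of `R`,
and the entries of `R` at the nonzero positions of `M` are free real parameters. -/
def IsRealization {m n : ℕ} (M : Matrix (Fin m) (Fin n) ℕ) (R : Matrix (Fin m) (Fin n) ℝ) : Prop :=
  ∀ i j, M i j = 0 → R i j = 0

/-- Structural (generic) full rank: some numerical realization is invertible. -/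
def StructurallyFullRank {n : ℕ} (A : Matrix (Fin n) (Fin n) ℕ) : Prop :=
  ∃ R : Matrix (Fin n) (Fin n) ℝ, IsRealization A R ∧ R.det ≠ 0

/-- Structurally cyclic: a family of disjoint cycles of the system digraph (the cycles of the
permutation `σ`, with edges `x_j → x_{σ j}`) spans all state nodes. -/
def StructurallyCyclic {n : ℕ} (A : Matrix (Fin n) (Fin n) ℕ) : Prop :=
  ∃ σ : Equiv.Perm (Fin n), ∀ j, A (σ j) j ≠ 0

theorem structurallyFullRank_iff_structurallyCyclic {n : ℕ} (A : Matrix (Fin n) (Fin n) ℕ) :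
    StructurallyFullRank A ↔ StructurallyCyclic A := by
  constructor
  · rintro ⟨R, hR, hdet⟩
    rw [Matrix.det_apply] at hdet
    obtain ⟨σ, -, hσ⟩ := Finset.exists_ne_zero_of_sum_ne_zero hdet
    refine ⟨σ, fun j h0 => hσ ?_⟩
    have hp : ∏ i, R (σ i) i = 0 := Finset.prod_eq_zero (Finset.mem_univ j) (hR _ _ h0)
    simp [hp]
  · rintro ⟨σ, hσ⟩
    refine ⟨σ⁻¹.permMatrix ℝ, fun i j h0 => ?_, ?_⟩
    · have hne : ¬ σ.symm i = j := by
        rintro rfl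
        exact hσ (σ.symm i) (by simpa using h0)
      simp [Equiv.Perm.permMatrix, PEquiv.toMatrix_apply, Equiv.toPEquiv_apply, hne]
    · rw [Matrix.det_permutation]
      rcases Int.units_eq_one_or (Equiv.Perm.sign σ⁻¹) with h | h <;> simp [h]

/-- Observability of `x_{k+1} = A x_k`, `y_k = H x_k`: the output sequence determines the initial
state. -/
def Observable {m n : ℕ} (A : Matrix (Fin n) (Fin n) ℝ) (H : Matrix (Fin m) (Fin n) ℝ) : Prop :=
  ∀ x : Fin n → ℝ, (∀ k : ℕ, H.mulVec ((A ^ k).mulVec x) = 0) → x = 0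

/-- Structural observability of the pair of structures `(A, H)`. -/
def StructurallyObservable {m n : ℕ} (A : Matrix (Fin n) (Fin n) ℕ)
    (H : Matrix (Fin m) (Fin n) ℕ) : Prop :=
  ∃ (RA : Matrix (Fin n) (Fin n) ℝ) (RH : Matrix (Fin m) (Fin n) ℝ),
    IsRealization A RA ∧ IsRealization H RH ∧ Observable RA RH

/-! ### Strongly connected components of the system digraph -/

/-- Edge `x_j → x_i` of the system digraph. -/
def Edge {n : ℕ} (A : Matrix (Fin n) (Fin n) ℕ) (j i : Fin n) : Prop := A i j ≠ 0

def Reaches {n : ℕ} (A : Matrix (Fin n) (Fin n) ℕ) : Fin n → Fin n → Prop :=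
  Relation.ReflTransGen (Edge A)

/-- `S` is a strongly connected component, i.e. a class of mutually reachable states. -/
def IsSCC {n : ℕ} (A : Matrix (Fin n) (Fin n) ℕ) (S : Set (Fin n)) : Prop :=
  ∃ x, S = {y | Reaches A x y ∧ Reaches A y x}

/-- A parent SCC: a strongly connected component without outgoing edges. -/
def IsParentSCC {n : ℕ} (A : Matrix (Fin n) (Fin n) ℕ) (S : Set (Fin n)) : Prop :=
  IsSCC A S ∧ ∀ i ∈ S, ∀ j, j ∉ S → ¬ Edge A i j

/-! ### The optimization problems -/

/-- The set of minimizers of `f` over the feasible set `F`. -/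
def argminSet {α : Type*} (F : Set α) (f : α → ℝ) : Set α :=
  {x | x ∈ F ∧ ∀ y ∈ F, f x ≤ f y}

/-- `∑ i j, c i j * M i j`. -/
noncomputable def totalCost {m n : ℕ} (c : Matrix (Fin m) (Fin n) ℝ)
    (M : Matrix (Fin m) (Fin n) ℕ) : ℝ :=
  ∑ i, ∑ j, c i j * (M i j : ℝ)

/-- Measurement structures of `m` sensors, each sensor taking exactly one measurement, that make
the system structurally observable. -/
def measurementSet {n : ℕ} (A : Matrix (Fin n) (Fin n) ℕ) (m : ℕ) :
    Set (Matrix (Fin m) (Fin n) ℕ) :=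
  {H | IsZeroOne H ∧ (∀ i, ∑ j, H i j = 1) ∧ StructurallyObservable A H}

/-- `m` is the minimum number of (single-measurement) sensors for structural observability. -/
def IsMinSensorNumber {n : ℕ} (A : Matrix (Fin n) (Fin n) ℕ) (m : ℕ) : Prop :=
  IsLeast {k | (measurementSet A k).Nonempty} m

/-- The feasible set of the sensing cost problem: structural observability, every state measured
by at most one sensor, every sensor measuring exactly one state. -/
def sensingFeasible {n : ℕ} (A : Matrix (Fin n) (Fin n) ℕ) (m : ℕ) :
    Set (Matrix (Fin m) (Fin n) ℕ) :=
  {H | IsZeroOne H ∧ (∀ j, ∑ i, H i j ≤ 1) ∧ (∀ i, ∑ j, H i j = 1) ∧ StructurallyObservable A H}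

/-- The feasible set of the linear sum assignment problem. -/
def lsapFeasible (m : ℕ) : Set (Matrix (Fin m) (Fin m) ℕ) :=
  {Z | IsZeroOne Z ∧ (∀ i, ∑ j, Z i j = 1) ∧ (∀ j, ∑ i, Z i j = 1)}

/-- `C i j = min {c i l | x_l ∈ S j}`. -/
noncomputable def sccCost {m n : ℕ} (c : Matrix (Fin m) (Fin n) ℝ) (S : Fin m → Set (Fin n)) :
    Matrix (Fin m) (Fin m) ℝ :=
  fun i j => sInf (c i '' S j)

open Classical in
/-- The assignment induced by `H`: entry `(i, j)` counts the states of `S j` measured by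
sensor `i`. -/
noncomputable def inducedAssignment {m n : ℕ} (S : Fin m → Set (Fin n))
    (H : Matrix (Fin m) (Fin n) ℕ) : Matrix (Fin m) (Fin m) ℕ :=
  fun i j => ∑ l, if l ∈ S j then H i l else 0

/-- The measurement structure in which a sensor `i` that is assigned to the `j`-th component
measures the state `ℓ i j`. -/
def measureSelected {m n : ℕ} (ℓ : Fin m → Fin m → Fin n) (Z : Matrix (Fin m) (Fin m) ℕ) :
    Matrix (Fin m) (Fin n) ℕ :=
  fun i l => ∑ j, if ℓ i j = l then Z i j else 0

/-! ### A random access machine with real registers and a step count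

Programs are finite and are written in an imperative language with two-dimensional integer arrays
and two-dimensional real arrays (array names are fixed in the program, indices are computed).
Integers can only be incremented, decremented and compared; reals can only be added, subtracted
and compared. There are no real constants other than `0`. -/

/-- The memory: entry `(i, j)` of the `a`-th integer array and of the `a`-th real array. -/
structure Memory where
  int : ℕ → ℕ → ℕ → ℕ
  real : ℕ → ℕ → ℕ → ℝ

inductive IntExpr where
  | const (k : ℕ)
  | read (a : ℕ) (i j : IntExpr)
  | succ (e : IntExpr)
  | pred (e : IntExpr)

inductive RealExpr where
  | zero
  | read (a : ℕ) (i j : IntExpr)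
  | add (e f : RealExpr)
  | sub (e f : RealExpr)

inductive Test where
  | intLe (e f : IntExpr)
  | realLe (e f : RealExpr)
  | not (b : Test)
  | and (b d : Test)

inductive Prog where
  | skip
  | setInt (a : ℕ) (i j e : IntExpr)
  | setReal (a : ℕ) (i j : IntExpr) (e : RealExpr)
  | seq (p q : Prog)
  | ite (b : Test) (p q : Prog)
  | loop (b : Test) (p : Prog)

def IntExpr.eval (s : Memory) : IntExpr → ℕ
  | .const k => k
  | .read a i j => s.int a (i.eval s) (j.eval s)
  | .succ e => e.eval s + 1
  | .pred e => e.eval s - 1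

noncomputable def RealExpr.eval (s : Memory) : RealExpr → ℝ
  | .zero => 0
  | .read a i j => s.real a (i.eval s) (j.eval s)
  | .add e f => e.eval s + f.eval s
  | .sub e f => e.eval s - f.eval s

def Test.Holds (s : Memory) : Test → Prop
  | .intLe e f => e.eval s ≤ f.eval s
  | .realLe e f => e.eval s ≤ f.eval s
  | .not b => ¬ b.Holds s
  | .and b d => b.Holds s ∧ d.Holds s

def Memory.writeInt (s : Memory) (a i j v : ℕ) : Memory where
  int := fun a' i' j' => if a' = a ∧ i' = i ∧ j' = j then v else s.int a' i' j'
  real := s.real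

def Memory.writeReal (s : Memory) (a i j : ℕ) (v : ℝ) : Memory where
  int := s.int
  real := fun a' i' j' => if a' = a ∧ i' = i ∧ j' = j then v else s.real a' i' j'

/-- `Exec p s t k`: started in memory `s`, the program `p` halts in memory `t` after `k` steps.
A step is an assignment, an empty statement or an evaluation of a test. As the expressions of a
fixed program have bounded size, counting every elementary operation and memory access separately
changes `k` by at most a constant factor that depends only on the program. -/
inductive Exec : Prog → Memory → Memory → ℕ → Prop where
  | skip (s : Memory) : Exec .skip s s 1
  | setInt (s : Memory) (a : ℕ) (i j e : IntExpr) :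
      Exec (.setInt a i j e) s (s.writeInt a (i.eval s) (j.eval s) (e.eval s)) 1
  | setReal (s : Memory) (a : ℕ) (i j : IntExpr) (e : RealExpr) :
      Exec (.setReal a i j e) s (s.writeReal a (i.eval s) (j.eval s) (e.eval s)) 1
  | seq {p q : Prog} {s t u : Memory} {k l : ℕ} :
      Exec p s t k → Exec q t u l → Exec (.seq p q) s u (k + l)
  | iteTrue {b : Test} {p q : Prog} {s t : Memory} {k : ℕ} :
      b.Holds s → Exec p s t k → Exec (.ite b p q) s t (k + 1)
  | iteFalse {b : Test} {p q : Prog} {s t : Memory} {k : ℕ} :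
      ¬ b.Holds s → Exec q s t k → Exec (.ite b p q) s t (k + 1)
  | loopDone {b : Test} {p : Prog} {s : Memory} :
      ¬ b.Holds s → Exec (.loop b p) s s 1
  | loopStep {b : Test} {p : Prog} {s t u : Memory} {k l : ℕ} :
      b.Holds s → Exec p s t k → Exec (.loop b p) t u l → Exec (.loop b p) s u (k + l + 1)

/-- Programs are deterministic: the final memory and the step count are unique. -/
theorem Exec.unique {p : Prog} {s t : Memory} {k : ℕ} (h : Exec p s t k) :
    ∀ {t' : Memory} {k' : ℕ}, Exec p s t' k' → t = t' ∧ k = k' := by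
  induction h with
  | skip s => intro _ _ h'; cases h'; exact ⟨rfl, rfl⟩
  | setInt s a i j e => intro _ _ h'; cases h'; exact ⟨rfl, rfl⟩
  | setReal s a i j e => intro _ _ h'; cases h'; exact ⟨rfl, rfl⟩
  | seq _ _ ih₁ ih₂ =>
    intro _ _ h'
    cases h' with
    | seq h₁ h₂ =>
      obtain ⟨rfl, rfl⟩ := ih₁ h₁
      obtain ⟨rfl, rfl⟩ := ih₂ h₂
      exact ⟨rfl, rfl⟩
  | iteTrue hb _ ih =>
    intro _ _ h'
    cases h' with
    | iteTrue _ h₁ => obtain ⟨rfl, rfl⟩ := ih h₁; exact ⟨rfl, rfl⟩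
    | iteFalse hb' _ => exact absurd hb hb'
  | iteFalse hb _ ih =>
    intro _ _ h'
    cases h' with
    | iteTrue hb' _ => exact absurd hb' hb
    | iteFalse _ h₁ => obtain ⟨rfl, rfl⟩ := ih h₁; exact ⟨rfl, rfl⟩
  | loopDone hb =>
    intro _ _ h'
    cases h' with
    | loopDone _ => exact ⟨rfl, rfl⟩
    | loopStep hb' _ _ => exact absurd hb' hb
  | loopStep hb _ _ ih₁ ih₂ =>
    intro _ _ h'
    cases h' with
    | loopDone hb' => exact absurd hb hb'
    | loopStep _ h₁ h₂ =>
      obtain ⟨rfl, rfl⟩ := ih₁ h₁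
      obtain ⟨rfl, rfl⟩ := ih₂ h₂
      exact ⟨rfl, rfl⟩

/-- Input of an assignment problem: `m` in cell `(0, 0)` of integer array `0`, the matrix `C` in
real array `0`; all other cells are zero. -/
noncomputable def lsapInput {m : ℕ} (C : Matrix (Fin m) (Fin m) ℝ) : Memory where
  int := fun a i j => if a = 0 ∧ i = 0 ∧ j = 0 then m else 0
  real := fun a i j => if h : a = 0 ∧ i < m ∧ j < m then C ⟨i, h.2.1⟩ ⟨j, h.2.2⟩ else 0

/-- Input of a sensing cost problem: `n` and `m` in cells `(0, 0)` and `(0, 1)` of integer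
array `0`, the structure `A` in integer array `1`, the costs `c` in real array `0`; all other cells
are zero. -/
noncomputable def sensingInput {m n : ℕ} (A : Matrix (Fin n) (Fin n) ℕ)
    (c : Matrix (Fin m) (Fin n) ℝ) : Memory where
  int := fun a i j =>
    if a = 0 ∧ i = 0 ∧ j = 0 then n
    else if a = 0 ∧ i = 0 ∧ j = 1 then m
    else if h : a = 1 ∧ i < n ∧ j < n then A ⟨i, h.2.1⟩ ⟨j, h.2.2⟩
    else 0
  real := fun a i j => if h : a = 0 ∧ i < m ∧ j < n then c ⟨i, h.2.1⟩ ⟨j, h.2.2⟩ else 0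

/-- The `m × n` matrix stored in integer array `a`. -/
def Memory.output (s : Memory) (a m n : ℕ) : Matrix (Fin m) (Fin n) ℕ :=
  fun i j => s.int a i j

end SensingLSAP

open SensingLSAP

/-!
The reduction rests on a criterion for structural observability. If a parent component contains no
measured state, then the vectors supported on it form an invariant subspace on which the output
vanishes (`StructurallyObservable.exists_measured`). Conversely, let every state reach a measured
state. A structurally full rank system is spanned by disjoint cycles, and the cycles can be added
one at a time to an observable part: a cycle that contains a measured state can be observed by
itself, and any other one is fed through a single edge into the part built so far. If all weights of
the new cycle are equal to `w`, its state is periodic up to the factor `w ^ k`; for `w` much larger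
than the growth rate of the old part the new contribution dominates the output, so that it must
vanish if the output does (`exists_rate_forall_periodic_eq_zero`, `ObservableOn.attachCycle`,
`exists_realization_observable`). As every state reaches a parent component, `m` dedicated sensors
are feasible exactly if they measure one state in each of the `m` parent components
(`mem_measurementSet_iff_perm`), that is, if they are given by a permutation and by a choice of
states. This is the assignment problem, once every sensor takes the cheapest state of its component
(`argminSet_correspondence`).

For the running times a small program logic with step bounds is used: `RunsWithin p s k Q`, with
rules for loops, and frames that keep track of the arrays a program does not write.

The assignment problem is solved by the Hungarian method with shortest augmenting paths. Rows are
matched one after the other along tight entries of feasible dual variables; for a new row an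
alternating tree is grown, every round of which costs `O(m)` because the smallest slack of each
column with respect to the tree is kept up to date (`TreeInv.shift`, `TreeInv.grow`), and at a free
column the matching is augmented (`AugInv.step`, `AugInv.finish`). A perfect tight matching is
optimal by weak duality (`MatchInv.optimal`).

The parent components are found by three graph searches (`sinkLabels_of_searchResults`). Each
search takes `O(n ^ 2)` steps, since a round either processes a vertex or treats a candidate, and
there are at most `n` of each. With the component labels, the cost matrix of the assignment problem
and the cheapest states are computed in `O(m * n)` steps, where `m ≤ n`.
-/

namespace SensingLSAP

/-! ### Structural observability -/

/-- In an observable pair every parent component contains a measured state: vectors supported on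
a set of states without outgoing edges form an invariant subspace. -/
theorem StructurallyObservable.exists_measured {m n : ℕ} {A : Matrix (Fin n) (Fin n) ℕ}
    {H : Matrix (Fin m) (Fin n) ℕ} (h : StructurallyObservable A H) {S : Set (Fin n)}
    (hS : IsParentSCC A S) : ∃ i, ∃ l ∈ S, H i l ≠ 0 := by
  classical
  by_contra! hH
  obtain ⟨RA, RH, hA, hHr, hobs⟩ := h
  obtain ⟨⟨s, rfl⟩, hout⟩ := hS
  set S : Set (Fin n) := {y | Reaches A s y ∧ Reaches A y s} with hSdef
  have hs : s ∈ S := ⟨Relation.ReflTransGen.refl, Relation.ReflTransGen.refl⟩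
  let x : Fin n → ℝ := fun j => if j ∈ S then 1 else 0
  have hx : ∀ k : ℕ, ∀ j, j ∉ S → ((RA ^ k).mulVec x) j = 0 := by
    intro k
    induction k with
    | zero => intro j hj; simp [x, hj]
    | succ k ih =>
      intro j hj
      rw [pow_succ', ← Matrix.mulVec_mulVec, Matrix.mulVec, dotProduct]
      refine Finset.sum_eq_zero fun l _ => ?_
      by_cases hl : l ∈ S
      · rw [hA j l (not_not.mp (hout l hl j hj)), zero_mul]
      · rw [ih l hl, mul_zero]
  have h0 := hobs x fun k => by
    funext i
    rw [Matrix.mulVec, dotProduct]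
    refine Finset.sum_eq_zero fun l _ => ?_
    by_cases hl : l ∈ S
    · rw [hHr i l (hH i l hl), zero_mul]
    · rw [hx k l hl, mul_zero]
  have := congrFun h0 s
  simp [x, hs] at this

/-- Powers of a matrix grow at most geometrically. -/
theorem exists_norm_pow_mulVec_le {n : ℕ} (R : Matrix (Fin n) (Fin n) ℝ) :
    ∃ ρ : ℝ, 1 ≤ ρ ∧ ∀ (k : ℕ) (v : Fin n → ℝ), ‖(R ^ k).mulVec v‖ ≤ ρ ^ k * ‖v‖ := by
  let T := LinearMap.toContinuousLinearMap (Matrix.mulVecLin R)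
  refine ⟨max 1 ‖T‖, le_max_left _ _, fun k v => ?_⟩
  induction k with
  | zero => simp
  | succ k ih =>
    rw [pow_succ', ← Matrix.mulVec_mulVec]
    have h1 : ‖R.mulVec ((R ^ k).mulVec v)‖ ≤ ‖T‖ * ‖(R ^ k).mulVec v‖ :=
      T.le_opNorm ((R ^ k).mulVec v)
    calc _ ≤ ‖T‖ * ‖(R ^ k).mulVec v‖ := h1
      _ ≤ max 1 ‖T‖ * (max 1 ‖T‖ ^ k * ‖v‖) := by gcongr; exact le_max_right _ _
      _ = _ := by ring

/-- A periodic input that is fed in with exponential growth rate `w`, large compared to the growth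
rate `ρ` of the impulse response `h` and of the free response `a`, is determined by the output:
the first nonzero coefficient of `h` dominates. The choice of `w` depends only on `h` and `ρ`. -/
theorem exists_rate_forall_periodic_eq_zero (h : ℕ → ℝ) (ρ : ℝ) (hρ : 1 ≤ ρ)
    (hb : ∀ r, |h r| ≤ ρ ^ r) (hne : ∃ r, h r ≠ 0) :
    ∃ w : ℝ, ∀ (a u : ℕ → ℝ) (M : ℝ) (L : ℕ), 0 < L → (∀ s, u (s + L) = u s) →
      (∀ k, |a k| ≤ M * ρ ^ k) →
      (∀ k, a k + ∑ s ∈ Finset.range k, h (k - 1 - s) * (w ^ s * u s) = 0) → ∀ s, u s = 0 := by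
  classical
  let r := Nat.find hne
  have hr : h r ≠ 0 := Nat.find_spec hne
  have hr' : ∀ t < r, h t = 0 := fun t ht => not_not.mp (Nat.find_min hne ht)
  have hpos : 0 < |h r| := abs_pos.mpr hr
  have hρ0 : 0 < ρ := by linarith
  set w : ℝ := ρ + 1 + 2 * ρ ^ (r + 1) / |h r| with hw
  have hwρ : ρ < w := by
    have : 0 ≤ 2 * ρ ^ (r + 1) / |h r| := by positivity
    linarith
  have hw0 : 0 < w := hρ0.trans hwρ
  refine ⟨w, fun a u M L hL hu ha heq => ?_⟩
  have hper : ∀ t s, u (s + t * L) = u s := by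
    intro t s
    induction t with
    | zero => simp
    | succ t ih => rw [Nat.succ_mul, ← add_assoc, hu, ih]
  have hmod : ∀ s, u s = u (s % L) := by
    intro s
    conv_lhs => rw [← Nat.mod_add_div s L, mul_comm L]
    exact hper _ _
  obtain ⟨s₀, -, hs₀⟩ := Finset.exists_max_image (Finset.range L) (fun s => |u s|)
    ⟨0, Finset.mem_range.mpr hL⟩
  set U : ℝ := |u s₀| with hU
  have hUmax : ∀ s, |u s| ≤ U := fun s => by
    rw [hmod s]; exact hs₀ _ (Finset.mem_range.mpr (Nat.mod_lt _ hL))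
  have hU0 : 0 ≤ U := abs_nonneg _
  -- at the times `s₀ + t * L + r + 1` the term with `h r` meets an input of maximal size `U`, the
  -- later inputs are not yet visible, and the earlier ones contribute at most half as much
  have key : ∀ t : ℕ, |h r| * U / 2 ≤ M * ρ ^ (r + 1) * (ρ / w) ^ (s₀ + t * L) := by
    intro t
    set s₁ := s₀ + t * L with hs₁
    have hus₁ : |u s₁| = U := by rw [hs₁, hper]
    have e := heq (s₁ + (r + 1))
    rw [Finset.sum_range_add, Finset.sum_range_succ'] at e
    have e2 : ∑ x ∈ Finset.range r, h (s₁ + (r + 1) - 1 - (s₁ + (x + 1))) *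
        (w ^ (s₁ + (x + 1)) * u (s₁ + (x + 1))) = 0 := by
      refine Finset.sum_eq_zero fun x hx => ?_
      have := Finset.mem_range.mp hx
      rw [hr' _ (by omega), zero_mul]
    rw [e2, show s₁ + (r + 1) - 1 - (s₁ + 0) = r by omega, zero_add, add_zero] at e
    have hsum : |∑ s ∈ Finset.range s₁, h (s₁ + (r + 1) - 1 - s) * (w ^ s * u s)| * (w - ρ)
        ≤ U * ρ ^ (r + 1) * w ^ s₁ := by
      have h1 : |∑ s ∈ Finset.range s₁, h (s₁ + (r + 1) - 1 - s) * (w ^ s * u s)|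
          ≤ ∑ s ∈ Finset.range s₁, U * ρ ^ (r + 1) * (w ^ s * ρ ^ (s₁ - 1 - s)) := by
        refine (Finset.abs_sum_le_sum_abs _ _).trans (Finset.sum_le_sum fun s hs => ?_)
        have hs' := Finset.mem_range.mp hs
        rw [abs_mul, abs_mul, abs_of_pos (pow_pos hw0 s)]
        have h2 := hb (s₁ + (r + 1) - 1 - s)
        rw [show s₁ + (r + 1) - 1 - s = (r + 1) + (s₁ - 1 - s) by omega, pow_add] at h2
        rw [show s₁ + (r + 1) - 1 - s = (r + 1) + (s₁ - 1 - s) by omega]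
        calc _ ≤ (ρ ^ (r + 1) * ρ ^ (s₁ - 1 - s)) * (w ^ s * U) := by
              gcongr; exact hUmax s
          _ = _ := by ring
      rw [← Finset.mul_sum] at h1
      calc _ ≤ (U * ρ ^ (r + 1) * ∑ s ∈ Finset.range s₁, w ^ s * ρ ^ (s₁ - 1 - s)) * (w - ρ) :=
            mul_le_mul_of_nonneg_right h1 (by linarith)
        _ = U * ρ ^ (r + 1) * (w ^ s₁ - ρ ^ s₁) := by rw [mul_assoc, geom_sum₂_mul]
        _ ≤ _ := by
          have : 0 ≤ ρ ^ s₁ := by positivity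
          gcongr; linarith
    have hsum2 : |∑ s ∈ Finset.range s₁, h (s₁ + (r + 1) - 1 - s) * (w ^ s * u s)|
        ≤ |h r| * U / 2 * w ^ s₁ := by
      have hge : 2 * ρ ^ (r + 1) / |h r| ≤ w - ρ := by rw [hw]; linarith
      rw [div_le_iff₀ hpos] at hge
      have hd : 0 < w - ρ := by linarith
      refine le_of_mul_le_mul_right (hsum.trans ?_) hd
      have h3 : 0 ≤ U * w ^ s₁ := by positivity
      nlinarith [mul_le_mul_of_nonneg_left hge h3]
    have hmain : |h r| * (w ^ s₁ * U) ≤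
        M * ρ ^ (s₁ + (r + 1)) + |h r| * U / 2 * w ^ s₁ := by
      have h4 : h r * (w ^ s₁ * u s₁) = -a (s₁ + (r + 1)) -
        ∑ s ∈ Finset.range s₁, h (s₁ + (r + 1) - 1 - s) * (w ^ s * u s) := by linarith
      have h5 : |h r| * (w ^ s₁ * U) = |h r * (w ^ s₁ * u s₁)| := by
        rw [abs_mul, abs_mul, abs_of_pos (pow_pos hw0 s₁), hus₁]
      rw [h5, h4]
      refine (abs_sub _ _).trans ?_
      rw [abs_neg]
      exact add_le_add (ha _) hsum2
    have hwp : 0 < w ^ s₁ := pow_pos hw0 _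
    rw [div_pow, mul_div_assoc', le_div_iff₀ hwp]
    rw [pow_add ρ s₁] at hmain
    nlinarith
  have hlim : Filter.Tendsto (fun t : ℕ => M * ρ ^ (r + 1) * (ρ / w) ^ (s₀ + t * L)) Filter.atTop
      (nhds (M * ρ ^ (r + 1) * 0)) := by
    refine Filter.Tendsto.const_mul _ ((tendsto_pow_atTop_nhds_zero_of_lt_one (by positivity)
      ((div_lt_one hw0).mpr hwρ)).comp ?_)
    refine Filter.tendsto_atTop_mono (fun t => ?_) Filter.tendsto_id
    simp only [id]
    nlinarith [Nat.le_mul_of_pos_right t hL]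
  rw [mul_zero] at hlim
  have hle : |h r| * U / 2 ≤ 0 := ge_of_tendsto' hlim key
  have hUz : U ≤ 0 := by
    by_contra hcon
    have := mul_pos hpos (not_le.mp hcon)
    linarith
  exact fun s => abs_nonpos_iff.mp ((hUmax s).trans hUz)

/-- Variation of constants for a linear recursion. -/
theorem linear_recursion_eq {n : ℕ} (R : Matrix (Fin n) (Fin n) ℝ) (e : Fin n → ℝ)
    (y : ℕ → Fin n → ℝ) (z : ℕ → ℝ) (hy : ∀ k, y (k + 1) = R.mulVec (y k) + z k • e) (k : ℕ) :
    y k = (R ^ k).mulVec (y 0) +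
      ∑ s ∈ Finset.range k, z s • (R ^ (k - 1 - s)).mulVec e := by
  induction k with
  | zero => simp
  | succ k ih =>
    rw [hy, ih, Finset.sum_range_succ, Matrix.mulVec_add, Matrix.mulVec_mulVec, ← pow_succ',
      Matrix.mulVec_sum, add_assoc]
    congr 1
    congr 1
    · refine Finset.sum_congr rfl fun s hs => ?_
      have := Finset.mem_range.mp hs
      rw [Matrix.mulVec_smul, Matrix.mulVec_mulVec, ← pow_succ',
        show k - 1 - s + 1 = k + 1 - 1 - s by omega]
    · simp

/-- The realization `R` lives on the set `W` of states, and is observable there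
through the measured states `f i`. -/
structure ObservableOn {m n : ℕ} (A : Matrix (Fin n) (Fin n) ℕ) (f : Fin m → Fin n)
    (W : Finset (Fin n)) (R : Matrix (Fin n) (Fin n) ℝ) : Prop where
  real : IsRealization A R
  supp : ∀ i j, R i j ≠ 0 → i ∈ W ∧ j ∈ W
  obs : ∀ x : Fin n → ℝ, (∀ j, j ∉ W → x j = 0) →
    (∀ (k : ℕ) (i : Fin m), ((R ^ k).mulVec x) (f i) = 0) → x = 0

open Classical in
/-- A cycle `Z` with all weights equal to `w`, attached to `R` by feeding the state `j` of the
cycle into the states where `e` is nonzero. -/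
noncomputable def attachCycle {n : ℕ} (R : Matrix (Fin n) (Fin n) ℝ) (σ : Equiv.Perm (Fin n))
    (Z : Finset (Fin n)) (w : ℝ) (e : Fin n → ℝ) (j : Fin n) : Matrix (Fin n) (Fin n) ℝ :=
  fun a b => R a b + (if b ∈ Z ∧ a = σ b then w else 0) + (if b = j then e a else 0)

theorem attachCycle_mulVec {n : ℕ} (R : Matrix (Fin n) (Fin n) ℝ) (σ : Equiv.Perm (Fin n))
    (Z : Finset (Fin n)) (w : ℝ) (e : Fin n → ℝ) (j : Fin n) (x : Fin n → ℝ) (a : Fin n) :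
    (attachCycle R σ Z w e j).mulVec x a =
      R.mulVec x a + (if σ.symm a ∈ Z then w * x (σ.symm a) else 0) + x j * e a := by
  classical
  have h2 : ∑ b, (if b ∈ Z ∧ a = σ b then w else 0) * x b =
      if σ.symm a ∈ Z then w * x (σ.symm a) else 0 := by
    rw [Finset.sum_eq_single (σ.symm a)]
    · simp
    · intro b _ hb
      have : ¬ a = σ b := fun h => hb (by simp [h])
      simp [this]
    · simp
  have h3 : ∑ b, (if b = j then e a else 0) * x b = x j * e a := by
    simp [mul_comm]
  simp only [Matrix.mulVec, dotProduct, attachCycle, add_mul, Finset.sum_add_distrib, h2, h3]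

/-- Attaching a cycle keeps the pair observable, as soon as the output determines the state `j`
of the cycle at all times. In `hdet`, `w ^ s * u s` is the state `j` at time `s`, and `y` is the
initial state of the part `W`. -/
theorem ObservableOn.attachCycle {m n : ℕ} {A : Matrix (Fin n) (Fin n) ℕ} {f : Fin m → Fin n}
    {W : Finset (Fin n)} {R : Matrix (Fin n) (Fin n) ℝ} (hR : ObservableOn A f W R)
    {σ : Equiv.Perm (Fin n)} (hσ : ∀ j, A (σ j) j ≠ 0) {Z : Finset (Fin n)} {j : Fin n}
    (hZ : ∀ c, c ∈ Z ↔ σ.SameCycle j c) (hdisj : ∀ c ∈ Z, c ∉ W) {w : ℝ}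
    {e : Fin n → ℝ} (he : ∀ a, e a ≠ 0 → a ∈ W ∧ A a j ≠ 0)
    (hdet : ∀ (u : ℕ → ℝ) (y : Fin n → ℝ), (∀ s, u (s + orderOf σ) = u s) →
      (∀ (k : ℕ) (i : Fin m), f i ∈ W → ((R ^ k).mulVec y) (f i) + ∑ s ∈ Finset.range k,
        ((R ^ (k - 1 - s)).mulVec e) (f i) * (w ^ s * u s) = 0) →
      (∀ (k : ℕ) (i : Fin m), f i = j → w ^ k * u k = 0) → ∀ s, u s = 0) :
    ObservableOn A f (W ∪ Z) (SensingLSAP.attachCycle R σ Z w e j) := by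
  classical
  have hσZ : ∀ b, b ∈ Z ↔ σ b ∈ Z := fun b => by
    rw [hZ, hZ, Equiv.Perm.sameCycle_apply_right]
  have hσZ' : ∀ b, σ.symm b ∈ Z ↔ b ∈ Z := fun b => by
    rw [hσZ, Equiv.apply_symm_apply]
  have hjZ : j ∈ Z := (hZ j).mpr (Equiv.Perm.SameCycle.refl _ _)
  refine ⟨fun a b hab => ?_, fun a b hab => ?_, fun x hx hout => ?_⟩
  · have h1 := hR.real a b hab
    have h2 : ¬ (b ∈ Z ∧ a = σ b) := fun h => hσ b (by rw [← h.2]; exact hab)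
    have h3 : (if b = j then e a else 0) = 0 := by
      split_ifs with hbj
      · by_contra hea
        exact (he a hea).2 (hbj ▸ hab)
      · rfl
    simp [SensingLSAP.attachCycle, h1, h2, h3]
  · by_contra hcon
    apply hab
    have h1 : R a b = 0 := by
      by_contra h
      have := hR.supp a b h
      exact hcon ⟨Finset.mem_union_left _ this.1, Finset.mem_union_left _ this.2⟩
    have h2 : ¬ (b ∈ Z ∧ a = σ b) := fun h => hcon
      ⟨Finset.mem_union_right _ (h.2 ▸ (hσZ b).mp h.1), Finset.mem_union_right _ h.1⟩
    have h3 : (if b = j then e a else 0) = 0 := by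
      split_ifs with hbj
      · by_contra hea
        exact hcon ⟨Finset.mem_union_left _ (he a hea).1, Finset.mem_union_right _ (hbj ▸ hjZ)⟩
      · rfl
    simp [SensingLSAP.attachCycle, h1, h2, h3]
  · set R' := SensingLSAP.attachCycle R σ Z w e j with hR'
    set X : ℕ → Fin n → ℝ := fun k => (R' ^ k).mulVec x with hX
    have hXs : ∀ k, X (k + 1) = R'.mulVec (X k) := fun k => by
      rw [hX]; simp only; rw [pow_succ', ← Matrix.mulVec_mulVec]
    have hRrow : ∀ (v : Fin n → ℝ) a, a ∉ W → R.mulVec v a = 0 := fun v a ha => by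
      rw [Matrix.mulVec, dotProduct]
      refine Finset.sum_eq_zero fun b _ => ?_
      have : R a b = 0 := by
        by_contra h
        exact ha (hR.supp a b h).1
      rw [this, zero_mul]
    -- on the cycle the state rotates and is multiplied by `w`
    have hcyc : ∀ k, ∀ b ∈ Z, X k ((σ ^ k) b) = w ^ k * x b := by
      intro k
      induction k with
      | zero => intro b _; simp [hX]
      | succ k ih =>
        intro b hb
        have hkb : ∀ t : ℕ, (σ ^ t) b ∈ Z := fun t => by
          rw [hZ]; exact ((hZ b).mp hb).trans ⟨t, by simp⟩
        have hea : e ((σ ^ (k + 1)) b) = 0 := by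
          by_contra h
          exact hdisj _ (hkb (k + 1)) (he _ h).1
        have hs : σ.symm ((σ ^ (k + 1)) b) = (σ ^ k) b := by
          rw [pow_succ', Equiv.Perm.mul_apply, Equiv.symm_apply_apply]
        rw [hXs, attachCycle_mulVec, hRrow _ _ (hdisj _ (hkb (k + 1))), hea, hs, if_pos (hkb k),
          ih b hb]
        ring
    let u : ℕ → ℝ := fun s => x (((σ⁻¹) ^ s) j)
    have huj : ∀ k, X k j = w ^ k * u k := fun k => by
      have hmem : ((σ⁻¹) ^ k) j ∈ Z := by
        rw [hZ]; exact ⟨-(k : ℤ), by simp⟩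
      have := hcyc k _ hmem
      rwa [← Equiv.Perm.mul_apply, inv_pow, mul_inv_cancel, Equiv.Perm.one_apply,
        ← inv_pow] at this
    have huper : ∀ s, u (s + orderOf σ) = u s := fun s => by
      simp only [u, pow_add, inv_pow, pow_orderOf_eq_one, mul_one]
    -- the part of the state that lives on `W`
    let Y : ℕ → Fin n → ℝ := fun k a => if a ∈ W then X k a else 0
    have hRY : ∀ k, R.mulVec (X k) = R.mulVec (Y k) := fun k => by
      funext a
      rw [Matrix.mulVec, Matrix.mulVec, dotProduct, dotProduct]
      refine Finset.sum_congr rfl fun b _ => ?_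
      by_cases hb : b ∈ W
      · simp [Y, hb]
      · have : R a b = 0 := by
          by_contra h
          exact hb (hR.supp a b h).2
        rw [this, zero_mul, zero_mul]
    have hYs : ∀ k, Y (k + 1) = R.mulVec (Y k) + (w ^ k * u k) • e := fun k => by
      funext a
      by_cases ha : a ∈ W
      · have hna : σ.symm a ∉ Z := fun h => hdisj a ((hσZ' a).mp h) ha
        simp only [Y, if_pos ha, Pi.add_apply, Pi.smul_apply, smul_eq_mul]
        rw [hXs, attachCycle_mulVec, if_neg hna, hRY, huj]
        ring
      · have hea : e a = 0 := by
          by_contra h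
          exact ha (he _ h).1
        simp only [Y, if_neg ha, Pi.add_apply, Pi.smul_apply, smul_eq_mul, hea, hRrow _ _ ha]
        simp
    have hYk := linear_recursion_eq R e Y _ hYs
    have hu0 : ∀ s, u s = 0 := by
      refine hdet u (Y 0) huper (fun k i hi => ?_) fun k i hi => ?_
      · have h1 := congrFun (hYk k) (f i)
        have h2 : Y k (f i) = 0 := by simp only [Y, if_pos hi]; exact hout k i
        rw [h2, Pi.add_apply, Finset.sum_apply] at h1
        rw [h1]
        congr 1
        refine Finset.sum_congr rfl fun s _ => ?_
        rw [Pi.smul_apply, smul_eq_mul, mul_comm]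
      · rw [← huj, ← hi]; exact hout k i
    have hxZ : ∀ b ∈ Z, x b = 0 := fun b hb => by
      obtain ⟨t, ht⟩ := ((Equiv.Perm.sameCycle_inv).mpr ((hZ b).mp hb)).exists_nat_pow_eq
      have := hu0 t
      simp only [u] at this
      rwa [ht] at this
    refine hR.obs x (fun b hb => ?_) fun k i => ?_
    · by_cases hbZ : b ∈ Z
      · exact hxZ b hbZ
      · exact hx b (by simp [hb, hbZ])
    · have hY0 : Y 0 = x := by
        funext b
        by_cases hb : b ∈ W
        · simp [Y, hb, hX]
        · by_cases hbZ : b ∈ Z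
          · simp [Y, hb, hxZ b hbZ]
          · simp only [Y, if_neg hb]; exact (hx b (by simp [hb, hbZ])).symm
      have h1 := hYk k
      rw [hY0] at h1
      simp only [hu0, mul_zero, zero_smul, Finset.sum_const_zero, add_zero] at h1
      rw [← h1]
      by_cases hi : f i ∈ W
      · simp only [Y, if_pos hi]; exact hout k i
      · simp only [Y, if_neg hi]


/-- If a family of disjoint cycles spans the states and every state reaches a measured state, then
some realization is observable: the cycles can be attached one at a time, each of them either
through a measured state of its own or through an edge into the part built so far. -/
theorem exists_realization_observable {m n : ℕ} {A : Matrix (Fin n) (Fin n) ℕ}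
    (f : Fin m → Fin n) (hA : StructurallyCyclic A) (hf : ∀ x, ∃ i, Reaches A x (f i)) :
    ∃ R, IsRealization A R ∧
      ∀ x : Fin n → ℝ, (∀ (k : ℕ) (i : Fin m), ((R ^ k).mulVec x) (f i) = 0) → x = 0 := by
  classical
  obtain ⟨σ, hσ⟩ := hA
  -- a largest part of the system that is a union of cycles and can be made observable
  let good : Finset (Finset (Fin n)) := Finset.univ.filter fun W =>
    (∀ j, j ∈ W ↔ σ j ∈ W) ∧ ∃ R, ObservableOn A f W R
  have hgood : good.Nonempty := by
    refine ⟨∅, Finset.mem_filter.mpr ⟨Finset.mem_univ _, by simp, 0, fun _ _ _ => rfl, ?_, ?_⟩⟩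
    · intro i j h; exact absurd rfl h
    · intro x hx _; funext j; exact hx j (by simp)
  obtain ⟨W, hW, hmax⟩ := Finset.exists_max_image good Finset.card hgood
  obtain ⟨-, hWσ, R, hR⟩ := Finset.mem_filter.mp hW
  by_cases hall : ∀ x, x ∈ W
  · exact ⟨R, hR.real, fun x hx => hR.obs x (fun j hj => absurd (hall j) hj) hx⟩
  exfalso
  push Not at hall
  have hWpow : ∀ (t : ℕ) b, b ∈ W ↔ (σ ^ t) b ∈ W := by
    intro t
    induction t with
    | zero => simp
    | succ t ih => intro b; rw [pow_succ', Equiv.Perm.mul_apply, ← hWσ, ← ih]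
  -- it suffices to attach one more cycle
  have extend : ∀ (j : Fin n) (w : ℝ) (e : Fin n → ℝ), j ∉ W →
      (∀ Z : Finset (Fin n), (∀ c, c ∈ Z ↔ σ.SameCycle j c) → (∀ c ∈ Z, c ∉ W) →
        ObservableOn A f (W ∪ Z) (attachCycle R σ Z w e j)) → False := by
    intro j w e hj hobs
    let Z : Finset (Fin n) := Finset.univ.filter fun c => σ.SameCycle j c
    have hZ : ∀ c, c ∈ Z ↔ σ.SameCycle j c := fun c => by simp [Z]
    have hdisj : ∀ c ∈ Z, c ∉ W := fun c hc hcW => by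
      obtain ⟨t, rfl⟩ := ((hZ c).mp hc).exists_nat_pow_eq
      exact hj ((hWpow t j).mpr hcW)
    have hmem : W ∪ Z ∈ good := by
      refine Finset.mem_filter.mpr ⟨Finset.mem_univ _, fun b => ?_, _, hobs Z hZ hdisj⟩
      rw [Finset.mem_union, Finset.mem_union, ← hWσ, hZ, hZ, Equiv.Perm.sameCycle_apply_right]
    have hcard := hmax _ hmem
    have hlt : W.card < (W ∪ Z).card := Finset.card_lt_card
      ⟨Finset.subset_union_left, fun h => hj (h (Finset.mem_union_right _
        ((hZ j).mpr (Equiv.Perm.SameCycle.refl _ _))))⟩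
    omega
  -- a cycle with a measured state is attached without any edge into `W`
  by_cases hmeas : ∃ i, f i ∉ W
  · obtain ⟨i, hi⟩ := hmeas
    refine extend (f i) 1 0 hi fun Z hZ hdisj => hR.attachCycle hσ hZ hdisj (by simp) ?_
    intro u y _ _ hu s
    simpa using hu s i rfl
  push Not at hmeas
  obtain ⟨x, hx⟩ := hall
  -- a path from outside to a measured state enters `W`
  obtain ⟨j, a, hj, ha, hja⟩ : ∃ j a, j ∉ W ∧ a ∈ W ∧ Edge A j a := by
    obtain ⟨i, hi⟩ := hf x
    by_contra! hno
    have : ∀ y, Reaches A x y → y ∉ W := by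
      intro y hy
      induction hy with
      | refl => exact hx
      | tail _ hbc ih => exact fun hc => hno _ _ ih hc hbc
    exact this _ hi (hmeas i)
  let e : Fin n → ℝ := Pi.single a 1
  have hesupp : ∀ b, e b ≠ 0 → b = a := fun b hb => by
    by_contra h
    exact hb (by simp [e, h])
  obtain ⟨ρ, hρ, hbound⟩ := exists_norm_pow_mulVec_le R
  -- the input at `a` is visible at some measured state
  obtain ⟨i, r, hir⟩ : ∃ i r, ((R ^ r).mulVec e) (f i) ≠ 0 := by
    by_contra! h
    have h0 := hR.obs e (fun b hb => by
      by_contra hne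
      exact hb (hesupp b hne ▸ ha)) fun k i => h i k
    have := congrFun h0 a
    simp [e] at this
  have hnorm : ‖e‖ ≤ 1 := by
    rw [pi_norm_le_iff_of_nonneg zero_le_one]
    intro b
    by_cases hb : b = a
    · subst hb; simp [e]
    · simp [e, hb]
  obtain ⟨w, hw⟩ := exists_rate_forall_periodic_eq_zero
    (fun r => ((R ^ r).mulVec e) (f i)) ρ hρ (fun r => by
      have h1 := (norm_le_pi_norm ((R ^ r).mulVec e) (f i)).trans (hbound r e)
      rw [Real.norm_eq_abs] at h1
      have : 0 ≤ ρ ^ r := by positivity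
      nlinarith) ⟨r, hir⟩
  refine extend j w e hj fun Z hZ hdisj => hR.attachCycle hσ hZ hdisj ?_ ?_
  · intro b hb
    rw [hesupp b hb]
    exact ⟨ha, hja⟩
  · intro u y hu hy _
    refine hw (fun k => ((R ^ k).mulVec y) (f i)) u ‖y‖ (orderOf σ) (orderOf_pos σ) hu (fun k => ?_)
      fun k => hy k i (hmeas i)
    rw [mul_comm]
    exact (norm_le_pi_norm ((R ^ k).mulVec y) (f i)).trans (hbound k y)

/-! ### Parent components -/

theorem IsParentSCC.nonempty {n : ℕ} {A : Matrix (Fin n) (Fin n) ℕ} {S : Set (Fin n)}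
    (hS : IsParentSCC A S) : S.Nonempty := by
  obtain ⟨⟨x, rfl⟩, -⟩ := hS
  exact ⟨x, Relation.ReflTransGen.refl, Relation.ReflTransGen.refl⟩

theorem IsSCC.eq_of_mem {n : ℕ} {A : Matrix (Fin n) (Fin n) ℕ} {S : Set (Fin n)}
    (hS : IsSCC A S) {y : Fin n} (hy : y ∈ S) : S = {z | Reaches A y z ∧ Reaches A z y} := by
  obtain ⟨x, rfl⟩ := hS
  ext z
  exact ⟨fun h => ⟨hy.2.trans h.1, h.2.trans hy.1⟩, fun h => ⟨hy.1.trans h.1, h.2.trans hy.2⟩⟩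

theorem IsSCC.eq_of_mem_of_mem {n : ℕ} {A : Matrix (Fin n) (Fin n) ℕ} {S T : Set (Fin n)}
    (hS : IsSCC A S) (hT : IsSCC A T) {y : Fin n} (hyS : y ∈ S) (hyT : y ∈ T) : S = T := by
  rw [hS.eq_of_mem hyS, hT.eq_of_mem hyT]

/-- The component of a state is a parent component if everything it reaches reaches it back. -/
theorem isParentSCC_of_forall_reaches {n : ℕ} {A : Matrix (Fin n) (Fin n) ℕ} {y : Fin n}
    (h : ∀ z, Reaches A y z → Reaches A z y) :
    IsParentSCC A {z | Reaches A y z ∧ Reaches A z y} := by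
  refine ⟨⟨y, rfl⟩, fun i hi j hj hij => hj ?_⟩
  have : Reaches A y j := hi.1.tail hij
  exact ⟨this, h j this⟩

theorem IsParentSCC.reaches_iff {n : ℕ} {A : Matrix (Fin n) (Fin n) ℕ} {S : Set (Fin n)}
    (hS : IsParentSCC A S) {x y : Fin n} (hx : x ∈ S) : Reaches A x y ↔ y ∈ S := by
  refine ⟨fun h => ?_, fun h => ?_⟩
  · induction h with
    | refl => exact hx
    | tail _ hbc ih => by_contra hc; exact hS.2 _ ih _ hc hbc
  · rw [hS.1.eq_of_mem hx] at h
    exact h.1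

/-- Every state reaches a parent component: a reachable state with fewest descendants lies in
one. -/
theorem exists_isParentSCC_reaches {n : ℕ} (A : Matrix (Fin n) (Fin n) ℕ) (x : Fin n) :
    ∃ S, IsParentSCC A S ∧ ∀ y ∈ S, Reaches A x y := by
  classical
  let D : Fin n → Finset (Fin n) := fun y => Finset.univ.filter (Reaches A y)
  have hD : ∀ a b, b ∈ D a ↔ Reaches A a b := fun a b => by simp [D]
  obtain ⟨y, hy, hmin⟩ := Finset.exists_min_image (D x) (fun y => (D y).card)
    ⟨x, (hD x x).mpr Relation.ReflTransGen.refl⟩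
  have hxy : Reaches A x y := (hD x y).mp hy
  refine ⟨_, isParentSCC_of_forall_reaches (y := y) fun z hz => ?_, fun z hz => hxy.trans hz.1⟩
  have hsub : D z ⊆ D y := fun a ha => (hD y a).mpr (hz.trans ((hD z a).mp ha))
  have heq := Finset.eq_of_subset_of_card_le hsub (hmin z ((hD x z).mpr (hxy.trans hz)))
  refine (hD z y).mp ?_
  rw [heq]
  exact (hD y y).mpr Relation.ReflTransGen.refl

/-! ### Single-measurement structures -/

/-- The `0/1` matrix with exactly one `1` in each row, in column `f i` of row `i`. -/
def selectionMatrix {m n : ℕ} (f : Fin m → Fin n) : Matrix (Fin m) (Fin n) ℕ :=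
  fun i l => if f i = l then 1 else 0

theorem isZeroOne_selectionMatrix {m n : ℕ} (f : Fin m → Fin n) :
    IsZeroOne (selectionMatrix f) := fun i l => by
  unfold selectionMatrix; split_ifs <;> simp

theorem sum_selectionMatrix {m n : ℕ} (f : Fin m → Fin n) (i : Fin m) :
    ∑ j, selectionMatrix f i j = 1 := by
  simp [selectionMatrix]

theorem totalCost_selectionMatrix {m n : ℕ} (c : Matrix (Fin m) (Fin n) ℝ) (f : Fin m → Fin n) :
    totalCost c (selectionMatrix f) = ∑ i, c i (f i) := by
  simp [totalCost, selectionMatrix]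

theorem exists_eq_selectionMatrix {m n : ℕ} {H : Matrix (Fin m) (Fin n) ℕ} (h01 : IsZeroOne H)
    (hrow : ∀ i, ∑ j, H i j = 1) : ∃ f, H = selectionMatrix f := by
  have : ∀ i, ∃ j, H i j = 1 := fun i => by
    by_contra! hno
    have h0 : ∑ j, H i j = 0 := Finset.sum_eq_zero fun j _ => (h01 i j).resolve_right (hno j)
    rw [hrow i] at h0
    exact one_ne_zero h0
  choose f hf using this
  refine ⟨f, ?_⟩
  funext i l
  unfold selectionMatrix
  split_ifs with hl
  · rw [← hl, hf]
  · refine (h01 i l).resolve_right fun h1 => ?_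
    have h2 : ∑ j ∈ {f i, l}, H i j ≤ ∑ j, H i j :=
      Finset.sum_le_sum_of_subset (Finset.subset_univ _)
    rw [Finset.sum_pair hl, hrow, hf, h1] at h2
    omega

theorem sum_selectionMatrix_le_one {m n : ℕ} {f : Fin m → Fin n} (hf : Function.Injective f)
    (j : Fin n) : ∑ i, selectionMatrix f i j ≤ 1 := by
  by_cases h : ∃ i, f i = j
  · obtain ⟨i, rfl⟩ := h
    simp [selectionMatrix, hf.eq_iff]
  · push Not at h
    simp [selectionMatrix, h]

theorem mem_lsapFeasible_iff {m : ℕ} {Z : Matrix (Fin m) (Fin m) ℕ} :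
    Z ∈ lsapFeasible m ↔ ∃ π : Equiv.Perm (Fin m), Z = selectionMatrix π := by
  constructor
  · rintro ⟨h01, hrow, hcol⟩
    obtain ⟨f, rfl⟩ := exists_eq_selectionMatrix h01 hrow
    have hsurj : Function.Surjective f := fun j => by
      by_contra! hno
      have := hcol j
      simp [selectionMatrix, hno] at this
    exact ⟨Equiv.ofBijective f (Finite.injective_iff_bijective.mp
      (Finite.injective_iff_surjective.mpr hsurj)), rfl⟩
  · rintro ⟨π, rfl⟩
    refine ⟨isZeroOne_selectionMatrix _, sum_selectionMatrix _, fun j => ?_⟩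
    have : ∀ i, selectionMatrix π i j = if i = π.symm j then 1 else 0 := fun i => by
      simp only [selectionMatrix, Equiv.eq_symm_apply]
    simp [this]

/-- For a structurally full rank system, dedicated sensors suffice for structural observability
exactly if every parent component contains a measured state. -/
theorem structurallyObservable_selectionMatrix_iff {m n : ℕ} {A : Matrix (Fin n) (Fin n) ℕ}
    (hA : StructurallyFullRank A) (f : Fin m → Fin n) :
    StructurallyObservable A (selectionMatrix f) ↔ ∀ S, IsParentSCC A S → ∃ i, f i ∈ S := by
  constructor
  · intro h S hS
    obtain ⟨i, l, hl, hne⟩ := h.exists_measured hS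
    refine ⟨i, ?_⟩
    have : f i = l := by
      by_contra h
      exact hne (by simp [selectionMatrix, h])
    rwa [this]
  · intro h
    obtain ⟨R, hR, hobs⟩ := exists_realization_observable f
      ((structurallyFullRank_iff_structurallyCyclic A).mp hA) fun x => by
        obtain ⟨S, hS, hx⟩ := exists_isParentSCC_reaches A x
        obtain ⟨i, hi⟩ := h S hS
        exact ⟨i, hx _ hi⟩
    refine ⟨R, fun i l => (selectionMatrix f i l : ℝ), hR, fun i j h => by simp [h], ?_⟩
    intro x hx
    refine hobs x fun k i => ?_
    have := congrFun (hx k) i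
    simpa [Matrix.mulVec, dotProduct, selectionMatrix] using this

theorem mem_measurementSet_iff {m n : ℕ} {A : Matrix (Fin n) (Fin n) ℕ}
    (hA : StructurallyFullRank A) {H : Matrix (Fin m) (Fin n) ℕ} :
    H ∈ measurementSet A m ↔
      ∃ f, H = selectionMatrix f ∧ ∀ S, IsParentSCC A S → ∃ i, f i ∈ S := by
  constructor
  · rintro ⟨h01, hrow, hobs⟩
    obtain ⟨f, rfl⟩ := exists_eq_selectionMatrix h01 hrow
    exact ⟨f, rfl, (structurallyObservable_selectionMatrix_iff hA f).mp hobs⟩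
  · rintro ⟨f, rfl, hf⟩
    exact ⟨isZeroOne_selectionMatrix f, sum_selectionMatrix f,
      (structurallyObservable_selectionMatrix_iff hA f).mpr hf⟩

/-- The minimum number of sensors is the number of parent components. -/
theorem ncard_parentSCC {m n : ℕ} {A : Matrix (Fin n) (Fin n) ℕ}
    (hA : StructurallyFullRank A) (hm : IsMinSensorNumber A m) :
    {S : Set (Fin n) | IsParentSCC A S}.ncard = m := by
  classical
  let P := {S : Set (Fin n) | IsParentSCC A S}
  let e : P ≃ Fin P.ncard := Finite.equivFin P
  apply le_antisymm
  · obtain ⟨H, hH⟩ := hm.1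
    obtain ⟨f, -, hf⟩ := (mem_measurementSet_iff hA).mp hH
    choose g hg using fun S : P => hf S.1 S.2
    have hinj : Function.Injective g := fun S T h => by
      refine Subtype.ext (S.2.1.eq_of_mem_of_mem T.2.1 (hg S) ?_)
      rw [h]; exact hg T
    have := Nat.card_le_card_of_injective g hinj
    rwa [Nat.card_fin] at this
  · choose r hr using fun S : P => S.2.nonempty
    refine hm.2 ⟨selectionMatrix fun i => r (e.symm i), (mem_measurementSet_iff hA).mpr
      ⟨_, rfl, fun S hS => ⟨e ⟨S, hS⟩, ?_⟩⟩⟩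
    rw [Equiv.symm_apply_apply]
    exact hr ⟨S, hS⟩

/-! ### Equivalence with the assignment problem -/

section Equivalence

variable {m n : ℕ} {A : Matrix (Fin n) (Fin n) ℕ} {S : Fin m → Set (Fin n)}

theorem eq_of_mem_enumeration (hinj : Function.Injective S)
    (hS : Set.range S = {T : Set (Fin n) | IsParentSCC A T}) {x : Fin n} {j k : Fin m}
    (hj : x ∈ S j) (hk : x ∈ S k) : j = k := by
  have h : ∀ j, IsParentSCC A (S j) := fun j => hS.subset (Set.mem_range_self j)
  exact hinj ((h j).1.eq_of_mem_of_mem (h k).1 hj hk)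

theorem mem_measurementSet_iff_perm (hA : StructurallyFullRank A) (hinj : Function.Injective S)
    (hS : Set.range S = {T : Set (Fin n) | IsParentSCC A T}) {H : Matrix (Fin m) (Fin n) ℕ} :
    H ∈ measurementSet A m ↔
      ∃ (f : Fin m → Fin n) (π : Equiv.Perm (Fin m)), H = selectionMatrix f ∧
        ∀ i, f i ∈ S (π i) := by
  rw [mem_measurementSet_iff hA]
  constructor
  · rintro ⟨f, rfl, hf⟩
    choose g hg using fun j => hf (S j) (hS.subset (Set.mem_range_self j))
    have hgi : Function.Injective g := fun j k h =>
      eq_of_mem_enumeration hinj hS (hg j) (by rw [h]; exact hg k)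
    let π := (Equiv.ofBijective g (Finite.injective_iff_bijective.mp hgi)).symm
    refine ⟨f, π, rfl, fun i => ?_⟩
    have h1 := hg (π i)
    have h2 : g (π i) = i := Equiv.ofBijective_apply_symm_apply g _ i
    rwa [h2] at h1
  · rintro ⟨f, π, rfl, hf⟩
    refine ⟨f, rfl, fun T hT => ?_⟩
    obtain ⟨j, rfl⟩ := hS.superset hT
    refine ⟨π.symm j, ?_⟩
    have := hf (π.symm j)
    rwa [Equiv.apply_symm_apply] at this

theorem measurementSet_eq_sensingFeasible (hA : StructurallyFullRank A)
    (hinj : Function.Injective S) (hS : Set.range S = {T : Set (Fin n) | IsParentSCC A T}) :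
    measurementSet A m = sensingFeasible A m := by
  ext H
  constructor
  · intro hH
    obtain ⟨f, π, rfl, hf⟩ := (mem_measurementSet_iff_perm hA hinj hS).mp hH
    refine ⟨hH.1, sum_selectionMatrix_le_one fun i k h => ?_, hH.2.1, hH.2.2⟩
    exact π.injective (eq_of_mem_enumeration hinj hS (hf i) (h ▸ hf k))
  · exact fun hH => ⟨hH.1, hH.2.2.1, hH.2.2.2⟩

theorem inducedAssignment_selectionMatrix (hinj : Function.Injective S)
    (hS : Set.range S = {T : Set (Fin n) | IsParentSCC A T}) {f : Fin m → Fin n}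
    {π : Equiv.Perm (Fin m)} (hf : ∀ i, f i ∈ S (π i)) :
    inducedAssignment S (selectionMatrix f) = selectionMatrix π := by
  classical
  funext i j
  unfold inducedAssignment selectionMatrix
  rw [Finset.sum_eq_single (f i)]
  · by_cases h : π i = j
    · simp [← h, hf i]
    · have : f i ∉ S j := fun hj => h (eq_of_mem_enumeration hinj hS (hf i) hj)
      simp [this, h]
  · intro l _ hl
    simp [hl.symm]
  · simp

theorem isLeast_sccCost (hS : Set.range S = {T : Set (Fin n) | IsParentSCC A T})
    (c : Matrix (Fin m) (Fin n) ℝ) (i j : Fin m) : IsLeast (c i '' S j) (sccCost c S i j) := by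
  have hP : IsParentSCC A (S j) := hS.subset (Set.mem_range_self j)
  have hfin : (c i '' S j).Finite := (Set.toFinite _).image _
  exact ⟨(hP.nonempty.image _).csInf_mem hfin, fun y hy => csInf_le hfin.bddBelow hy⟩

theorem measureSelected_selectionMatrix (ℓ : Fin m → Fin m → Fin n) (π : Fin m → Fin m) :
    measureSelected ℓ (selectionMatrix π) = selectionMatrix fun i => ℓ i (π i) := by
  funext i l
  unfold measureSelected selectionMatrix
  rw [Finset.sum_eq_single (π i)]
  · simp
  · intro j _ hj; simp [hj.symm]
  · simp

/-- Inducing an assignment does not increase the cost. -/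
theorem inducedAssignment_mem_and_le (hA : StructurallyFullRank A)
    (hinj : Function.Injective S) (hS : Set.range S = {T : Set (Fin n) | IsParentSCC A T})
    (c : Matrix (Fin m) (Fin n) ℝ) {H : Matrix (Fin m) (Fin n) ℕ} (hH : H ∈ sensingFeasible A m) :
    inducedAssignment S H ∈ lsapFeasible m ∧
      totalCost (sccCost c S) (inducedAssignment S H) ≤ totalCost c H := by
  rw [← measurementSet_eq_sensingFeasible hA hinj hS] at hH
  obtain ⟨f, π, rfl, hf⟩ := (mem_measurementSet_iff_perm hA hinj hS).mp hH
  rw [inducedAssignment_selectionMatrix hinj hS hf]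
  refine ⟨mem_lsapFeasible_iff.mpr ⟨π, rfl⟩, ?_⟩
  rw [totalCost_selectionMatrix, totalCost_selectionMatrix]
  exact Finset.sum_le_sum fun i _ => (isLeast_sccCost hS c i (π i)).2 ⟨f i, hf i, rfl⟩

/-- Cheapest states realize an assignment at the same cost. -/
theorem measureSelected_mem_and_eq (hA : StructurallyFullRank A)
    (hinj : Function.Injective S) (hS : Set.range S = {T : Set (Fin n) | IsParentSCC A T})
    (c : Matrix (Fin m) (Fin n) ℝ) {ℓ : Fin m → Fin m → Fin n}
    (hℓ : ∀ i j, ℓ i j ∈ S j ∧ c i (ℓ i j) = sccCost c S i j) {Z : Matrix (Fin m) (Fin m) ℕ}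
    (hZ : Z ∈ lsapFeasible m) :
    measureSelected ℓ Z ∈ sensingFeasible A m ∧
      inducedAssignment S (measureSelected ℓ Z) = Z ∧
      totalCost c (measureSelected ℓ Z) = totalCost (sccCost c S) Z := by
  obtain ⟨π, rfl⟩ := mem_lsapFeasible_iff.mp hZ
  have hf : ∀ i, (fun i => ℓ i (π i)) i ∈ S (π i) := fun i => (hℓ i (π i)).1
  rw [measureSelected_selectionMatrix, ← measurementSet_eq_sensingFeasible hA hinj hS]
  refine ⟨(mem_measurementSet_iff_perm hA hinj hS).mpr ⟨_, π, rfl, hf⟩,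
    inducedAssignment_selectionMatrix hinj hS hf, ?_⟩
  rw [totalCost_selectionMatrix, totalCost_selectionMatrix]
  exact Finset.sum_congr rfl fun i _ => (hℓ i (π i)).2

theorem exists_cheapest (hS : Set.range S = {T : Set (Fin n) | IsParentSCC A T})
    (c : Matrix (Fin m) (Fin n) ℝ) :
    ∃ ℓ : Fin m → Fin m → Fin n, ∀ i j, ℓ i j ∈ S j ∧ c i (ℓ i j) = sccCost c S i j := by
  choose ℓ hℓ using fun i j => (isLeast_sccCost hS c i j).1
  exact ⟨ℓ, hℓ⟩

end Equivalence

/-- Two minimization problems with cost-nonincreasing maps `Φ` and `Ψ` between their feasible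
sets, `Ψ` preserving the cost and being a section of `Φ`, have corresponding optima. -/
theorem argminSet_correspondence {α β : Type*} {F : Set α} {G : Set β} {f : α → ℝ} {g : β → ℝ}
    {Φ : α → β} {Ψ : β → α} (hΦ : ∀ x ∈ F, Φ x ∈ G ∧ g (Φ x) ≤ f x)
    (hΨ : ∀ y ∈ G, Ψ y ∈ F ∧ Φ (Ψ y) = y ∧ f (Ψ y) = g y) :
    (∀ y ∈ G, Ψ y ∈ argminSet F f ↔ y ∈ argminSet G g) ∧
    (∀ x, x ∈ argminSet F f ↔ x ∈ F ∧ Φ x ∈ argminSet G g ∧ f x = g (Φ x)) ∧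
    (∀ v : ℝ, IsLeast (f '' F) v ↔ IsLeast (g '' G) v) := by
  refine ⟨fun y hy => ⟨fun h => ⟨hy, fun y' hy' => ?_⟩, fun h => ⟨(hΨ y hy).1, fun x hx => ?_⟩⟩,
    fun x => ⟨fun h => ⟨h.1, ⟨(hΦ x h.1).1, fun y' hy' => ?_⟩, ?_⟩, fun h => ⟨h.1, fun x' hx' => ?_⟩⟩,
    fun v => ⟨?_, ?_⟩⟩
  · rw [← (hΨ y hy).2.2, ← (hΨ y' hy').2.2]
    exact h.2 _ (hΨ y' hy').1
  · rw [(hΨ y hy).2.2]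
    exact (h.2 _ (hΦ x hx).1).trans (hΦ x hx).2
  · refine (hΦ x h.1).2.trans ?_
    rw [← (hΨ y' hy').2.2]
    exact h.2 _ (hΨ y' hy').1
  · refine le_antisymm ?_ (hΦ x h.1).2
    rw [← (hΨ _ (hΦ x h.1).1).2.2]
    exact h.2 _ (hΨ _ (hΦ x h.1).1).1
  · rw [h.2.2]
    exact (h.2.1.2 _ (hΦ x' hx').1).trans (hΦ x' hx').2
  · rintro ⟨⟨x, hx, rfl⟩, hmin⟩
    have hle : ∀ y ∈ G, f x ≤ g y := fun y hy => by
      rw [← (hΨ y hy).2.2]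
      exact hmin ⟨_, (hΨ y hy).1, rfl⟩
    refine ⟨⟨Φ x, (hΦ x hx).1, le_antisymm (hΦ x hx).2 (hle _ (hΦ x hx).1)⟩, ?_⟩
    rintro _ ⟨y, hy, rfl⟩
    exact hle y hy
  · rintro ⟨⟨y, hy, rfl⟩, hmin⟩
    refine ⟨⟨Ψ y, (hΨ y hy).1, (hΨ y hy).2.2⟩, ?_⟩
    rintro _ ⟨x, hx, rfl⟩
    exact (hmin ⟨_, (hΦ x hx).1, rfl⟩).trans (hΦ x hx).2

theorem exists_enumeration_parentSCC {m n : ℕ} {A : Matrix (Fin n) (Fin n) ℕ}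
    (hA : StructurallyFullRank A) (hm : IsMinSensorNumber A m) :
    ∃ S : Fin m → Set (Fin n), Function.Injective S ∧
      Set.range S = {T : Set (Fin n) | IsParentSCC A T} := by
  have hcard := ncard_parentSCC hA hm
  let e : Fin m ≃ {S : Set (Fin n) | IsParentSCC A S} :=
    (finCongr hcard.symm).trans (Finite.equivFin _).symm
  refine ⟨fun j => (e j).1, fun j k h => e.injective (Subtype.ext h), ?_⟩
  ext T
  constructor
  · rintro ⟨j, rfl⟩; exact (e j).2
  · intro hT; exact ⟨e.symm ⟨T, hT⟩, by simp⟩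

theorem finite_sensingFeasible {m n : ℕ} (A : Matrix (Fin n) (Fin n) ℕ) :
    (sensingFeasible A m).Finite := by
  refine (Set.finite_range (selectionMatrix : (Fin m → Fin n) → _)).subset fun H hH => ?_
  obtain ⟨f, rfl⟩ := exists_eq_selectionMatrix hH.1 hH.2.2.1
  exact ⟨f, rfl⟩

theorem argminSet_nonempty {α : Type*} {F : Set α} (hF : F.Finite) (hne : F.Nonempty)
    (f : α → ℝ) : (argminSet F f).Nonempty := by
  obtain ⟨x, hx, hmin⟩ := hF.exists_minimalFor f F hne
  exact ⟨x, hx, fun y hy => (le_total (f x) (f y)).elim id fun h => hmin hy h⟩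

/-! ### Program logic with a step count -/

/-- Started in `s`, the program `p` halts after at most `k` steps in a memory satisfying `Q`. -/
def RunsWithin (p : Prog) (s : Memory) (k : ℕ) (Q : Memory → Prop) : Prop :=
  ∃ t l, Exec p s t l ∧ l ≤ k ∧ Q t

theorem RunsWithin.mono {p : Prog} {s : Memory} {k l : ℕ} {Q R : Memory → Prop}
    (h : RunsWithin p s k Q) (hkl : k ≤ l) (hQR : ∀ t, Q t → R t) : RunsWithin p s l R := by
  obtain ⟨t, i, he, hi, hQ⟩ := h
  exact ⟨t, i, he, hi.trans hkl, hQR t hQ⟩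

theorem RunsWithin.seq {p q : Prog} {s : Memory} {k l : ℕ} {Q R : Memory → Prop}
    (hp : RunsWithin p s k Q) (hq : ∀ t, Q t → RunsWithin q t l R) :
    RunsWithin (.seq p q) s (k + l) R := by
  obtain ⟨t, i, he, hi, hQ⟩ := hp
  obtain ⟨u, j, he', hj, hR⟩ := hq t hQ
  exact ⟨u, i + j, he.seq he', add_le_add hi hj, hR⟩

theorem RunsWithin.ite {b : Test} {p q : Prog} {s : Memory} {k : ℕ} {Q : Memory → Prop}
    (hp : b.Holds s → RunsWithin p s k Q) (hq : ¬ b.Holds s → RunsWithin q s k Q) :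
    RunsWithin (.ite b p q) s (k + 1) Q := by
  by_cases hb : b.Holds s
  · obtain ⟨t, i, he, hi, hQ⟩ := hp hb
    exact ⟨t, i + 1, .iteTrue hb he, by omega, hQ⟩
  · obtain ⟨t, i, he, hi, hQ⟩ := hq hb
    exact ⟨t, i + 1, .iteFalse hb he, by omega, hQ⟩

/-- A loop whose variant `μ` decreases in every round. -/
theorem RunsWithin.loop {b : Test} {p : Prog} (I : Memory → Prop) (μ : Memory → ℕ) (c : ℕ)
    (h : ∀ s, I s → b.Holds s → RunsWithin p s c fun t => I t ∧ μ t < μ s) (s : Memory)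
    (hs : I s) : RunsWithin (.loop b p) s (μ s * (c + 1) + 1) fun t => I t ∧ ¬ b.Holds t := by
  induction hm : μ s using Nat.strong_induction_on generalizing s with
  | _ k ih =>
    by_cases hb : b.Holds s
    · obtain ⟨t, i, he, hi, hIt, hlt⟩ := h s hs hb
      obtain ⟨u, j, he', hj, hQ⟩ := ih (μ t) (by omega) t hIt rfl
      refine ⟨u, i + j + 1, .loopStep hb he he', ?_, hQ⟩
      have : (μ t + 1) * (c + 1) ≤ k * (c + 1) := Nat.mul_le_mul_right _ (by omega)
      linarith
    · exact ⟨s, 1, .loopDone hb, by omega, hs, hb⟩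

/-! ### Loop-free programs -/

/-- The program contains no loop. -/
def Prog.loopFree : Prog → Bool
  | .skip => true
  | .setInt _ _ _ _ => true
  | .setReal _ _ _ _ => true
  | .seq p q => p.loopFree && q.loopFree
  | .ite _ p q => p.loopFree && q.loopFree
  | .loop _ _ => false

/-- The largest possible step count of a loop-free program. -/
def Prog.cost : Prog → ℕ
  | .skip => 1
  | .setInt _ _ _ _ => 1
  | .setReal _ _ _ _ => 1
  | .seq p q => p.cost + q.cost
  | .ite _ p q => max p.cost q.cost + 1
  | .loop _ _ => 0

open Classical in
/-- The final memory of a loop-free program; loops are ignored. -/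
noncomputable def Prog.run : Prog → Memory → Memory
  | .skip, s => s
  | .setInt a i j e, s => s.writeInt a (i.eval s) (j.eval s) (e.eval s)
  | .setReal a i j e, s => s.writeReal a (i.eval s) (j.eval s) (e.eval s)
  | .seq p q, s => q.run (p.run s)
  | .ite b p q, s => if b.Holds s then p.run s else q.run s
  | .loop _ _, s => s

theorem RunsWithin.of_run {p : Prog} {s : Memory} {k : ℕ} {Q : Memory → Prop}
    (hp : p.loopFree = true) (hk : p.cost ≤ k) (hQ : Q (p.run s)) : RunsWithin p s k Q := by
  suffices h : ∃ l ≤ p.cost, Exec p s (p.run s) l by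
    obtain ⟨l, hl, he⟩ := h
    exact ⟨_, l, he, hl.trans hk, hQ⟩
  clear hk hQ
  induction p generalizing s with
  | skip => exact ⟨1, le_rfl, .skip s⟩
  | setInt a i j e => exact ⟨1, le_rfl, .setInt s a i j e⟩
  | setReal a i j e => exact ⟨1, le_rfl, .setReal s a i j e⟩
  | seq p q ihp ihq =>
    simp only [Prog.loopFree, Bool.and_eq_true] at hp
    obtain ⟨k, hk, he⟩ := ihp hp.1 (s := s)
    obtain ⟨l, hl, he'⟩ := ihq hp.2 (s := p.run s)
    exact ⟨k + l, add_le_add hk hl, he.seq he'⟩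
  | ite b p q ihp ihq =>
    simp only [Prog.loopFree, Bool.and_eq_true] at hp
    by_cases hb : b.Holds s
    · obtain ⟨k, hk, he⟩ := ihp hp.1 (s := s)
      refine ⟨k + 1, by simp only [Prog.cost]; omega, ?_⟩
      simp only [Prog.run, if_pos hb]
      exact .iteTrue hb he
    · obtain ⟨k, hk, he⟩ := ihq hp.2 (s := s)
      refine ⟨k + 1, by simp only [Prog.cost]; omega, ?_⟩
      simp only [Prog.run, if_neg hb]
      exact .iteFalse hb he
  | loop b p => simp [Prog.loopFree] at hp

/-! ### Frames -/

/-- The integer arrays that a program may write. -/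
def Prog.intMod : Prog → List ℕ
  | .skip => []
  | .setInt a _ _ _ => [a]
  | .setReal _ _ _ _ => []
  | .seq p q => p.intMod ++ q.intMod
  | .ite _ p q => p.intMod ++ q.intMod
  | .loop _ p => p.intMod

/-- The real arrays that a program may write. -/
def Prog.realMod : Prog → List ℕ
  | .skip => []
  | .setInt _ _ _ _ => []
  | .setReal a _ _ _ => [a]
  | .seq p q => p.realMod ++ q.realMod
  | .ite _ p q => p.realMod ++ q.realMod
  | .loop _ p => p.realMod

/-- `s` and `t` agree outside the arrays that `p` may write. -/
structure Frame (p : Prog) (s t : Memory) : Prop where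
  int : ∀ a, a ∉ p.intMod → t.int a = s.int a
  real : ∀ a, a ∉ p.realMod → t.real a = s.real a

theorem Exec.frame {p : Prog} {s t : Memory} {k : ℕ} (h : Exec p s t k) : Frame p s t := by
  induction h with
  | skip s => exact ⟨fun _ _ => rfl, fun _ _ => rfl⟩
  | setInt s a i j e =>
    refine ⟨fun b hb => ?_, fun _ _ => rfl⟩
    have : ¬ b = a := by simpa [Prog.intMod] using hb
    simp [Memory.writeInt, this]
  | setReal s a i j e =>
    refine ⟨fun _ _ => rfl, fun b hb => ?_⟩
    have : ¬ b = a := by simpa [Prog.realMod] using hb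
    simp [Memory.writeReal, this]
  | seq _ _ ih₁ ih₂ =>
    refine ⟨fun a ha => ?_, fun a ha => ?_⟩
    · simp only [Prog.intMod, List.mem_append, not_or] at ha
      rw [ih₂.int a ha.2, ih₁.int a ha.1]
    · simp only [Prog.realMod, List.mem_append, not_or] at ha
      rw [ih₂.real a ha.2, ih₁.real a ha.1]
  | iteTrue _ _ ih | iteFalse _ _ ih =>
    refine ⟨fun a ha => ih.int a ?_, fun a ha => ih.real a ?_⟩ <;>
      simp only [Prog.intMod, Prog.realMod, List.mem_append, not_or] at ha
    all_goals first | exact ha.1 | exact ha.2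
  | loopDone _ => exact ⟨fun _ _ => rfl, fun _ _ => rfl⟩
  | loopStep _ _ _ ih₁ ih₂ =>
    exact ⟨fun a ha => (ih₂.int a ha).trans (ih₁.int a ha),
      fun a ha => (ih₂.real a ha).trans (ih₁.real a ha)⟩

/-- A frame can be added to every specification. -/
theorem RunsWithin.frame {p : Prog} {s : Memory} {k : ℕ} {Q : Memory → Prop}
    (h : RunsWithin p s k Q) : RunsWithin p s k fun t => Q t ∧ Frame p s t := by
  obtain ⟨t, l, he, hl, hQ⟩ := h
  exact ⟨t, l, he, hl, hQ, he.frame⟩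

/-! ### Scalars, vectors and counting loops -/

/-- A scalar variable: the cell `(0, 0)` of integer array `a`. -/
def IntExpr.var (a : ℕ) : IntExpr := .read a (.const 0) (.const 0)

/-- Entry `i` of a vector, kept in column `0` of integer array `a`. -/
def IntExpr.entry (a : ℕ) (i : IntExpr) : IntExpr := .read a i (.const 0)

/-- A scalar variable: the cell `(0, 0)` of real array `a`. -/
def RealExpr.var (a : ℕ) : RealExpr := .read a (.const 0) (.const 0)

/-- Entry `i` of a real vector, kept in column `0` of real array `a`. -/
def RealExpr.entry (a : ℕ) (i : IntExpr) : RealExpr := .read a i (.const 0)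

abbrev Prog.assign (a : ℕ) (e : IntExpr) : Prog := .setInt a (.const 0) (.const 0) e

abbrev Prog.assignEntry (a : ℕ) (i e : IntExpr) : Prog := .setInt a i (.const 0) e

abbrev Prog.assignReal (a : ℕ) (e : RealExpr) : Prog := .setReal a (.const 0) (.const 0) e

abbrev Prog.assignRealEntry (a : ℕ) (i : IntExpr) (e : RealExpr) : Prog := .setReal a i (.const 0) e

/-- `e < f` for integers. -/
abbrev Test.intLt (e f : IntExpr) : Test := .not (.intLe f e)

/-- `e < f` for reals. -/
abbrev Test.realLt (e f : RealExpr) : Test := .not (.realLe f e)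

/-- `e = 0` for integers. -/
abbrev Test.isZero (e : IntExpr) : Test := .intLe e (.const 0)

/-- `e = f` for integers. -/
abbrev Test.intEq (e f : IntExpr) : Test := .and (.intLe e f) (.intLe f e)

/-- Sequential composition. -/
infixr:60 " ;; " => Prog.seq

/-- The value of the integer variable `a`. -/
def Memory.var (s : Memory) (a : ℕ) : ℕ := s.int a 0 0

/-- The integer vector `a`. -/
def Memory.vec (s : Memory) (a : ℕ) : ℕ → ℕ := fun i => s.int a i 0

/-- The value of the real variable `a`. -/
def Memory.rvar (s : Memory) (a : ℕ) : ℝ := s.real a 0 0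

/-- The real vector `a`. -/
def Memory.rvec (s : Memory) (a : ℕ) : ℕ → ℝ := fun i => s.real a i 0

section Memory

variable (s : Memory) (a b i j v : ℕ) (x : ℝ) (e : IntExpr) (f : RealExpr)

@[simp] theorem IntExpr.eval_var : (IntExpr.var a).eval s = s.var a := rfl
@[simp] theorem IntExpr.eval_entry : (IntExpr.entry a e).eval s = s.vec a (e.eval s) := rfl
@[simp] theorem RealExpr.eval_var : (RealExpr.var a).eval s = s.rvar a := rfl
@[simp] theorem RealExpr.eval_entry : (RealExpr.entry a e).eval s = s.rvec a (e.eval s) := rfl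

@[simp] theorem IntExpr.eval_const : (IntExpr.const i).eval s = i := rfl
@[simp] theorem IntExpr.eval_succ : (IntExpr.succ e).eval s = e.eval s + 1 := rfl
@[simp] theorem IntExpr.eval_pred : (IntExpr.pred e).eval s = e.eval s - 1 := rfl
@[simp] theorem IntExpr.eval_read (e' : IntExpr) :
    (IntExpr.read a e e').eval s = s.int a (e.eval s) (e'.eval s) := rfl
@[simp] theorem RealExpr.eval_zero : RealExpr.zero.eval s = 0 := rfl
@[simp] theorem RealExpr.eval_add (g : RealExpr) :
    (RealExpr.add f g).eval s = f.eval s + g.eval s := rfl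
@[simp] theorem RealExpr.eval_sub (g : RealExpr) :
    (RealExpr.sub f g).eval s = f.eval s - g.eval s := rfl
@[simp] theorem RealExpr.eval_read (e' : IntExpr) :
    (RealExpr.read a e e').eval s = s.real a (e.eval s) (e'.eval s) := rfl

theorem Memory.writeInt_int_ne {a b : ℕ} (h : b ≠ a) : (s.writeInt a i j v).int b = s.int b := by
  simp [Memory.writeInt, h]

theorem Memory.writeInt_var_ne {a b : ℕ} (h : b ≠ a) : (s.writeInt a i j v).var b = s.var b := by
  simp [Memory.writeInt, Memory.var, h]

theorem Memory.writeInt_vec_ne {a b : ℕ} (h : b ≠ a) : (s.writeInt a i j v).vec b = s.vec b := by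
  funext k
  simp [Memory.writeInt, Memory.vec, h]

@[simp] theorem Memory.writeInt_var : (s.writeInt a 0 0 v).var a = v := by
  simp [Memory.writeInt, Memory.var]

@[simp] theorem Memory.writeInt_vec :
    (s.writeInt a i 0 v).vec a = Function.update (s.vec a) i v := by
  funext k
  simp [Memory.writeInt, Memory.vec, Function.update_apply]

@[simp] theorem Memory.writeInt_int : (s.writeInt a i j v).int a =
    fun i' j' => if i' = i ∧ j' = j then v else s.int a i' j' := by
  simp [Memory.writeInt]

@[simp] theorem Memory.writeInt_real : (s.writeInt a i j v).real = s.real := rfl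
@[simp] theorem Memory.writeInt_rvec : (s.writeInt a i j v).rvec b = s.rvec b := rfl
@[simp] theorem Memory.writeReal_int : (s.writeReal a i j x).int = s.int := rfl
@[simp] theorem Memory.writeReal_var : (s.writeReal a i j x).var b = s.var b := rfl
@[simp] theorem Memory.writeReal_vec : (s.writeReal a i j x).vec b = s.vec b := rfl

theorem Memory.writeReal_rvar_ne {a b : ℕ} (h : b ≠ a) :
    (s.writeReal a i j x).rvar b = s.rvar b := by
  simp [Memory.writeReal, Memory.rvar, h]

theorem Memory.writeReal_rvec_ne {a b : ℕ} (h : b ≠ a) :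
    (s.writeReal a i j x).rvec b = s.rvec b := by
  funext k
  simp [Memory.writeReal, Memory.rvec, h]

@[simp] theorem Memory.writeReal_rvar_self : (s.writeReal a 0 0 x).rvar a = x := by
  simp [Memory.writeReal, Memory.rvar]

@[simp] theorem Memory.writeReal_rvec_self :
    (s.writeReal a i 0 x).rvec a = Function.update (s.rvec a) i x := by
  funext k
  simp [Memory.writeReal, Memory.rvec, Function.update_apply]

@[simp] theorem Memory.writeReal_real_self : (s.writeReal a i j x).real a =
    fun i' j' => if i' = i ∧ j' = j then x else s.real a i' j' := by
  simp [Memory.writeReal]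

end Memory

attribute [simp] Memory.writeInt_int_ne Memory.writeInt_var_ne Memory.writeInt_vec_ne
attribute [simp] Memory.writeReal_rvar_ne Memory.writeReal_rvec_ne

theorem Frame.var {p : Prog} {s t : Memory} (h : Frame p s t) (a : ℕ) (ha : a ∉ p.intMod) :
    t.var a = s.var a := by
  rw [Memory.var, h.int a ha, Memory.var]

theorem Frame.vec {p : Prog} {s t : Memory} (h : Frame p s t) (a : ℕ) (ha : a ∉ p.intMod) :
    t.vec a = s.vec a := by
  funext k
  simp only [Memory.vec, h.int a ha]

theorem Frame.rvar {p : Prog} {s t : Memory} (h : Frame p s t) (a : ℕ) (ha : a ∉ p.realMod) :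
    t.rvar a = s.rvar a := by
  rw [Memory.rvar, h.real a ha, Memory.rvar]

theorem Frame.rvec {p : Prog} {s t : Memory} (h : Frame p s t) (a : ℕ) (ha : a ∉ p.realMod) :
    t.rvec a = s.rvec a := by
  funext k
  simp only [Memory.rvec, h.real a ha]

/-- `for v := 0, …, B - 1 do p`, where the bound is the value of the variable `B`. -/
abbrev Prog.forUpTo (v B : ℕ) (p : Prog) : Prog :=
  .assign v (.const 0) ;; .loop (.intLt (.var v) (.var B)) (p ;; .assign v (.succ (.var v)))

/-- Rule for counting loops: `I i` holds before the round with counter value `i`. The arrays that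
the loop does not write stay as they are in the initial memory. -/
theorem RunsWithin.forUpTo {v B : ℕ} {p : Prog} {s : Memory} {N : ℕ} (I : ℕ → Memory → Prop)
    (c : ℕ) (hN : s.var B = N) (hB : B ∉ (Prog.forUpTo v B p).intMod) (hv : v ∉ p.intMod)
    (h0 : I 0 (s.writeInt v 0 0 0))
    (hstep : ∀ i < N, ∀ t, Frame (Prog.forUpTo v B p) s t → t.var v = i → I i t →
      RunsWithin p t c fun t' => I (i + 1) (t'.writeInt v 0 0 (i + 1))) :
    RunsWithin (Prog.forUpTo v B p) s (N * (c + 2) + 2)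
      fun t => I N t ∧ Frame (Prog.forUpTo v B p) s t := by
  let J : Memory → Prop := fun t =>
    I (t.var v) t ∧ t.var v ≤ N ∧ Frame (Prog.forUpTo v B p) s t
  have hBN : ∀ t, Frame (Prog.forUpTo v B p) s t → t.var B = N := fun t ht => by
    rw [ht.var B hB, hN]
  have hloop := RunsWithin.loop (b := .intLt (.var v) (.var B))
    (p := p ;; .assign v (.succ (.var v))) J (fun t => N - t.var v) (c + 1) (fun t ht hb => by
      have hlt : t.var v < N := by
        have := not_le.mp hb
        simpa [hBN t ht.2.2] using this
      refine ((hstep _ hlt t ht.2.2 rfl ht.1).frame.seq (l := 1) fun t' ht' => ?_)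
      have hv' : t'.var v = t.var v := ht'.2.var v hv
      refine RunsWithin.of_run rfl le_rfl ?_
      have hrun : (Prog.assign v (.succ (.var v))).run t' = t'.writeInt v 0 0 (t.var v + 1) := by
        rw [← hv']; rfl
      rw [hrun]
      refine ⟨⟨by simpa using ht'.1, by simpa using hlt, ⟨fun a ha => ?_, fun a ha => ?_⟩⟩, ?_⟩
      · have h1 : a ≠ v := fun h => ha (by simp [Prog.intMod, h])
        have h2 : a ∉ p.intMod := fun h => ha (by simp [Prog.intMod, h])
        rw [Memory.writeInt_int_ne _ _ _ _ h1, ht'.2.int a h2, ht.2.2.int a ha]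
      · have h2 : a ∉ p.realMod := fun h => ha (by simp [Prog.realMod, h])
        rw [Memory.writeInt_real, ht'.2.real a h2, ht.2.2.real a ha]
      · simp only [Memory.writeInt_var]; omega) (s.writeInt v 0 0 0) ⟨by simpa using h0, by simp, by
        refine ⟨fun a ha => ?_, fun a ha => rfl⟩
        have h1 : a ≠ v := fun h => ha (by simp [Prog.intMod, h])
        rw [Memory.writeInt_int_ne _ _ _ _ h1]⟩
  have hinit : RunsWithin (.assign v (.const 0)) s 1 fun t => t = s.writeInt v 0 0 0 :=
    RunsWithin.of_run rfl le_rfl rfl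
  refine (hinit.seq fun t ht => by rw [ht]; exact hloop).mono ?_ fun t ht => ?_
  · simp only [Memory.writeInt_var, Nat.sub_zero]; linarith
  · have hge : N ≤ t.var v := by
      have := not_not.mp ht.2
      simpa [Test.Holds, hBN t ht.1.2.2] using this
    have : t.var v = N := le_antisymm ht.1.2.1 hge
    exact ⟨this ▸ ht.1.1, ht.1.2.2⟩

/-! ### Graph search -/

/-- The relation `E`, restricted to vertices below `n`. -/
def EdgeBelow (n : ℕ) (E : ℕ → ℕ → Prop) (x y : ℕ) : Prop := x < n ∧ y < n ∧ E x y

/-- Reachability in the graph with vertices `0, …, n - 1` and edge relation `E`. -/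
abbrev ReachBelow (n : ℕ) (E : ℕ → ℕ → Prop) : ℕ → ℕ → Prop :=
  Relation.ReflTransGen (EdgeBelow n E)

/-- Invariant of a graph search from the candidates `cand 0, …, cand (K - 1)`, in this order: a
candidate that is still unlabelled becomes the next root, and everything that is newly reached
from the root number `t` gets the label `t + 1`. The vertices `queue i`, `i < tail`, are labelled,
those with `i < head` are processed, and the first `ci` candidates are treated. -/
structure SearchInv (n : ℕ) (E : ℕ → ℕ → Prop) (K : ℕ) (cand lab queue root : ℕ → ℕ)
    (head tail cnt ci : ℕ) : Prop where
  head_le : head ≤ tail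
  ci_le : ci ≤ K
  queue_lt : ∀ i < tail, queue i < n
  queue_inj : ∀ i < tail, ∀ j < tail, queue i = queue j → i = j
  lab_ne_zero : ∀ x < n, lab x ≠ 0 ↔ ∃ i < tail, queue i = x
  closed : ∀ i < head, ∀ y < n, E (queue i) y → lab y ≠ 0 ∧ lab y ≤ lab (queue i)
  current : ∀ i, head ≤ i → i < tail → lab (queue i) = cnt
  lab_le : ∀ x < n, lab x ≤ cnt
  reach : ∀ x < n, ∀ t, lab x = t + 1 → ReachBelow n E (root t) x
  root_spec : ∃ a : ℕ → ℕ,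
    (∀ t < cnt, a t < ci ∧ cand (a t) = root t ∧ root t < n ∧ lab (root t) = t + 1) ∧
    ∀ t < cnt, ∀ t' < t, a t' < a t
  cand_done : ∀ i < ci, lab (cand i) ≠ 0

namespace SearchInv

variable {n : ℕ} {E : ℕ → ℕ → Prop} {K : ℕ} {cand lab queue root : ℕ → ℕ} {head tail cnt ci : ℕ}

theorem init (h : ∀ x < n, lab x = 0) : SearchInv n E K cand lab queue root 0 0 0 0 where
  head_le := le_rfl
  ci_le := Nat.zero_le _
  queue_lt := by simp
  queue_inj := by simp
  lab_ne_zero := fun x hx => by simp [h x hx]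
  closed := by simp
  current := by simp
  lab_le := fun x hx => (h x hx).le
  reach := fun x hx t ht => by rw [h x hx] at ht; omega
  root_spec := ⟨id, by simp, by simp⟩
  cand_done := by simp

theorem tail_le (h : SearchInv n E K cand lab queue root head tail cnt ci) : tail ≤ n := by
  have := Finset.card_le_card_of_injOn (s := Finset.range tail) (t := Finset.range n) queue
    (fun i hi => by simpa using h.queue_lt i (by simpa using hi))
    (fun i hi j hj hij => h.queue_inj i (by simpa using hi) j (by simpa using hj) hij)
  simpa using this

/-- Labelling a new neighbour of the vertex in process. -/
theorem visit (h : SearchInv n E K cand lab queue root head tail cnt ci) (hht : head < tail)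
    {y : ℕ} (hy : y < n) (hE : E (queue head) y) (hlab : lab y = 0) :
    SearchInv n E K cand (Function.update lab y cnt) (Function.update queue tail y) root
      head (tail + 1) cnt ci := by
  have hx : queue head < n := h.queue_lt head hht
  have hxc : lab (queue head) = cnt := h.current head le_rfl hht
  have hc : cnt ≠ 0 := by
    rw [← hxc]; exact (h.lab_ne_zero _ hx).mpr ⟨head, hht, rfl⟩
  have hq : ∀ i < tail, queue i ≠ y := fun i hi he =>
    (h.lab_ne_zero y hy).mpr ⟨i, hi, he⟩ hlab
  have hu : ∀ i < tail, Function.update queue tail y i = queue i := fun i hi => by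
    simp [hi.ne]
  have hl : ∀ x, lab x ≠ 0 → Function.update lab y cnt x = lab x := fun x hx => by
    have : x ≠ y := by rintro rfl; exact hx hlab
    simp [this]
  have hlq : ∀ i < tail, Function.update lab y cnt (queue i) = lab (queue i) := fun i hi => by
    simp [hq i hi]
  refine ⟨by have := h.head_le; omega, h.ci_le, ?_, ?_, ?_, ?_, ?_, ?_, ?_, ?_, ?_⟩
  · intro i hi
    rcases Nat.lt_succ_iff_lt_or_eq.mp hi with hi | rfl
    · rw [hu i hi]; exact h.queue_lt i hi
    · simpa using hy
  · intro i hi j hj hij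
    rcases Nat.lt_succ_iff_lt_or_eq.mp hi with hi | rfl <;>
      rcases Nat.lt_succ_iff_lt_or_eq.mp hj with hj | rfl
    · rw [hu i hi, hu j hj] at hij; exact h.queue_inj i hi j hj hij
    · rw [hu i hi] at hij; exact absurd (by simpa using hij) (hq i hi)
    · rw [hu j hj] at hij; exact absurd (by simpa using hij.symm) (hq j hj)
    · rfl
  · intro x hx
    by_cases hxy : x = y
    · subst hxy
      simp only [Function.update_self]
      exact ⟨fun _ => ⟨tail, by omega, by simp⟩, fun _ => hc⟩
    · rw [Function.update_of_ne hxy, h.lab_ne_zero x hx]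
      constructor
      · rintro ⟨i, hi, rfl⟩; exact ⟨i, by omega, hu i hi⟩
      · rintro ⟨i, hi, he⟩
        rcases Nat.lt_succ_iff_lt_or_eq.mp hi with hi | rfl
        · exact ⟨i, hi, by rw [← hu i hi, he]⟩
        · exact absurd (by simpa using he.symm) hxy
  · intro i hi z hz hEz
    have hit : i < tail := hi.trans hht
    rw [hu i hit] at hEz ⊢
    obtain ⟨h1, h2⟩ := h.closed i hi z hz hEz
    rw [hl z h1, hlq i hit]
    exact ⟨h1, h2⟩
  · intro i hi hit
    rcases Nat.lt_succ_iff_lt_or_eq.mp hit with hit | rfl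
    · rw [hu i hit, hlq i hit]; exact h.current i hi hit
    · simp
  · intro x hx
    by_cases hxy : x = y
    · simp [hxy]
    · rw [Function.update_of_ne hxy]; exact h.lab_le x hx
  · intro x hx t ht
    by_cases hxy : x = y
    · subst hxy
      simp only [Function.update_self] at ht
      exact (h.reach _ (h.queue_lt head hht) t (hxc.trans ht)).tail
        ⟨h.queue_lt head hht, hy, hE⟩
    · rw [Function.update_of_ne hxy] at ht; exact h.reach x hx t ht
  · obtain ⟨a, h1, h2⟩ := h.root_spec
    refine ⟨a, fun t ht => ?_, h2⟩
    obtain ⟨h3, h4, h5, h6⟩ := h1 t ht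
    exact ⟨h3, h4, h5, by rw [hl _ (by omega), h6]⟩
  · intro i hi
    rw [hl _ (h.cand_done i hi)]; exact h.cand_done i hi

/-- A vertex all of whose neighbours are labelled is processed. -/
theorem advance (h : SearchInv n E K cand lab queue root head tail cnt ci) (hht : head < tail)
    (hE : ∀ y < n, E (queue head) y → lab y ≠ 0) :
    SearchInv n E K cand lab queue root (head + 1) tail cnt ci :=
  { h with
    head_le := hht
    closed := fun i hi y hy hEy => by
      rcases Nat.lt_succ_iff_lt_or_eq.mp hi with hi | rfl
      · exact h.closed i hi y hy hEy
      · refine ⟨hE y hy hEy, ?_⟩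
        rw [h.current i le_rfl hht]
        exact h.lab_le y hy
    current := fun i hi hit => h.current i (by omega) hit }

theorem skip (h : SearchInv n E K cand lab queue root head tail cnt ci) (hci : ci < K)
    (hlab : lab (cand ci) ≠ 0) : SearchInv n E K cand lab queue root head tail cnt (ci + 1) :=
  { h with
    ci_le := hci
    root_spec := by
      obtain ⟨a, h1, h2⟩ := h.root_spec
      exact ⟨a, fun t ht => ⟨(h1 t ht).1.trans (Nat.lt_succ_self _), (h1 t ht).2⟩, h2⟩
    cand_done := fun i hi => by
      rcases Nat.lt_succ_iff_lt_or_eq.mp hi with hi | rfl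
      · exact h.cand_done i hi
      · exact hlab }

/-- An unlabelled candidate becomes a root. -/
theorem select (h : SearchInv n E K cand lab queue root tail tail cnt ci) (hci : ci < K)
    (hx : cand ci < n) (hlab : lab (cand ci) = 0) :
    SearchInv n E K cand (Function.update lab (cand ci) (cnt + 1))
      (Function.update queue tail (cand ci)) (Function.update root cnt (cand ci))
      tail (tail + 1) (cnt + 1) (ci + 1) := by
  set x := cand ci with hxdef
  have hq : ∀ i < tail, queue i ≠ x := fun i hi he =>
    (h.lab_ne_zero x hx).mpr ⟨i, hi, he⟩ hlab
  have hu : ∀ i < tail, Function.update queue tail x i = queue i := fun i hi => by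
    simp [hi.ne]
  have hl : ∀ y, lab y ≠ 0 → Function.update lab x (cnt + 1) y = lab y := fun y hy => by
    have : y ≠ x := by rintro rfl; exact hy hlab
    simp [this]
  have hlq : ∀ i < tail, Function.update lab x (cnt + 1) (queue i) = lab (queue i) :=
    fun i hi => by simp [hq i hi]
  refine ⟨by omega, hci, ?_, ?_, ?_, ?_, ?_, ?_, ?_, ?_, ?_⟩
  · intro i hi
    rcases Nat.lt_succ_iff_lt_or_eq.mp hi with hi | rfl
    · rw [hu i hi]; exact h.queue_lt i hi
    · simpa using hx
  · intro i hi j hj hij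
    rcases Nat.lt_succ_iff_lt_or_eq.mp hi with hi | rfl <;>
      rcases Nat.lt_succ_iff_lt_or_eq.mp hj with hj | rfl
    · rw [hu i hi, hu j hj] at hij; exact h.queue_inj i hi j hj hij
    · rw [hu i hi] at hij; exact absurd (by simpa using hij) (hq i hi)
    · rw [hu j hj] at hij; exact absurd (by simpa using hij.symm) (hq j hj)
    · rfl
  · intro y hy
    by_cases hxy : y = x
    · subst hxy
      simp only [Function.update_self]
      exact ⟨fun _ => ⟨tail, by omega, by simp⟩, fun _ => by omega⟩
    · rw [Function.update_of_ne hxy, h.lab_ne_zero y hy]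
      constructor
      · rintro ⟨i, hi, rfl⟩; exact ⟨i, by omega, hu i hi⟩
      · rintro ⟨i, hi, he⟩
        rcases Nat.lt_succ_iff_lt_or_eq.mp hi with hi | rfl
        · exact ⟨i, hi, by rw [← hu i hi, he]⟩
        · exact absurd (by simpa using he.symm) hxy
  · intro i hi z hz hEz
    rw [hu i hi] at hEz ⊢
    obtain ⟨h1, h2⟩ := h.closed i hi z hz hEz
    rw [hl z h1, hlq i hi]
    exact ⟨h1, h2⟩
  · intro i hi hit
    have : i = tail := by omega
    subst this
    simp
  · intro y hy
    by_cases hxy : y = x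
    · simp [hxy]
    · rw [Function.update_of_ne hxy]; exact (h.lab_le y hy).trans (Nat.le_succ _)
  · intro y hy t ht
    by_cases hxy : y = x
    · subst hxy
      simp only [Function.update_self] at ht
      have : t = cnt := by omega
      subst this
      simpa using Relation.ReflTransGen.refl
    · rw [Function.update_of_ne hxy] at ht
      have := h.lab_le y hy
      rw [Function.update_of_ne (by omega)]
      exact h.reach y hy t ht
  · obtain ⟨a, h1, h2⟩ := h.root_spec
    refine ⟨Function.update a cnt ci, fun t ht => ?_, fun t ht t' ht' => ?_⟩
    · rcases Nat.lt_succ_iff_lt_or_eq.mp ht with ht | rfl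
      · obtain ⟨h3, h4, h5, h6⟩ := h1 t ht
        rw [Function.update_of_ne ht.ne, Function.update_of_ne ht.ne]
        exact ⟨by omega, h4, h5, by rw [hl _ (by omega), h6]⟩
      · simp [hx, ← hxdef]
    · rcases Nat.lt_succ_iff_lt_or_eq.mp ht with ht | rfl
      · rw [Function.update_of_ne ht.ne, Function.update_of_ne (ht'.trans ht).ne]
        exact h2 t ht t' ht'
      · rw [Function.update_self, Function.update_of_ne ht'.ne]
        exact (h1 t' ht').1
  · intro i hi
    rcases Nat.lt_succ_iff_lt_or_eq.mp hi with hi | rfl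
    · rw [hl _ (h.cand_done i hi)]; exact h.cand_done i hi
    · simp [← hxdef]

end SearchInv

/-- Outcome of a graph search: `root 0, …, root (cnt - 1)` is a subsequence of the candidates, and
`lab x = t + 1` if `root t` is the first root that reaches `x`. -/
structure SearchResult (n : ℕ) (E : ℕ → ℕ → Prop) (K : ℕ) (cand lab root : ℕ → ℕ) (cnt : ℕ) :
    Prop where
  lab_le : ∀ x < n, lab x ≤ cnt
  reach : ∀ x < n, ∀ t, lab x = t + 1 → ReachBelow n E (root t) x
  lab_mono : ∀ x < n, lab x ≠ 0 → ∀ y, ReachBelow n E x y → y < n ∧ lab y ≠ 0 ∧ lab y ≤ lab x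
  root_spec : ∃ a : ℕ → ℕ,
    (∀ t < cnt, a t < K ∧ cand (a t) = root t ∧ root t < n ∧ lab (root t) = t + 1) ∧
    ∀ t < cnt, ∀ t' < t, a t' < a t
  lab_cand : ∀ i < K, lab (cand i) ≠ 0

/-- When the queue and the candidates are exhausted, the labelled set is closed under edges. -/
theorem SearchInv.result {n : ℕ} {E : ℕ → ℕ → Prop} {K : ℕ} {cand lab queue root : ℕ → ℕ}
    {head cnt : ℕ} (h : SearchInv n E K cand lab queue root head head cnt K) :
    SearchResult n E K cand lab root cnt where
  lab_le := h.lab_le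
  reach := h.reach
  lab_mono := fun x hx hlx y hxy => by
    induction hxy with
    | refl => exact ⟨hx, hlx, le_rfl⟩
    | tail _ hyz ih =>
      obtain ⟨hy, hly, hle⟩ := ih
      obtain ⟨i, hi, rfl⟩ := (h.lab_ne_zero _ hy).mp hly
      obtain ⟨h1, h2⟩ := h.closed i hi _ hyz.2.1 hyz.2.2
      exact ⟨hyz.2.1, h1, h2.trans hle⟩
  root_spec := h.root_spec
  lab_cand := h.cand_done

/-! The integer arrays used by the search. The graph has `vN` vertices and adjacency matrix `vAdj`;
the candidates are the entries of the vector `vCand` below `vK`. The other names are those of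
`SearchInv`, with the auxiliary variables `vX` and `vY`. -/

notation "vN" => (20 : ℕ)
notation "vAdj" => (21 : ℕ)
notation "vCand" => (22 : ℕ)
notation "vK" => (23 : ℕ)
notation "vLab" => (24 : ℕ)
notation "vRoot" => (25 : ℕ)
notation "vCnt" => (26 : ℕ)
notation "vQueue" => (27 : ℕ)
notation "vHead" => (28 : ℕ)
notation "vTail" => (29 : ℕ)
notation "vCi" => (30 : ℕ)
notation "vX" => (31 : ℕ)
notation "vY" => (32 : ℕ)

/-- Visit the vertex `vY` if it is an unlabelled neighbour of `vX`. -/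
def visitProg : Prog :=
  .ite (.and (.not (.isZero (.read vAdj (.var vX) (.var vY)))) (.isZero (.entry vLab (.var vY))))
    (.assignEntry vLab (.var vY) (.var vCnt) ;;
      .assignEntry vQueue (.var vTail) (.var vY) ;;
      .assign vTail (.succ (.var vTail)))
    .skip

/-- Treat the next candidate. -/
def selectProg : Prog :=
  .assign vX (.entry vCand (.var vCi)) ;;
  .ite (.isZero (.entry vLab (.var vX)))
    (.assignEntry vRoot (.var vCnt) (.var vX) ;;
      .assign vCnt (.succ (.var vCnt)) ;;
      .assignEntry vLab (.var vX) (.var vCnt) ;;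
      .assignEntry vQueue (.var vTail) (.var vX) ;;
      .assign vTail (.succ (.var vTail)))
    .skip ;;
  .assign vCi (.succ (.var vCi))

/-- One round of the search: process a vertex of the queue, or treat a candidate. -/
def searchStep : Prog :=
  .ite (.intLt (.var vHead) (.var vTail))
    (.assign vX (.entry vQueue (.var vHead)) ;;
      .forUpTo vY vN visitProg ;;
      .assign vHead (.succ (.var vHead)))
    selectProg

/-- The search in the graph with adjacency matrix `vAdj` from the candidates `vCand`. -/
def searchProg : Prog :=
  .forUpTo vY vN (.assignEntry vLab (.var vY) (.const 0)) ;;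
  (.assign vCnt (.const 0) ;; .assign vHead (.const 0) ;; .assign vTail (.const 0) ;;
    .assign vCi (.const 0)) ;;
  .loop (.not (.and (.intLe (.var vTail) (.var vHead)) (.intLe (.var vK) (.var vCi)))) searchStep

/-- The invariant of the search, read off the memory. -/
def MemSearchInv (n : ℕ) (E : ℕ → ℕ → Prop) (K : ℕ) (cand : ℕ → ℕ) (t : Memory) : Prop :=
  SearchInv n E K cand (t.vec vLab) (t.vec vQueue) (t.vec vRoot) (t.var vHead) (t.var vTail)
    (t.var vCnt) (t.var vCi)

theorem selectProg_spec {n : ℕ} {E : ℕ → ℕ → Prop} {K : ℕ} {s : Memory}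
    (hcand : ∀ i < K, s.vec vCand i < n) (h : MemSearchInv n E K (s.vec vCand) s)
    (hht : s.var vTail ≤ s.var vHead) (hci : s.var vCi < K) :
    RunsWithin selectProg s 8 fun t => MemSearchInv n E K (s.vec vCand) t ∧
      t.var vHead = s.var vHead ∧ t.var vCi = s.var vCi + 1 := by
  refine RunsWithin.of_run rfl (by decide) ?_
  have hht' : s.var vHead = s.var vTail := le_antisymm h.head_le hht
  unfold MemSearchInv at h ⊢
  by_cases hlab : s.vec vLab (s.vec vCand (s.var vCi)) = 0
  · rw [hht'] at h
    have := SearchInv.select h hci (hcand _ hci) hlab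
    simpa [selectProg, Prog.run, Test.Holds, hlab, hht'] using this
  · have := SearchInv.skip h hci hlab
    simpa [selectProg, Prog.run, Test.Holds, hlab] using this

theorem searchStep_spec {n : ℕ} {E : ℕ → ℕ → Prop} {K : ℕ} {s : Memory} (hn : s.var vN = n)
    (hE : ∀ x < n, ∀ y < n, E x y ↔ s.int vAdj x y ≠ 0)
    (hcand : ∀ i < K, s.vec vCand i < n) (h : MemSearchInv n E K (s.vec vCand) s)
    (hne : s.var vHead < s.var vTail ∨ s.var vCi < K) :
    RunsWithin searchStep s (6 * n + 10) fun t => MemSearchInv n E K (s.vec vCand) t ∧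
      (n - t.var vHead) + (K - t.var vCi) < (n - s.var vHead) + (K - s.var vCi) := by
  have hmain : RunsWithin searchStep s (6 * n + 9 + 1) fun t =>
      MemSearchInv n E K (s.vec vCand) t ∧
      (n - t.var vHead) + (K - t.var vCi) < (n - s.var vHead) + (K - s.var vCi) := by
    refine RunsWithin.ite (fun hb => ?_) fun hb => ?_
    · have hht : s.var vHead < s.var vTail := by simpa [Test.Holds] using hb
      have hhn : s.var vHead < n := hht.trans_le h.tail_le
      set x := s.vec vQueue (s.var vHead) with hx
      have hxn : x < n := h.queue_lt _ hht
      have h1 : RunsWithin (.assign vX (.entry vQueue (.var vHead))) s 1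
          fun t => t = s.writeInt vX 0 0 x := RunsWithin.of_run rfl le_rfl rfl
      refine (h1.seq (l := (n * (4 + 2) + 2) + 1) fun t ht => ?_).mono (by omega) fun t ht => ht
      subst ht
      refine RunsWithin.seq (RunsWithin.forUpTo (N := n) (fun y t =>
        MemSearchInv n E K (s.vec vCand) t ∧ t.var vHead < t.var vTail ∧
          t.vec vQueue (t.var vHead) = x ∧ ∀ y' < y, E x y' → t.vec vLab y' ≠ 0) 4
        (by simpa using hn) (by decide) (by decide) ?_ ?_) fun t ht => ?_
      · refine ⟨by simpa [MemSearchInv] using h, by simpa using hht, by simp [hx], by simp⟩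
      · rintro y hy t hfr hty ⟨hinv, hlt, hq, hlab⟩
        refine RunsWithin.of_run rfl (by decide) ?_
        have hadj : t.int vAdj = s.int vAdj := by
          rw [hfr.int vAdj (by decide)]; simp
        have htx : t.var vX = x := by rw [hfr.var vX (by decide)]; simp
        by_cases hcase : E x y ∧ t.vec vLab y = 0
        · have hv := SearchInv.visit hinv hlt hy (by rw [hq]; exact hcase.1) hcase.2
          have hc0 : t.var vCnt ≠ 0 := by
            rw [← hinv.current _ le_rfl hlt]
            exact (hinv.lab_ne_zero _ (hinv.queue_lt _ hlt)).mpr ⟨_, hlt, rfl⟩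
          have hne := (hE x hxn y hy).mp hcase.1
          have hb1 : 0 < s.int vAdj x y := Nat.pos_of_ne_zero hne
          simp only [visitProg, Prog.run, Test.Holds, IntExpr.eval_read, IntExpr.eval_var,
            IntExpr.eval_const, IntExpr.eval_entry, hadj, htx, hty, hcase.2, hne, Nat.le_zero,
            not_false_eq_true, and_self, if_true]
          refine ⟨by simpa [MemSearchInv, hty] using hv, by simp; omega, by simpa [hlt.ne] using hq, ?_⟩
          intro y' hy' hEy
          by_cases hyy : y' = y
          · simpa [hyy] using hc0
          · simpa [hyy] using hlab y' (by omega) hEy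
        · have hcase' : ¬ (s.int vAdj x y ≠ 0 ∧ t.vec vLab y = 0) := by
            rw [← hE x hxn y hy]; exact hcase
          have hrun : visitProg.run t = t := by
            simp only [visitProg, Prog.run, Test.Holds, IntExpr.eval_read, IntExpr.eval_var,
              IntExpr.eval_const, IntExpr.eval_entry, hadj, htx, hty, Nat.le_zero]
            rw [if_neg hcase']
          rw [hrun]
          refine ⟨by simpa [MemSearchInv] using hinv, by simpa using hlt, by simpa using hq, ?_⟩
          intro y' hy' hEy
          by_cases hyy : y' = y
          · subst hyy
            simpa using fun h0 => hcase ⟨hEy, h0⟩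
          · simpa using hlab y' (by omega) hEy
      · obtain ⟨⟨hinv, hlt, hq, hlab⟩, hfr⟩ := ht
        refine RunsWithin.of_run rfl (by decide) ?_
        have hadv := SearchInv.advance hinv hlt fun y hy hEy => hlab y hy (hq ▸ hEy)
        have hhead : t.var vHead = s.var vHead := by rw [hfr.var vHead (by decide)]; simp
        have hci : t.var vCi = s.var vCi := by rw [hfr.var vCi (by decide)]; simp
        refine ⟨by simpa [MemSearchInv, Prog.run] using hadv, ?_⟩
        simp [Prog.run, hhead, hci]
        omega
    · have hht : s.var vTail ≤ s.var vHead := by simpa [Test.Holds] using hb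
      have hci : s.var vCi < K := hne.resolve_left (by omega)
      refine (selectProg_spec hcand h hht hci).mono (by omega) fun t ht => ⟨ht.1, ?_⟩
      rw [ht.2.1, ht.2.2]
      omega
  exact hmain

theorem searchProg_spec {n : ℕ} {E : ℕ → ℕ → Prop} {K : ℕ} {s : Memory} (hn : s.var vN = n)
    (hK : s.var vK = K) (hE : ∀ x < n, ∀ y < n, E x y ↔ s.int vAdj x y ≠ 0)
    (hcand : ∀ i < K, s.vec vCand i < n) :
    RunsWithin searchProg s ((n + K + 1) * (7 * n + 20)) fun t =>
      SearchResult n E K (s.vec vCand) (t.vec vLab) (t.vec vRoot) (t.var vCnt) := by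
  have h1 : RunsWithin (.forUpTo vY vN (.assignEntry vLab (.var vY) (.const 0))) s
      (n * (1 + 2) + 2) _ := RunsWithin.forUpTo (N := n)
        (fun y t => ∀ x < y, t.vec vLab x = 0) 1 hn (by decide) (by decide) (by simp)
        fun y _ t _ hty h => RunsWithin.of_run rfl le_rfl fun x hx => by
          by_cases hxy : x = y
          · simp [Prog.run, hxy, hty]
          · have : x ≠ t.var vY := by rwa [hty]
            simpa [Prog.run, this] using h x (by omega)
  refine (h1.seq (l := 4 + ((n + K) * (6 * n + 10 + 1) + 1)) fun t ht => ?_).mono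
    (by nlinarith) fun t ht => ht
  obtain ⟨hlab, hfr⟩ := ht
  have hcandt : t.vec vCand = s.vec vCand := hfr.vec _ (by decide)
  let J : Memory → Prop := fun u => MemSearchInv n E K (s.vec vCand) u ∧ u.var vN = n ∧
    u.var vK = K ∧ u.int vAdj = s.int vAdj ∧ u.vec vCand = s.vec vCand
  have h2 : RunsWithin (.assign vCnt (.const 0) ;; .assign vHead (.const 0) ;;
      .assign vTail (.const 0) ;; .assign vCi (.const 0)) t 4
      fun u => J u ∧ u.var vHead = 0 ∧ u.var vCi = 0 := by
    refine RunsWithin.of_run rfl (by decide) ⟨⟨?_, ?_, ?_, ?_, ?_⟩, ?_, ?_⟩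
    · simpa [MemSearchInv, Prog.run] using SearchInv.init (E := E) (K := K) hlab
    · simpa [Prog.run, hn] using hfr.var vN (by decide)
    · simpa [Prog.run, hK] using hfr.var vK (by decide)
    · simpa [Prog.run] using hfr.int vAdj (by decide)
    · simpa [Prog.run] using hcandt
    · simp [Prog.run]
    · simp [Prog.run]
  refine h2.seq fun u hu => ?_
  refine (RunsWithin.loop J (fun u => (n - u.var vHead) + (K - u.var vCi)) (6 * n + 10)
    (fun v hv hb => ?_) u hu.1).mono (by simp [hu.2.1, hu.2.2]) fun v hv => ?_
  · obtain ⟨hinv, hvn, hvK, hvA, hvc⟩ := hv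
    have hne : v.var vHead < v.var vTail ∨ v.var vCi < K := by
      by_contra hcon
      refine hb ?_
      simp only [Test.Holds, IntExpr.eval_var, hvK]
      omega
    rw [← hvc] at hinv hcand
    refine (searchStep_spec hvn (fun x hx y hy => by rw [hvA]; exact hE x hx y hy) hcand hinv
      hne).frame.mono le_rfl fun w hw => ⟨⟨?_, ?_, ?_, ?_, ?_⟩, hw.1.2⟩
    · rw [← hvc]; exact hw.1.1
    · rw [hw.2.var vN (by decide), hvn]
    · rw [hw.2.var vK (by decide), hvK]
    · rw [hw.2.int vAdj (by decide), hvA]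
    · rw [hw.2.vec vCand (by decide), hvc]
  · obtain ⟨⟨hinv, hvn, hvK, hvA, hvc⟩, hb⟩ := hv
    have hend : v.var vTail ≤ v.var vHead ∧ K ≤ v.var vCi := by
      by_contra hcon
      refine hb ?_
      simp only [Test.Holds, IntExpr.eval_var, hvK]
      exact hcon
    have h3 : v.var vTail = v.var vHead := le_antisymm hend.1 hinv.head_le
    have h4 : v.var vCi = K := le_antisymm hinv.ci_le hend.2
    unfold MemSearchInv at hinv
    rw [h3, h4] at hinv
    exact hinv.result

/-! ### The assignment algorithm: invariants -/

/-- The rows below `r` are matched along tight entries of feasible dual variables `u`, `v`. Row `i`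
is matched with column `q i`; `p j` is the row of column `j` plus one, and `0` for a free column. -/
structure MatchInv (D : ℕ → ℕ → ℝ) (m r : ℕ) (u v : ℕ → ℝ) (p q : ℕ → ℕ) : Prop where
  row : ∀ i < r, q i < m ∧ p (q i) = i + 1
  col : ∀ j < m, p j ≠ 0 → p j ≤ r ∧ q (p j - 1) = j
  feas : ∀ i < r, ∀ j < m, u i + v j ≤ D i j
  tight : ∀ i < r, u i + v (q i) = D i (q i)

theorem MatchInv.exists_free {D : ℕ → ℕ → ℝ} {m r : ℕ} {u v : ℕ → ℝ} {p q : ℕ → ℕ}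
    (h : MatchInv D m r u v p q) (hr : r < m) : ∃ j < m, p j = 0 := by
  by_contra! hp
  have := Finset.card_le_card_of_injOn (s := Finset.range m) (t := Finset.range r)
    (fun j => p j - 1) (fun j hj => by
      have hj' : j < m := by simpa using hj
      have h1 := h.col j hj' (hp j hj')
      have h2 := hp j hj'
      simp only [Finset.coe_range, Set.mem_Iio]
      omega) (fun j hj k hk hjk => by
      have hj' : j < m := by simpa using hj
      have hk' : k < m := by simpa using hk
      rw [← (h.col j hj' (hp j hj')).2, ← (h.col k hk' (hp k hk')).2]
      exact congrArg q hjk)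
  simp at this
  omega

/-- A perfect tight matching is optimal, by weak duality. -/
theorem MatchInv.optimal {D : ℕ → ℕ → ℝ} {m : ℕ} {u v : ℕ → ℝ} {p q : ℕ → ℕ}
    (h : MatchInv D m m u v p q) :
    ∃ π : Equiv.Perm (Fin m), (∀ i, ((π i : Fin m) : ℕ) = q i) ∧
      ∀ τ : Equiv.Perm (Fin m), ∑ i : Fin m, D i (π i) ≤ ∑ i : Fin m, D i (τ i) := by
  let f : Fin m → Fin m := fun i => ⟨q i, (h.row i i.2).1⟩
  have hf : Function.Injective f := fun i k hik => by
    have h1 : q i = q k := congrArg Fin.val hik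
    have h2 := (h.row i i.2).2
    rw [h1, (h.row k k.2).2] at h2
    exact Fin.ext (by omega)
  refine ⟨Equiv.ofBijective f (Finite.injective_iff_bijective.mp hf), fun i => rfl, fun τ => ?_⟩
  have hsum : ∀ τ : Equiv.Perm (Fin m),
      ∑ i : Fin m, (u i + v (τ i)) = ∑ i : Fin m, u i + ∑ j : Fin m, v j := fun τ => by
    rw [Finset.sum_add_distrib, Equiv.sum_comp τ fun j => v j]
  set π := Equiv.ofBijective f (Finite.injective_iff_bijective.mp hf)
  calc ∑ i : Fin m, D i (π i) = ∑ i : Fin m, (u i + v (π i)) :=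
        Finset.sum_congr rfl fun i _ => (h.tight i i.2).symm
    _ = ∑ i : Fin m, (u i + v (τ i)) := by rw [hsum, hsum]
    _ ≤ _ := Finset.sum_le_sum fun i _ => h.feas i i.2 _ (τ i).2

/-- The rows of the alternating tree that is grown from row `r`. -/
def InTree (r : ℕ) (q used : ℕ → ℕ) (i : ℕ) : Prop := i = r ∨ (i < r ∧ used (q i) ≠ 0)

/-- Invariant of the growth of the alternating tree: `used j` is the position at which column `j`
entered the tree (`0` outside the tree), `way j` is the tree row that precedes column `j`, and
`minv j` is the smallest slack of a column outside the tree with respect to the tree rows. -/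
structure TreeInv (D : ℕ → ℕ → ℝ) (m r : ℕ) (u v : ℕ → ℝ) (p q used way : ℕ → ℕ) (minv : ℕ → ℝ)
    (cnt : ℕ) : Prop where
  matched : MatchInv D m r u v p q
  used_col : ∀ j < m, used j ≠ 0 → p j ≠ 0
  used_le : ∀ j < m, used j ≤ cnt
  count : cnt + ((Finset.range m).filter fun j => used j = 0).card = m
  feas_root : ∀ j < m, used j ≠ 0 → u r + v j ≤ D r j
  minv_le : ∀ j < m, used j = 0 → ∀ i, InTree r q used i → minv j ≤ D i j - u i - v j
  minv_eq : ∀ j < m, used j = 0 →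
    InTree r q used (way j) ∧ minv j = D (way j) j - u (way j) - v j
  nonneg : (∀ j < m, used j = 0) ∨ ∀ j < m, used j = 0 → 0 ≤ minv j
  tree : ∀ j < m, used j ≠ 0 → u (way j) + v j = D (way j) j ∧
    (way j = r ∨ (way j < r ∧ used (q (way j)) ≠ 0 ∧ used (q (way j)) < used j))

/-- Invariant of the augmentation: column `j` is about to be matched with row `way j`. -/
structure AugInv (D : ℕ → ℕ → ℝ) (m r : ℕ) (u v : ℕ → ℝ) (p q used way : ℕ → ℕ) (j : ℕ) :
    Prop where
  lt : j < m
  used_ne : used j ≠ 0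
  row : ∀ i < r, q i < m ∧ p (q i) = i + 1 ∧ q i ≠ j
  col : ∀ k < m, k ≠ j → p k ≠ 0 → p k ≤ r ∧ q (p k - 1) = k
  feas : ∀ i < r + 1, ∀ k < m, u i + v k ≤ D i k
  tight : ∀ i < r, u i + v (q i) = D i (q i)
  tree : ∀ k < m, used k ≠ 0 → used k ≤ used j → u (way k) + v k = D (way k) k ∧
    (way k = r ∨ (way k < r ∧ used (q (way k)) ≠ 0 ∧ used (q (way k)) < used k))

theorem TreeInv.init {D : ℕ → ℕ → ℝ} {m r : ℕ} {u v : ℕ → ℝ} {p q used way : ℕ → ℕ} {minv : ℕ → ℝ}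
    (h : MatchInv D m r u v p q) (hused : ∀ j < m, used j = 0) (hway : ∀ j < m, way j = r)
    (hminv : ∀ j < m, minv j = D r j - v j) :
    TreeInv D m r (Function.update u r 0) v p q used way minv 0 where
  matched :=
    { h with
      feas := fun i hi j hj => by
        rw [Function.update_of_ne hi.ne]; exact h.feas i hi j hj
      tight := fun i hi => by
        rw [Function.update_of_ne hi.ne]; exact h.tight i hi }
  used_col := fun j hj hu => absurd (hused j hj) hu
  used_le := fun j hj => (hused j hj).le
  count := by
    rw [Finset.filter_true_of_mem fun j hj => hused j (Finset.mem_range.mp hj)]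
    simp
  feas_root := fun j hj hu => absurd (hused j hj) hu
  minv_le := fun j hj _ i hi => by
    rcases hi with rfl | ⟨hi, hu⟩
    · simp [hminv j hj]
    · exact absurd (hused _ (h.row i hi).1) hu
  minv_eq := fun j hj _ => ⟨Or.inl (hway j hj), by simp [hway j hj, hminv j hj]⟩
  nonneg := Or.inl hused
  tree := fun j hj hu => absurd (hused j hj) hu

/-- The dual update by the smallest slack `minv j₁`. -/
theorem TreeInv.shift {D : ℕ → ℕ → ℝ} {m r : ℕ} {u v : ℕ → ℝ} {p q used way : ℕ → ℕ} {minv : ℕ → ℝ}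
    {cnt : ℕ} (h : TreeInv D m r u v p q used way minv cnt) {j₁ : ℕ} (hj₁ : j₁ < m)
    (hu₁ : used j₁ = 0) (hmin : ∀ j < m, used j = 0 → minv j₁ ≤ minv j) {u' v' minv' : ℕ → ℝ}
    (hu_tree : ∀ i, InTree r q used i → u' i = u i + minv j₁)
    (hu_not : ∀ i < r, used (q i) = 0 → u' i = u i)
    (hv_used : ∀ j < m, used j ≠ 0 → v' j = v j - minv j₁)
    (hv_not : ∀ j < m, used j = 0 → v' j = v j)
    (hminv : ∀ j < m, used j = 0 → minv' j = minv j - minv j₁) :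
    TreeInv D m r u' v' p q used way minv' cnt ∧ minv' j₁ = 0 ∧
      ∀ j < m, used j = 0 → 0 ≤ minv' j := by
  have hnn : ∀ j < m, used j = 0 → 0 ≤ minv' j := fun j hj hu => by
    rw [hminv j hj hu]; linarith [hmin j hj hu]
  refine ⟨?_, by rw [hminv j₁ hj₁ hu₁, sub_self], hnn⟩
  refine ⟨⟨h.matched.row, h.matched.col, ?_, ?_⟩, h.used_col, h.used_le, h.count, ?_, ?_, ?_,
    Or.inr hnn, ?_⟩
  · intro i hi j hj
    have h1 := h.matched.feas i hi j hj
    by_cases hT : used (q i) = 0 <;> by_cases hU : used j = 0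
    · rw [hu_not i hi hT, hv_not j hj hU]; exact h1
    · have h0 : 0 ≤ minv j₁ := by
        rcases h.nonneg with h2 | h2
        · exact absurd (h2 j hj) hU
        · exact h2 j₁ hj₁ hu₁
      rw [hu_not i hi hT, hv_used j hj hU]; linarith
    · have hin : InTree r q used i := Or.inr ⟨hi, hT⟩
      rw [hu_tree i hin, hv_not j hj hU]
      linarith [h.minv_le j hj hU i hin, hmin j hj hU]
    · rw [hu_tree i (Or.inr ⟨hi, hT⟩), hv_used j hj hU]; linarith
  · intro i hi
    have h1 := h.matched.tight i hi
    have h2 := (h.matched.row i hi).1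
    by_cases hT : used (q i) = 0
    · rw [hu_not i hi hT, hv_not _ h2 hT]; exact h1
    · rw [hu_tree i (Or.inr ⟨hi, hT⟩), hv_used _ h2 hT]; linarith
  · intro j hj hU
    rw [hu_tree r (Or.inl rfl), hv_used j hj hU]
    linarith [h.feas_root j hj hU]
  · intro j hj hU i hi
    rw [hminv j hj hU, hu_tree i hi, hv_not j hj hU]
    linarith [h.minv_le j hj hU i hi]
  · intro j hj hU
    obtain ⟨h1, h2⟩ := h.minv_eq j hj hU
    refine ⟨h1, ?_⟩
    rw [hminv j hj hU, hu_tree _ h1, hv_not j hj hU]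
    linarith
  · intro j hj hU
    obtain ⟨h1, h2⟩ := h.tree j hj hU
    refine ⟨?_, h2⟩
    have hin : InTree r q used (way j) := h2.imp id fun h3 => ⟨h3.1, h3.2.1⟩
    rw [hu_tree _ hin, hv_used j hj hU]
    linarith

theorem TreeInv.cnt_lt {D : ℕ → ℕ → ℝ} {m r : ℕ} {u v : ℕ → ℝ} {p q used way : ℕ → ℕ}
    {minv : ℕ → ℝ} {cnt : ℕ} (h : TreeInv D m r u v p q used way minv cnt) {j : ℕ} (hj : j < m)
    (hu : used j = 0) : cnt < m := by
  have := h.count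
  have hpos : 0 < ((Finset.range m).filter fun j => used j = 0).card :=
    Finset.card_pos.mpr ⟨j, by simp [hj, hu]⟩
  omega

/-- A matched column with slack `0` enters the tree, together with its row. -/
theorem TreeInv.grow {D : ℕ → ℕ → ℝ} {m r : ℕ} {u v : ℕ → ℝ} {p q used way : ℕ → ℕ} {minv : ℕ → ℝ}
    {cnt : ℕ} (h : TreeInv D m r u v p q used way minv cnt) {j₁ : ℕ} (hj₁ : j₁ < m)
    (hu₁ : used j₁ = 0) (h0 : minv j₁ = 0) (hnn : ∀ j < m, used j = 0 → 0 ≤ minv j)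
    (hp : p j₁ ≠ 0) {way' : ℕ → ℕ} {minv' : ℕ → ℝ}
    (hway : ∀ j < m, Function.update used j₁ (cnt + 1) j ≠ 0 → way' j = way j)
    (hrelax : ∀ j < m, Function.update used j₁ (cnt + 1) j = 0 →
      (D (p j₁ - 1) j - u (p j₁ - 1) - v j < minv j ∧
        minv' j = D (p j₁ - 1) j - u (p j₁ - 1) - v j ∧ way' j = p j₁ - 1) ∨
      (minv j ≤ D (p j₁ - 1) j - u (p j₁ - 1) - v j ∧ minv' j = minv j ∧ way' j = way j)) :
    TreeInv D m r u v p q (Function.update used j₁ (cnt + 1)) way' minv' (cnt + 1) := by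
  obtain ⟨hpr, hq⟩ := h.matched.col j₁ hj₁ hp
  set i₀ := p j₁ - 1 with hi₀
  have hi₀r : i₀ < r := by omega
  have hud : ∀ j, Function.update used j₁ (cnt + 1) j = 0 → j ≠ j₁ ∧ used j = 0 := fun j hj => by
    by_cases hjj : j = j₁
    · subst hjj; simp at hj
    · rw [Function.update_of_ne hjj] at hj; exact ⟨hjj, hj⟩
  have hmono : ∀ j, used j ≠ 0 → Function.update used j₁ (cnt + 1) j = used j := fun j hj => by
    rw [Function.update_of_ne]; rintro rfl; exact hj hu₁
  have hT : ∀ i, InTree r q (Function.update used j₁ (cnt + 1)) i →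
      InTree r q used i ∨ i = i₀ := fun i hi => by
    rcases hi with hi | ⟨hi, hu⟩
    · exact Or.inl (Or.inl hi)
    · by_cases hqi : q i = j₁
      · right
        have h1 := (h.matched.row i hi).2
        rw [hqi] at h1
        omega
      · rw [Function.update_of_ne hqi] at hu
        exact Or.inl (Or.inr ⟨hi, hu⟩)
  have hT' : ∀ i, InTree r q used i → InTree r q (Function.update used j₁ (cnt + 1)) i :=
    fun i hi => hi.imp id fun hi => ⟨hi.1, by rw [hmono _ hi.2]; exact hi.2⟩
  have hTi₀ : InTree r q (Function.update used j₁ (cnt + 1)) i₀ :=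
    Or.inr ⟨hi₀r, by rw [hq]; simp⟩
  refine ⟨h.matched, ?_, ?_, ?_, ?_, ?_, ?_, Or.inr ?_, ?_⟩
  · intro j hj hu
    by_cases hjj : j = j₁
    · rw [hjj]; exact hp
    · rw [Function.update_of_ne hjj] at hu; exact h.used_col j hj hu
  · intro j hj
    by_cases hjj : j = j₁
    · simp [hjj]
    · rw [Function.update_of_ne hjj]; exact (h.used_le j hj).trans (Nat.le_succ _)
  · have h1 := h.count
    have h2 : ((Finset.range m).filter fun j => Function.update used j₁ (cnt + 1) j = 0) =
        ((Finset.range m).filter fun j => used j = 0).erase j₁ := by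
      ext j
      by_cases hjj : j = j₁
      · subst hjj; simp
      · simp [hjj]
    have hmem : j₁ ∈ (Finset.range m).filter fun j => used j = 0 := by simp [hj₁, hu₁]
    have hpos := Finset.card_pos.mpr ⟨j₁, hmem⟩
    rw [h2, Finset.card_erase_of_mem hmem]
    omega
  · intro j hj hu
    by_cases hjj : j = j₁
    · have := h.minv_le j₁ hj₁ hu₁ r (Or.inl rfl)
      rw [hjj]; linarith
    · rw [Function.update_of_ne hjj] at hu; exact h.feas_root j hj hu
  · intro j hj hu i hi
    have hu' := (hud j hu).2
    rcases hT i hi with hi | rfl <;> rcases hrelax j hj hu with ⟨h1, h2, -⟩ | ⟨h1, h2, -⟩ <;>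
      rw [h2]
    · exact h1.le.trans (h.minv_le j hj hu' i hi)
    · exact h.minv_le j hj hu' i hi
    · exact h1
  · intro j hj hu
    have hu' := (hud j hu).2
    rcases hrelax j hj hu with ⟨-, h2, h3⟩ | ⟨-, h2, h3⟩
    · rw [h2, h3]; exact ⟨hTi₀, rfl⟩
    · rw [h2, h3]; exact ⟨hT' _ (h.minv_eq j hj hu').1, (h.minv_eq j hj hu').2⟩
  · intro j hj hu
    have hu' := (hud j hu).2
    rcases hrelax j hj hu with ⟨-, h2, -⟩ | ⟨-, h2, -⟩ <;> rw [h2]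
    · linarith [h.matched.feas i₀ hi₀r j hj]
    · exact hnn j hj hu'
  · intro j hj hu
    rw [hway j hj hu]
    by_cases hjj : j = j₁
    · rw [hjj, Function.update_self]
      obtain ⟨h1, h2⟩ := h.minv_eq j₁ hj₁ hu₁
      refine ⟨by linarith, h1.imp id fun h3 => ⟨h3.1, ?_, ?_⟩⟩
      · rw [hmono _ h3.2]; exact h3.2
      · rw [hmono _ h3.2]
        exact Nat.lt_succ_of_le (h.used_le _ (h.matched.row _ h3.1).1)
    · rw [Function.update_of_ne hjj] at hu ⊢
      obtain ⟨h1, h2⟩ := h.tree j hj hu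
      refine ⟨h1, h2.imp id fun h3 => ?_⟩
      rw [hmono _ h3.2.1]
      exact h3

/-- A free column with slack `0` ends the growth of the tree. -/
theorem TreeInv.toAug {D : ℕ → ℕ → ℝ} {m r : ℕ} {u v : ℕ → ℝ} {p q used way : ℕ → ℕ} {minv : ℕ → ℝ}
    {cnt : ℕ} (h : TreeInv D m r u v p q used way minv cnt) {j₁ : ℕ} (hj₁ : j₁ < m)
    (hu₁ : used j₁ = 0) (h0 : minv j₁ = 0) (hnn : ∀ j < m, used j = 0 → 0 ≤ minv j)
    (hp : p j₁ = 0) : AugInv D m r u v p q (Function.update used j₁ (cnt + 1)) way j₁ := by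
  have hmono : ∀ j, used j ≠ 0 → Function.update used j₁ (cnt + 1) j = used j := fun j hj => by
    rw [Function.update_of_ne]; rintro rfl; exact hj hu₁
  refine ⟨hj₁, by simp, ?_, ?_, ?_, h.matched.tight, ?_⟩
  · intro i hi
    obtain ⟨h1, h2⟩ := h.matched.row i hi
    refine ⟨h1, h2, fun h3 => ?_⟩
    rw [h3] at h2
    omega
  · exact fun k hk _ hpk => h.matched.col k hk hpk
  · intro i hi k hk
    rcases Nat.lt_succ_iff_lt_or_eq.mp hi with hi | rfl
    · exact h.matched.feas i hi k hk
    · by_cases hu : used k = 0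
      · linarith [h.minv_le k hk hu i (Or.inl rfl), hnn k hk hu]
      · exact h.feas_root k hk hu
  · intro j hj hu _
    by_cases hjj : j = j₁
    · rw [hjj, Function.update_self]
      obtain ⟨h1, h2⟩ := h.minv_eq j₁ hj₁ hu₁
      refine ⟨by linarith, h1.imp id fun h3 => ⟨h3.1, ?_, ?_⟩⟩
      · rw [hmono _ h3.2]; exact h3.2
      · rw [hmono _ h3.2]
        exact Nat.lt_succ_of_le (h.used_le _ (h.matched.row _ h3.1).1)
    · rw [Function.update_of_ne hjj] at hu ⊢
      obtain ⟨h1, h2⟩ := h.tree j hj hu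
      refine ⟨h1, h2.imp id fun h3 => ?_⟩
      rw [hmono _ h3.2.1]
      exact h3

theorem AugInv.step {D : ℕ → ℕ → ℝ} {m r : ℕ} {u v : ℕ → ℝ} {p q used way : ℕ → ℕ} {j : ℕ}
    (h : AugInv D m r u v p q used way j) (hw : way j ≠ r) :
    AugInv D m r u v (Function.update p j (way j + 1)) (Function.update q (way j) j) used way
      (q (way j)) ∧ used (q (way j)) < used j := by
  obtain ⟨htj, hwr⟩ := h.tree j h.lt h.used_ne le_rfl
  obtain ⟨hlt, hne, hless⟩ := hwr.resolve_left hw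
  set i₀ := way j with hi₀
  obtain ⟨hq1, hq2, hq3⟩ := h.row i₀ hlt
  refine ⟨⟨hq1, hne, ?_, ?_, h.feas, ?_, ?_⟩, hless⟩
  · intro i hi
    by_cases hii : i = i₀
    · rw [hii, Function.update_self, Function.update_self]
      exact ⟨h.lt, rfl, hq3.symm⟩
    · obtain ⟨h1, h2, h3⟩ := h.row i hi
      rw [Function.update_of_ne hii, Function.update_of_ne h3]
      refine ⟨h1, h2, fun h4 => hii ?_⟩
      rw [h4, hq2] at h2
      omega
  · intro k hk hkne hpk
    by_cases hkj : k = j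
    · rw [hkj, Function.update_self]
      exact ⟨hlt, by simp⟩
    · rw [Function.update_of_ne hkj] at hpk ⊢
      obtain ⟨h1, h2⟩ := h.col k hk hkj hpk
      refine ⟨h1, ?_⟩
      rw [Function.update_of_ne, h2]
      intro h3
      rw [h3] at h2
      exact hkne h2.symm
  · intro i hi
    by_cases hii : i = i₀
    · rw [hii, Function.update_self]; exact htj
    · rw [Function.update_of_ne hii]; exact h.tight i hi
  · intro k hk hu hle
    obtain ⟨h1, h2⟩ := h.tree k hk hu (hle.trans hless.le)
    refine ⟨h1, h2.imp id fun h3 => ?_⟩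
    have : way k ≠ i₀ := fun h4 => by
      rw [h4] at h3
      omega
    rw [Function.update_of_ne this]
    exact h3

theorem AugInv.finish {D : ℕ → ℕ → ℝ} {m r : ℕ} {u v : ℕ → ℝ} {p q used way : ℕ → ℕ} {j : ℕ}
    (h : AugInv D m r u v p q used way j) (hw : way j = r) :
    MatchInv D m (r + 1) u v (Function.update p j (r + 1)) (Function.update q r j) := by
  obtain ⟨htj, -⟩ := h.tree j h.lt h.used_ne le_rfl
  rw [hw] at htj
  refine ⟨?_, ?_, h.feas, ?_⟩
  · intro i hi
    rcases Nat.lt_succ_iff_lt_or_eq.mp hi with hi | rfl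
    · obtain ⟨h1, h2, h3⟩ := h.row i hi
      rw [Function.update_of_ne hi.ne, Function.update_of_ne h3]
      exact ⟨h1, h2⟩
    · simp [h.lt]
  · intro k hk hpk
    by_cases hkj : k = j
    · simp [hkj]
    · rw [Function.update_of_ne hkj] at hpk ⊢
      obtain ⟨h1, h2⟩ := h.col k hk hkj hpk
      refine ⟨by omega, ?_⟩
      rw [Function.update_of_ne (by omega), h2]
  · intro i hi
    rcases Nat.lt_succ_iff_lt_or_eq.mp hi with hi | rfl
    · rw [Function.update_of_ne hi.ne]; exact h.tight i hi
    · rw [Function.update_self]; exact htj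

/-! ### The assignment algorithm: program -/

/-! The arrays used by the assignment algorithm, with names as in `TreeInv` and `AugInv`: the size
is `vM`, the current row `vR`, the column in process `vJ1`, and `vRank` counts the columns of the
tree. The prefix `v` stands for integer arrays and the prefix `r` for real arrays; the cost matrix is
`rD`. The flag `vDone` is `1` between the growth of the tree and the end of the augmentation. -/

notation "vM" => (40 : ℕ)
notation "vP" => (41 : ℕ)
notation "vQ" => (42 : ℕ)
notation "vUsed" => (43 : ℕ)
notation "vWay" => (44 : ℕ)
notation "vR" => (45 : ℕ)
notation "vJ1" => (46 : ℕ)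
notation "vI0" => (47 : ℕ)
notation "vJ" => (48 : ℕ)
notation "vDone" => (49 : ℕ)
notation "vJ2" => (50 : ℕ)
notation "vRank" => (51 : ℕ)
notation "rD" => (40 : ℕ)
notation "rU" => (41 : ℕ)
notation "rV" => (42 : ℕ)
notation "rMinv" => (43 : ℕ)
notation "rDelta" => (44 : ℕ)

/-- Start of a phase: the tree consists of the row `vR`. -/
def phaseInit : Prog :=
  .forUpTo vJ vM
    (.assignRealEntry rMinv (.var vJ) (.sub (.read rD (.var vR) (.var vJ)) (.entry rV (.var vJ))) ;;
      .assignEntry vWay (.var vJ) (.var vR) ;;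
      .assignEntry vUsed (.var vJ) (.const 0)) ;;
  (.assignRealEntry rU (.var vR) .zero ;; .assign vRank (.const 0) ;; .assign vDone (.const 0))

/-- Find a column outside the tree with the smallest slack. -/
def findMin : Prog :=
  .assign vJ1 (.var vM) ;;
  .forUpTo vJ vM
    (.ite (.isZero (.entry vUsed (.var vJ)))
      (.ite (.intLe (.var vM) (.var vJ1)) (.assign vJ1 (.var vJ))
        (.ite (.realLt (.entry rMinv (.var vJ)) (.entry rMinv (.var vJ1)))
          (.assign vJ1 (.var vJ)) .skip))
      .skip)

/-- Change the dual variables by the smallest slack. -/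
def shiftDuals : Prog :=
  .assignReal rDelta (.entry rMinv (.var vJ1)) ;;
  .forUpTo vJ vM
    (.ite (.isZero (.entry vUsed (.var vJ)))
      (.assignRealEntry rMinv (.var vJ) (.sub (.entry rMinv (.var vJ)) (.var rDelta)))
      (.assignRealEntry rV (.var vJ) (.sub (.entry rV (.var vJ)) (.var rDelta)) ;;
        .assignRealEntry rU (.pred (.entry vP (.var vJ)))
          (.add (.entry rU (.pred (.entry vP (.var vJ)))) (.var rDelta)))) ;;
  .assignRealEntry rU (.var vR) (.add (.entry rU (.var vR)) (.var rDelta))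

/-- The slack of column `vJ` in row `vI0`. -/
def slackExpr : RealExpr :=
  .sub (.sub (.read rD (.var vI0) (.var vJ)) (.entry rU (.var vI0))) (.entry rV (.var vJ))

/-- Update the smallest slacks after row `vI0` has entered the tree. -/
def relaxSlacks : Prog :=
  .assign vI0 (.pred (.entry vP (.var vJ1))) ;;
  .forUpTo vJ vM
    (.ite (.isZero (.entry vUsed (.var vJ)))
      (.ite (.realLt slackExpr (.entry rMinv (.var vJ)))
        (.assignRealEntry rMinv (.var vJ) slackExpr ;; .assignEntry vWay (.var vJ) (.var vI0))
        .skip)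
      .skip)

/-- Column `vJ1` enters the tree; if it is free, the growth is finished. -/
def enterColumn : Prog :=
  (.assign vRank (.succ (.var vRank)) ;; .assignEntry vUsed (.var vJ1) (.var vRank)) ;;
  .ite (.isZero (.entry vP (.var vJ1))) (.assign vDone (.const 1)) relaxSlacks

/-- One round of the growth of the tree. -/
def growStep : Prog := findMin ;; shiftDuals ;; enterColumn

/-- Match column `vJ1` with the preceding row and continue with the former column of this row. -/
def augmentStep : Prog :=
  .assign vI0 (.entry vWay (.var vJ1)) ;;
  .assignEntry vP (.var vJ1) (.succ (.var vI0)) ;;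
  .ite (.intEq (.var vI0) (.var vR))
    (.assignEntry vQ (.var vR) (.var vJ1) ;; .assign vDone (.const 0))
    (.assign vJ2 (.entry vQ (.var vI0)) ;;
      .assignEntry vQ (.var vI0) (.var vJ1) ;;
      .assign vJ1 (.var vJ2))

/-- Match the row `vR`. -/
def phaseProg : Prog :=
  phaseInit ;; .loop (.isZero (.var vDone)) growStep ;;
    .loop (.not (.isZero (.var vDone))) augmentStep

/-- The assignment algorithm: the size is `vM` and the cost matrix is the real array `rD`. Row `i`
is assigned to column `i` of the vector `vQ`. -/
def assignmentProg : Prog :=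
  .forUpTo vJ vM (.assignEntry vP (.var vJ) (.const 0)) ;; .forUpTo vR vM phaseProg

/-- `TreeInv`, read off the memory. -/
def MemTree (D : ℕ → ℕ → ℝ) (m r : ℕ) (t : Memory) : Prop :=
  TreeInv D m r (t.rvec rU) (t.rvec rV) (t.vec vP) (t.vec vQ) (t.vec vUsed) (t.vec vWay)
    (t.rvec rMinv) (t.var vRank)

/-- `AugInv`, read off the memory. -/
def MemAug (D : ℕ → ℕ → ℝ) (m r : ℕ) (t : Memory) : Prop :=
  AugInv D m r (t.rvec rU) (t.rvec rV) (t.vec vP) (t.vec vQ) (t.vec vUsed) (t.vec vWay)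
    (t.var vJ1)

/-- `MatchInv`, read off the memory. -/
def MemMatch (D : ℕ → ℕ → ℝ) (m r : ℕ) (t : Memory) : Prop :=
  MatchInv D m r (t.rvec rU) (t.rvec rV) (t.vec vP) (t.vec vQ)

section Spec

variable {D : ℕ → ℕ → ℝ} {m r : ℕ} {s : Memory}

theorem phaseInit_spec (hm : s.var vM = m) (hr : s.var vR = r) (hD : s.real rD = D)
    (h : MemMatch D m r s) :
    RunsWithin phaseInit s (5 * m + 5) fun t => MemTree D m r t ∧ t.var vDone = 0 ∧
      t.var vRank = 0 := by
  have h1 := RunsWithin.forUpTo (v := vJ) (B := vM) (N := m) (s := s)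
    (p := .assignRealEntry rMinv (.var vJ)
        (.sub (.read rD (.var vR) (.var vJ)) (.entry rV (.var vJ))) ;;
      .assignEntry vWay (.var vJ) (.var vR) ;; .assignEntry vUsed (.var vJ) (.const 0))
    (fun j t => ∀ k < j, t.vec vUsed k = 0 ∧ t.vec vWay k = r ∧
      t.rvec rMinv k = D r k - s.rvec rV k) 3 hm (by decide) (by decide) (by simp) (by
      intro j hj t hfr htj hI
      refine RunsWithin.of_run rfl (by decide) fun k hk => ?_
      have htr : t.var vR = r := by rw [hfr.var vR (by decide), hr]
      have htD : t.real rD = D := by rw [hfr.real rD (by decide), hD]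
      have htv : t.rvec rV = s.rvec rV := hfr.rvec rV (by decide)
      by_cases hkj : k = j
      · simp [Prog.run, hkj, htj, htr, htD, htv]
      · simpa [Prog.run, htj, hkj] using hI k (by omega))
  refine (h1.seq (l := 3) fun t ht => ?_).mono (by omega) fun t ht => ht
  obtain ⟨hI, hfr⟩ := ht
  refine RunsWithin.of_run rfl (by decide) ?_
  have htr : t.var vR = r := by rw [hfr.var vR (by decide), hr]
  have hinit := TreeInv.init (D := D) (p := s.vec vP) (q := s.vec vQ) h (fun j hj => (hI j hj).1)
    (fun j hj => (hI j hj).2.1) (fun j hj => (hI j hj).2.2)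
  rw [← hfr.rvec rU (by decide), ← hfr.rvec rV (by decide), ← hfr.vec vP (by decide),
    ← hfr.vec vQ (by decide)] at hinit
  exact ⟨by simpa [MemTree, Prog.run, htr] using hinit, by simp [Prog.run], by simp [Prog.run]⟩

theorem findMin_spec (hm : s.var vM = m) (hex : ∃ j < m, s.vec vUsed j = 0) :
    RunsWithin findMin s (6 * m + 3) fun t => t.var vJ1 < m ∧ s.vec vUsed (t.var vJ1) = 0 ∧
      ∀ j < m, s.vec vUsed j = 0 → s.rvec rMinv (t.var vJ1) ≤ s.rvec rMinv j := by
  have h0 : RunsWithin (.assign vJ1 (.var vM)) s 1 fun t => t = s.writeInt vJ1 0 0 m :=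
    RunsWithin.of_run rfl le_rfl (by simp [Prog.run, hm])
  refine (h0.seq (l := m * (4 + 2) + 2) fun t ht => ?_).mono (by omega) fun t ht => ht
  subst ht
  refine (RunsWithin.forUpTo (N := m) (fun i t =>
    (t.var vJ1 = m ∧ ∀ j < i, s.vec vUsed j ≠ 0) ∨
    (t.var vJ1 < m ∧ s.vec vUsed (t.var vJ1) = 0 ∧
      ∀ j < i, s.vec vUsed j = 0 → s.rvec rMinv (t.var vJ1) ≤ s.rvec rMinv j)) 4
    (by simpa using hm) (by decide) (by decide) (by simp) ?_).mono le_rfl fun t ht => ?_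
  · intro i hi t hfr hti hI
    refine RunsWithin.of_run rfl (by decide) ?_
    have htm : t.var vM = m := by rw [hfr.var vM (by decide)]; simpa using hm
    have htu : t.vec vUsed = s.vec vUsed := by rw [hfr.vec vUsed (by decide)]; simp
    have htv : t.rvec rMinv = s.rvec rMinv := by rw [hfr.rvec rMinv (by decide)]; simp
    have hsucc : ∀ j, j < i + 1 → j < i ∨ j = i := fun j hj => by omega
    by_cases hu : s.vec vUsed i = 0
    · rcases hI with ⟨h1, h2⟩ | ⟨h1, h2, h3⟩
      · right
        simp only [Prog.run, Test.Holds, IntExpr.eval_entry, IntExpr.eval_var, IntExpr.eval_const,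
          hti, htu, hu, htm, h1, le_refl, if_true]
        refine ⟨by simpa using hi, by simpa using hu, fun j hj huj => ?_⟩
        rcases hsucc j hj with hj | rfl
        · exact absurd huj (h2 j hj)
        · simp
      · right
        by_cases hlt : s.rvec rMinv i < s.rvec rMinv (t.var vJ1)
        · simp only [Prog.run, Test.Holds, IntExpr.eval_entry, IntExpr.eval_var,
            IntExpr.eval_const, RealExpr.eval_entry, hti, htu, hu, htm, htv, not_le.mpr h1,
            le_refl, if_true, if_false, not_le.mpr hlt, not_false_eq_true]
          refine ⟨by simpa using hi, by simpa using hu, fun j hj huj => ?_⟩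
          rcases hsucc j hj with hj | rfl
          · simpa using hlt.le.trans (h3 j hj huj)
          · simp
        · simp only [Prog.run, Test.Holds, IntExpr.eval_entry, IntExpr.eval_var,
            IntExpr.eval_const, RealExpr.eval_entry, hti, htu, hu, htm, htv, not_le.mpr h1,
            le_refl, if_true, if_false, not_lt.mp hlt, not_true_eq_false]
          refine ⟨by simpa using h1, by simpa using h2, fun j hj huj => ?_⟩
          rcases hsucc j hj with hj | rfl
          · simpa using h3 j hj huj
          · simpa using not_lt.mp hlt
    · have hu' : ¬ s.vec vUsed i ≤ 0 := by omega
      simp only [Prog.run, Test.Holds, IntExpr.eval_entry, IntExpr.eval_var, IntExpr.eval_const,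
        hti, htu, hu', if_false]
      refine hI.imp (fun h => ⟨by simpa using h.1, fun j hj => ?_⟩) fun h =>
        ⟨by simpa using h.1, by simpa using h.2.1, fun j hj huj => ?_⟩
      · rcases hsucc j hj with hj | rfl
        · exact h.2 j hj
        · exact hu
      · rcases hsucc j hj with hj | rfl
        · simpa using h.2.2 j hj huj
        · exact absurd huj hu
  · rcases ht.1 with ⟨-, h⟩ | h
    · obtain ⟨j, hj, hu⟩ := hex
      exact absurd hu (h j hj)
    · exact h

theorem shiftDuals_spec (hm : s.var vM = m) (hr : s.var vR = r) (h : MemTree D m r s)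
    (hj₁ : s.var vJ1 < m) (hu₁ : s.vec vUsed (s.var vJ1) = 0)
    (hmin : ∀ j < m, s.vec vUsed j = 0 → s.rvec rMinv (s.var vJ1) ≤ s.rvec rMinv j) :
    RunsWithin shiftDuals s (5 * m + 4) fun t => MemTree D m r t ∧
      t.rvec rMinv (s.var vJ1) = 0 ∧ ∀ j < m, s.vec vUsed j = 0 → 0 ≤ t.rvec rMinv j := by
  set δ := s.rvec rMinv (s.var vJ1) with hδ
  have h0 : RunsWithin (.assignReal rDelta (.entry rMinv (.var vJ1))) s 1
      fun t => t = s.writeReal rDelta 0 0 δ := RunsWithin.of_run rfl le_rfl rfl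
  refine (h0.seq (l := (m * (3 + 2) + 2) + 1) fun t ht => ?_).mono (by omega) fun t ht => ht
  subst ht
  refine RunsWithin.seq (RunsWithin.forUpTo (N := m) (fun j t =>
    (∀ k < m, t.rvec rMinv k = if s.vec vUsed k = 0 ∧ k < j then s.rvec rMinv k - δ
      else s.rvec rMinv k) ∧
    (∀ k < m, t.rvec rV k = if s.vec vUsed k ≠ 0 ∧ k < j then s.rvec rV k - δ else s.rvec rV k) ∧
    t.rvec rU r = s.rvec rU r ∧
    (∀ i < r, t.rvec rU i = if s.vec vUsed (s.vec vQ i) ≠ 0 ∧ s.vec vQ i < j then s.rvec rU i + δ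
      else s.rvec rU i)) 3 (by simpa using hm) (by decide) (by decide) (by simp) ?_)
    fun t ht => ?_
  · rintro j hj t hfr htj ⟨h1, h2, h3, h4⟩
    refine RunsWithin.of_run rfl (by decide) ?_
    have htu : t.vec vUsed = s.vec vUsed := by rw [hfr.vec vUsed (by decide)]; simp
    have htp : t.vec vP = s.vec vP := by rw [hfr.vec vP (by decide)]; simp
    have htδ : t.rvar rDelta = δ := by rw [hfr.rvar rDelta (by decide)]; simp
    by_cases hu : s.vec vUsed j = 0
    · simp only [Prog.run, Test.Holds, IntExpr.eval_entry, IntExpr.eval_var, IntExpr.eval_const,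
        htj, htu, hu, le_refl, if_true, RealExpr.eval_sub, RealExpr.eval_entry,
        RealExpr.eval_var, htδ]
      refine ⟨fun k hk => ?_, fun k hk => ?_, by simpa using h3, fun i hi => ?_⟩
      · by_cases hkj : k = j
        · subst hkj; simp [hu, h1 k hk]
        · have : k < j + 1 ↔ k < j := by omega
          simp [hkj, this, h1 k hk]
      · have : (s.vec vUsed k ≠ 0 ∧ k < j + 1) ↔ (s.vec vUsed k ≠ 0 ∧ k < j) := by
          constructor
          · rintro ⟨ha, hb⟩
            refine ⟨ha, lt_of_le_of_ne (by omega) ?_⟩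
            rintro rfl; exact ha hu
          · rintro ⟨ha, hb⟩; exact ⟨ha, by omega⟩
        simp only [this]
        simpa using h2 k hk
      · have : (s.vec vUsed (s.vec vQ i) ≠ 0 ∧ s.vec vQ i < j + 1) ↔
            (s.vec vUsed (s.vec vQ i) ≠ 0 ∧ s.vec vQ i < j) := by
          constructor
          · rintro ⟨ha, hb⟩
            refine ⟨ha, lt_of_le_of_ne (by omega) ?_⟩
            intro hc; rw [hc] at ha; exact ha hu
          · rintro ⟨ha, hb⟩; exact ⟨ha, by omega⟩
        simp only [this]
        simpa using h4 i hi
    · have hu' : ¬ s.vec vUsed j ≤ 0 := by omega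
      obtain ⟨hpr, hqp⟩ := h.matched.col j hj (h.used_col j hj hu)
      have hp0 := h.used_col j hj hu
      set i₀ := s.vec vP j - 1 with hi₀
      have hi₀r : i₀ < r := by omega
      simp only [Prog.run, Test.Holds, IntExpr.eval_entry, IntExpr.eval_var, IntExpr.eval_const,
        IntExpr.eval_pred, htj, htu, htp, hu', if_false, RealExpr.eval_sub, RealExpr.eval_add,
        RealExpr.eval_entry, RealExpr.eval_var, htδ, Memory.writeReal_vec, Memory.writeReal_var,
        ← hi₀]
      rw [Memory.writeReal_rvar_ne _ _ _ _ (by decide), htδ]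
      refine ⟨fun k hk => ?_, fun k hk => ?_, by simpa [hi₀r.ne'] using h3, fun i hi => ?_⟩
      · have : (s.vec vUsed k = 0 ∧ k < j + 1) ↔ (s.vec vUsed k = 0 ∧ k < j) := by
          constructor
          · rintro ⟨ha, hb⟩
            refine ⟨ha, lt_of_le_of_ne (by omega) ?_⟩
            rintro rfl; exact hu ha
          · rintro ⟨ha, hb⟩; exact ⟨ha, by omega⟩
        simp only [this]
        simpa using h1 k hk
      · by_cases hkj : k = j
        · subst hkj; simp [hu, h2 k hk]
        · have : k < j + 1 ↔ k < j := by omega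
          simp [hkj, this, h2 k hk]
      · by_cases hii : i = i₀
        · rw [hii]
          have h5 := h4 i₀ hi₀r
          rw [hqp] at h5 ⊢
          simp [hu, h5]
        · have hqj : s.vec vQ i ≠ j := fun hc => by
            have := (h.matched.row i hi).2
            rw [hc] at this
            omega
          have : s.vec vQ i < j + 1 ↔ s.vec vQ i < j := by omega
          simp [hii, this, h4 i hi]
  · obtain ⟨⟨h1, h2, h3, h4⟩, hfr⟩ := ht
    refine RunsWithin.of_run rfl (by decide) ?_
    have htu : t.vec vUsed = s.vec vUsed := by rw [hfr.vec vUsed (by decide)]; simp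
    have htp : t.vec vP = s.vec vP := by rw [hfr.vec vP (by decide)]; simp
    have htq : t.vec vQ = s.vec vQ := by rw [hfr.vec vQ (by decide)]; simp
    have htw : t.vec vWay = s.vec vWay := by rw [hfr.vec vWay (by decide)]; simp
    have htc : t.var vRank = s.var vRank := by rw [hfr.var vRank (by decide)]; simp
    have htδ : t.rvar rDelta = δ := by rw [hfr.rvar rDelta (by decide)]; simp
    have htr : t.var vR = r := by rw [hfr.var vR (by decide)]; simpa using hr
    have key := TreeInv.shift h hj₁ hu₁ hmin
      (u' := Function.update (t.rvec rU) r (t.rvec rU r + δ)) (v' := t.rvec rV)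
      (minv' := t.rvec rMinv) (fun i hi => by
        rcases hi with rfl | ⟨hi, hui⟩
        · rw [Function.update_self, h3]
        · rw [Function.update_of_ne hi.ne, h4 i hi,
            if_pos ⟨hui, (h.matched.row i hi).1⟩])
      (fun i hi hui => by
        rw [Function.update_of_ne hi.ne, h4 i hi, if_neg (by simp [hui])])
      (fun j hj hu => by rw [h2 j hj, if_pos ⟨hu, hj⟩])
      (fun j hj hu => by rw [h2 j hj, if_neg (by simp [hu])])
      (fun j hj hu => by rw [h1 j hj, if_pos ⟨hu, hj⟩])
    refine ⟨?_, by simpa [Prog.run] using key.2.1, by simpa [Prog.run] using key.2.2⟩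
    simpa [MemTree, Prog.run, htr, htδ, htu, htp, htq, htw, htc] using key.1

theorem relaxSlacks_spec (hm : s.var vM = m) {i₀ : ℕ} (hi₀ : s.vec vP (s.var vJ1) - 1 = i₀)
    (hD : s.real rD = D) :
    RunsWithin relaxSlacks s (6 * m + 3) fun t =>
      (∀ j < m, s.vec vUsed j ≠ 0 → t.vec vWay j = s.vec vWay j) ∧
      ∀ j < m, s.vec vUsed j = 0 →
        (D i₀ j - s.rvec rU i₀ - s.rvec rV j < s.rvec rMinv j ∧
          t.rvec rMinv j = D i₀ j - s.rvec rU i₀ - s.rvec rV j ∧ t.vec vWay j = i₀) ∨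
        (s.rvec rMinv j ≤ D i₀ j - s.rvec rU i₀ - s.rvec rV j ∧
          t.rvec rMinv j = s.rvec rMinv j ∧ t.vec vWay j = s.vec vWay j) := by
  have h0 : RunsWithin (.assign vI0 (.pred (.entry vP (.var vJ1)))) s 1
      fun t => t = s.writeInt vI0 0 0 i₀ := RunsWithin.of_run rfl le_rfl (by rw [← hi₀]; rfl)
  refine (h0.seq (l := m * (4 + 2) + 2) fun t ht => ?_).mono (by omega) fun t ht => ht
  subst ht
  refine (RunsWithin.forUpTo (N := m) (fun i t =>
    (∀ j < m, (s.vec vUsed j ≠ 0 ∨ i ≤ j) →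
      t.vec vWay j = s.vec vWay j ∧ t.rvec rMinv j = s.rvec rMinv j) ∧
    ∀ j < i, s.vec vUsed j = 0 →
        (D i₀ j - s.rvec rU i₀ - s.rvec rV j < s.rvec rMinv j ∧
          t.rvec rMinv j = D i₀ j - s.rvec rU i₀ - s.rvec rV j ∧ t.vec vWay j = i₀) ∨
        (s.rvec rMinv j ≤ D i₀ j - s.rvec rU i₀ - s.rvec rV j ∧
          t.rvec rMinv j = s.rvec rMinv j ∧ t.vec vWay j = s.vec vWay j)) 4
    (by simpa using hm) (by decide) (by decide) (by simp) ?_).mono le_rfl fun t ht =>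
      ⟨fun j hj hu => (ht.1.1 j hj (Or.inl hu)).1, ht.1.2⟩
  rintro i hi t hfr hti ⟨h1, h2⟩
  refine RunsWithin.of_run rfl (by decide) ?_
  have htu : t.vec vUsed = s.vec vUsed := by rw [hfr.vec vUsed (by decide)]; simp
  have htU : t.rvec rU = s.rvec rU := by rw [hfr.rvec rU (by decide)]; simp
  have htV : t.rvec rV = s.rvec rV := by rw [hfr.rvec rV (by decide)]; simp
  have htD : t.real rD = D := by rw [hfr.real rD (by decide)]; simpa using hD
  have hti₀ : t.var vI0 = i₀ := by rw [hfr.var vI0 (by decide)]; simp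
  have hmi := (h1 i hi (Or.inr le_rfl)).2
  by_cases hu : s.vec vUsed i = 0
  · by_cases hlt : D i₀ i - s.rvec rU i₀ - s.rvec rV i < s.rvec rMinv i
    · simp only [Prog.run, Test.Holds, slackExpr, IntExpr.eval_entry, IntExpr.eval_var,
        IntExpr.eval_const, RealExpr.eval_sub, RealExpr.eval_entry, RealExpr.eval_read, hti, htu,
        hu, htU, htV, htD, hti₀, hmi, le_refl, if_true, not_le.mpr hlt, not_false_eq_true,
        Memory.writeReal_var]
      refine ⟨fun j hj hji => ?_, fun j hj huj => ?_⟩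
      · have hne : j ≠ i := by
          rintro rfl
          rcases hji with h | h
          · exact h hu
          · omega
        simpa [hne] using h1 j hj (hji.imp id fun h => by omega)
      · by_cases hne : j = i
        · subst hne; simp [hlt]
        · simpa [hne] using h2 j (by omega) huj
    · simp only [Prog.run, Test.Holds, slackExpr, IntExpr.eval_entry, IntExpr.eval_var,
        IntExpr.eval_const, RealExpr.eval_sub, RealExpr.eval_entry, RealExpr.eval_read, hti, htu,
        hu, htU, htV, htD, hti₀, hmi, le_refl, if_true, not_lt.mp hlt, not_true_eq_false, if_false]
      refine ⟨fun j hj hji => ?_, fun j hj huj => ?_⟩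
      · simpa using h1 j hj (hji.imp id fun h => by omega)
      · by_cases hne : j = i
        · subst hne
          right
          simpa [hmi, (h1 j hi (Or.inr le_rfl)).1] using not_lt.mp hlt
        · simpa using h2 j (by omega) huj
  · have hu' : ¬ s.vec vUsed i ≤ 0 := by omega
    simp only [Prog.run, Test.Holds, IntExpr.eval_entry, IntExpr.eval_var, IntExpr.eval_const,
      hti, htu, hu', if_false]
    refine ⟨fun j hj hji => ?_, fun j hj huj => ?_⟩
    · simpa using h1 j hj (hji.imp id fun h => by omega)
    · have hne : j ≠ i := by rintro rfl; exact hu huj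
      simpa using h2 j (by omega) huj

/-- The state of a phase during the growth of the tree and at its end. -/
def MemGrow (D : ℕ → ℕ → ℝ) (m r : ℕ) (t : Memory) : Prop :=
  (t.var vDone = 0 ∧ MemTree D m r t) ∨
    (t.var vDone = 1 ∧ MemAug D m r t ∧ t.vec vUsed (t.var vJ1) ≤ m)

theorem enterColumn_spec (hm : s.var vM = m) (hD : s.real rD = D)
    (h : MemTree D m r s) (hdone : s.var vDone = 0)
    (hj₁ : s.var vJ1 < m) (hu₁ : s.vec vUsed (s.var vJ1) = 0)
    (h0 : s.rvec rMinv (s.var vJ1) = 0)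
    (hnn : ∀ j < m, s.vec vUsed j = 0 → 0 ≤ s.rvec rMinv j) :
    RunsWithin enterColumn s (6 * m + 6) fun t => MemGrow D m r t ∧
      t.var vRank = s.var vRank + 1 := by
  set j₁ := s.var vJ1 with hj₁def
  set s' := (s.writeInt vRank 0 0 (s.var vRank + 1)).writeInt vUsed j₁ 0 (s.var vRank + 1)
    with hs'
  have h1 : RunsWithin (.assign vRank (.succ (.var vRank)) ;;
      .assignEntry vUsed (.var vJ1) (.var vRank)) s 2 fun t => t = s' :=
    RunsWithin.of_run rfl (by decide) (by simp [Prog.run, hs', ← hj₁def])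
  have hp' : s'.vec vP = s.vec vP := by simp [hs']
  have hj' : s'.var vJ1 = j₁ := by simp [hs', hj₁def]
  have hrank' : s'.var vRank = s.var vRank + 1 := by simp [hs']
  refine (h1.seq (l := (6 * m + 3) + 1) fun t ht => ?_).mono (by omega) fun t ht => ht
  subst ht
  refine RunsWithin.ite (fun hb => ?_) fun hb => ?_
  · have hp : s.vec vP j₁ = 0 := by
      simpa [Test.Holds, hp', hj'] using hb
    refine RunsWithin.of_run rfl (by simp [Prog.cost]) ?_
    have key := TreeInv.toAug h hj₁ hu₁ h0 hnn hp
    refine ⟨Or.inr ⟨by simp [Prog.run], ?_, ?_⟩, by simp [Prog.run, hrank']⟩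
    · simpa [MemAug, Prog.run, hs', ← hj₁def] using key
    · simpa [Prog.run, hs', ← hj₁def] using TreeInv.cnt_lt h hj₁ hu₁
  · have hp : s.vec vP j₁ ≠ 0 := by
      intro hp
      exact hb (by simp [Test.Holds, hp', hj', hp])
    refine (relaxSlacks_spec (s := s') (D := D) (m := m) (i₀ := s.vec vP j₁ - 1)
      (by simpa [hs'] using hm) (by rw [hp', hj']) (by simpa [hs'] using hD)).frame.mono le_rfl
      fun t ht => ?_
    obtain ⟨⟨hw, hrelax⟩, hfr⟩ := ht
    have hu' : s'.vec vUsed = Function.update (s.vec vUsed) j₁ (s.var vRank + 1) := by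
      simp [hs']
    have hw' : s'.vec vWay = s.vec vWay := by simp [hs']
    have hU' : s'.rvec rU = s.rvec rU := by simp [hs']
    have hV' : s'.rvec rV = s.rvec rV := by simp [hs']
    have hM' : s'.rvec rMinv = s.rvec rMinv := by simp [hs']
    rw [hu', hw'] at hw
    rw [hu', hw', hU', hV', hM'] at hrelax
    have key := TreeInv.grow h hj₁ hu₁ h0 hnn hp hw hrelax
    have hrk : t.var vRank = s.var vRank + 1 := by rw [hfr.var vRank (by decide), hrank']
    refine ⟨Or.inl ⟨?_, ?_⟩, hrk⟩
    · rw [hfr.var vDone (by decide)]; simpa [hs'] using hdone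
    · unfold MemTree
      rw [hfr.rvec rU (by decide), hfr.rvec rV (by decide), hfr.vec vP (by decide),
        hfr.vec vQ (by decide), hfr.vec vUsed (by decide), hrk, hu', hU', hV', hp']
      have hq' : s'.vec vQ = s.vec vQ := by simp [hs']
      rw [hq']
      exact key

theorem growStep_spec (hm : s.var vM = m) (hD : s.real rD = D) (hr : s.var vR = r) (hrm : r < m)
    (h : MemTree D m r s) (hdone : s.var vDone = 0) :
    RunsWithin growStep s (17 * m + 13) fun t => MemGrow D m r t ∧
      m - t.var vRank < m - s.var vRank := by
  have hex : ∃ j < m, s.vec vUsed j = 0 := by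
    obtain ⟨j, hj, hp⟩ := h.matched.exists_free hrm
    refine ⟨j, hj, ?_⟩
    by_contra hu
    exact h.used_col j hj hu hp
  refine ((findMin_spec hm hex).frame.seq (l := (5 * m + 4) + (6 * m + 6)) fun t ht => ?_).mono
    (by omega) fun t ht => ht
  obtain ⟨⟨hj₁, hu₁, hmin⟩, hfr⟩ := ht
  have htree : MemTree D m r t := by
    unfold MemTree
    rw [hfr.rvec rU (by decide), hfr.rvec rV (by decide), hfr.vec vP (by decide),
      hfr.vec vQ (by decide), hfr.vec vUsed (by decide), hfr.vec vWay (by decide),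
      hfr.rvec rMinv (by decide), hfr.var vRank (by decide)]
    exact h
  have hcnt := TreeInv.cnt_lt h hj₁ hu₁
  rw [← hfr.vec vUsed (by decide)] at hu₁ hmin
  rw [← hfr.rvec rMinv (by decide)] at hmin
  rw [← hfr.var vM (by decide)] at hm
  refine (shiftDuals_spec hm (by rw [hfr.var vR (by decide), hr]) htree hj₁ hu₁ hmin).frame.seq
    fun w hw => ?_
  obtain ⟨⟨hwt, hw0, hwnn⟩, hfr'⟩ := hw
  rw [← hfr'.var vJ1 (by decide)] at hj₁ hu₁ hw0
  rw [← hfr'.vec vUsed (by decide)] at hu₁ hwnn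
  refine (enterColumn_spec (by rw [hfr'.var vM (by decide), hm])
    (by rw [hfr'.real rD (by decide), hfr.real rD (by decide), hD]) hwt
    (by rw [hfr'.var vDone (by decide), hfr.var vDone (by decide), hdone]) hj₁ hu₁ hw0
    hwnn).mono le_rfl fun z hz => ⟨hz.1, ?_⟩
  rw [hz.2, hfr'.var vRank (by decide), hfr.var vRank (by decide)]
  omega

theorem augmentStep_spec (hr : s.var vR = r) (h : MemAug D m r s) (hdone : s.var vDone = 1) :
    RunsWithin augmentStep s 6 fun t =>
      (t.var vDone = 1 ∧ MemAug D m r t ∧ t.vec vUsed (t.var vJ1) < s.vec vUsed (s.var vJ1)) ∨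
      (t.var vDone = 0 ∧ MemMatch D m (r + 1) t) := by
  refine RunsWithin.of_run rfl (by decide) ?_
  by_cases hw : s.vec vWay (s.var vJ1) = r
  · right
    have := AugInv.finish h hw
    simpa [augmentStep, Prog.run, Test.Holds, MemMatch, hr, hw] using this
  · left
    have := AugInv.step h hw
    have hw' : ¬ (s.vec vWay (s.var vJ1) ≤ r ∧ r ≤ s.vec vWay (s.var vJ1)) :=
      fun hc => hw (le_antisymm hc.1 hc.2)
    simpa [augmentStep, Prog.run, Test.Holds, MemAug, hr, hw', hdone] using this

theorem phaseProg_spec (hm : s.var vM = m) (hD : s.real rD = D) (hr : s.var vR = r) (hrm : r < m)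
    (h : MemMatch D m r s) :
    RunsWithin phaseProg s (30 * (m + 1) ^ 2) fun t => MemMatch D m (r + 1) t := by
  refine ((phaseInit_spec hm hr hD h).frame.seq
    (l := (m * (17 * m + 13 + 1) + 1) + (m * (6 + 1) + 1)) fun t ht => ?_).mono (by nlinarith)
    fun t ht => ht
  obtain ⟨⟨htree, hdone, hrank⟩, hfr⟩ := ht
  let J : Memory → Prop := fun w => MemGrow D m r w ∧ w.var vM = m ∧ w.real rD = D ∧ w.var vR = r
  have hJ : J t := ⟨Or.inl ⟨hdone, htree⟩, by rw [hfr.var vM (by decide), hm],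
    by rw [hfr.real rD (by decide), hD], by rw [hfr.var vR (by decide), hr]⟩
  refine RunsWithin.seq ((RunsWithin.loop J (fun w => m - w.var vRank) (17 * m + 13)
    (fun w hw hb => ?_) t hJ).mono (by simp [hrank]) fun w hw => hw) fun w hw => ?_
  · obtain ⟨hg, hwm, hwD, hwr⟩ := hw
    have hd : w.var vDone = 0 := by simpa [Test.Holds] using hb
    have hT : MemTree D m r w := by
      rcases hg with h | h
      · exact h.2
      · omega
    exact (growStep_spec hwm hwD hwr hrm hT hd).frame.mono le_rfl fun z hz =>
      ⟨⟨hz.1.1, by rw [hz.2.var vM (by decide), hwm], by rw [hz.2.real rD (by decide), hwD],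
        by rw [hz.2.var vR (by decide), hwr]⟩, hz.1.2⟩
  · obtain ⟨⟨hg, -, -, hwr⟩, hb⟩ := hw
    have hd : w.var vDone ≠ 0 := by simpa [Test.Holds] using hb
    obtain ⟨hd1, haug, hle⟩ : w.var vDone = 1 ∧ MemAug D m r w ∧
        w.vec vUsed (w.var vJ1) ≤ m := hg.resolve_left fun h => hd h.1
    let J' : Memory → Prop := fun z => z.var vR = r ∧
      ((z.var vDone = 1 ∧ MemAug D m r z) ∨ (z.var vDone = 0 ∧ MemMatch D m (r + 1) z))
    refine (RunsWithin.loop J'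
      (fun z => if z.var vDone = 0 then 0 else z.vec vUsed (z.var vJ1)) 6
      (fun z hz hb => ?_) w ⟨hwr, Or.inl ⟨hd1, haug⟩⟩).mono ?_ fun z hz => ?_
    · have hzd : z.var vDone ≠ 0 := by
        have : ¬ z.var vDone ≤ 0 := hb
        omega
      obtain ⟨hz1, hza⟩ := hz.2.resolve_right fun h => hzd h.1
      refine (augmentStep_spec hz.1 hza hz1).frame.mono le_rfl fun y hy => ?_
      refine ⟨⟨by rw [hy.2.var vR (by decide), hz.1], hy.1.imp (fun h => ⟨h.1, h.2.1⟩) id⟩, ?_⟩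
      rcases hy.1 with ⟨h1, -, h3⟩ | ⟨h1, -⟩
      · simpa [h1, hz1] using h3
      · simpa [h1, hz1] using Nat.pos_of_ne_zero hza.used_ne
    · simp only [hd1, one_ne_zero, if_false]
      have := Nat.mul_le_mul_right (6 + 1) hle
      omega
    · have hz0 : z.var vDone = 0 := by
        have : ¬ ¬ z.var vDone ≤ 0 := hz.2
        omega
      rcases hz.1.2 with h1 | h1
      · omega
      · exact h1.2

theorem assignmentProg_spec (hm : s.var vM = m) (hD : s.real rD = D) :
    RunsWithin assignmentProg s (40 * (m + 1) ^ 3) fun t =>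
      ∃ π : Equiv.Perm (Fin m), (∀ i, ((π i : Fin m) : ℕ) = t.vec vQ i) ∧
        ∀ τ : Equiv.Perm (Fin m), ∑ i : Fin m, D i (π i) ≤ ∑ i : Fin m, D i (τ i) := by
  have h1 := RunsWithin.forUpTo (v := vJ) (B := vM) (N := m) (s := s)
    (p := .assignEntry vP (.var vJ) (.const 0)) (fun i t => ∀ j < i, t.vec vP j = 0) 1 hm (by decide) (by decide) (by simp)
    fun i hi t hfr hti hI => RunsWithin.of_run rfl (by decide) fun j hj => by
      by_cases hji : j = i
      · simp [Prog.run, hti, hji]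
      · simpa [Prog.run, hti, hji] using hI j (by omega)
  refine (h1.seq (l := m * (30 * (m + 1) ^ 2 + 2) + 2) fun t ht => ?_).mono (by nlinarith)
    fun t ht => ht
  obtain ⟨hI, hfr⟩ := ht
  have hinit : MemMatch D m 0 t := ⟨by simp, fun j hj hp => absurd (hI j hj) hp, by simp, by simp⟩
  refine (RunsWithin.forUpTo (N := m) (fun r t => MemMatch D m r t) (30 * (m + 1) ^ 2)
    (by rw [hfr.var vM (by decide), hm]) (by decide) (by decide) (by simpa [MemMatch] using hinit)
    fun r hr w hfr' hwr hw => ?_).mono le_rfl fun w hw => MatchInv.optimal hw.1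
  refine (phaseProg_spec (by rw [hfr'.var vM (by decide), hfr.var vM (by decide), hm])
    (by rw [hfr'.real rD (by decide), hfr.real rD (by decide), hD]) hwr hr hw).mono le_rfl
    fun z hz => by simpa [MemMatch] using hz

end Spec

/-! ### Solving the assignment problem -/

/-- Copy the input of the assignment problem to the arrays of `assignmentProg`. -/
def copyCosts : Prog :=
  .assign vM (.var 0) ;;
  .forUpTo vR vM (.forUpTo vJ vM
    (.setReal rD (.var vR) (.var vJ) (.read 0 (.var vR) (.var vJ))))

/-- Write the assignment as a `0/1` matrix. -/
def writeAssignment : Prog :=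
  .forUpTo vR vM (.setInt 1 (.var vR) (.entry vQ (.var vR)) (.const 1))

/-- The program that solves the assignment problem. -/
def lsapProg : Prog := copyCosts ;; assignmentProg ;; writeAssignment

theorem copyCosts_spec {s : Memory} {m : ℕ} (hm : s.var 0 = m) :
    RunsWithin copyCosts s (7 * (m + 1) ^ 2) fun t => t.var vM = m ∧
      ∀ i < m, ∀ j < m, t.real rD i j = s.real 0 i j := by
  have h0 : RunsWithin (.assign vM (.var 0)) s 1 fun t => t = s.writeInt vM 0 0 m :=
    RunsWithin.of_run rfl le_rfl (by simp [Prog.run, hm])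
  refine (h0.seq (l := m * ((m * (1 + 2) + 2) + 2) + 2) fun t ht => ?_).mono (by nlinarith)
    fun t ht => ht
  subst ht
  refine (RunsWithin.forUpTo (N := m)
    (fun i t => ∀ k < i, ∀ j < m, t.real rD k j = s.real 0 k j) (m * (1 + 2) + 2) (by simp)
    (by decide) (by decide) (by simp) fun i hi t hfr hti hI => ?_).mono le_rfl fun t ht =>
      ⟨by rw [ht.2.var vM (by decide)]; simp, ht.1⟩
  refine (RunsWithin.forUpTo (N := m)
    (fun j t => (∀ k < i, ∀ j < m, t.real rD k j = s.real 0 k j) ∧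
      ∀ l < j, t.real rD i l = s.real 0 i l) 1 (by rw [hfr.var vM (by decide)]; simp)
    (by decide) (by decide) ⟨by simpa using hI, by simp⟩
    fun j hj w hfr' hwj hw => RunsWithin.of_run rfl le_rfl ?_).mono le_rfl fun w hw k hk l hl => ?_
  · have hwi : w.var vR = i := by rw [hfr'.var vR (by decide), hti]
    have hw0 : w.real 0 = s.real 0 := by
      rw [hfr'.real 0 (by decide), hfr.real 0 (by decide)]; simp
    refine ⟨fun k hk l hl => ?_, fun l hl => ?_⟩
    · have : ¬ k = i := by omega
      simpa [Prog.run, hwi, hwj, this] using hw.1 k hk l hl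
    · by_cases hlj : l = j
      · simp [Prog.run, hwi, hwj, hlj, hw0]
      · simpa [Prog.run, hwi, hwj, hlj] using hw.2 l (by omega)
  · rcases Nat.lt_succ_iff_lt_or_eq.mp hk with hk | rfl
    · simpa using hw.1.1 k hk l hl
    · simpa using hw.1.2 l hl

theorem writeAssignment_spec {s : Memory} {m : ℕ} (hm : s.var vM = m)
    (h0 : ∀ i j, s.int 1 i j = 0) :
    RunsWithin writeAssignment s (3 * m + 2) fun t =>
      ∀ i < m, ∀ j, t.int 1 i j = if s.vec vQ i = j then 1 else 0 := by
  refine (RunsWithin.forUpTo (N := m)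
    (fun i t => ∀ k j, t.int 1 k j = if k < i ∧ s.vec vQ k = j then 1 else 0) 1 hm
    (by decide) (by decide) (by simp [h0])
    fun i hi t hfr hti hI => RunsWithin.of_run rfl le_rfl fun k j => ?_).mono (by omega)
    fun t ht i hi j => by simpa [hi] using ht.1 i j
  have htq : t.vec vQ = s.vec vQ := hfr.vec vQ (by decide)
  by_cases hki : k = i
  · subst hki
    have hn : t.int 1 k j = 0 := by simpa using hI k j
    by_cases hj : j = s.vec vQ k
    · simp [Prog.run, hti, htq, hj]
    · simp [Prog.run, hti, htq, hj, hn, Ne.symm hj]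
  · have : k < i + 1 ↔ k < i := by omega
    simp [Prog.run, hti, hki, this, hI k j]

theorem selectionMatrix_mem_argminSet {m : ℕ} {C : Matrix (Fin m) (Fin m) ℝ}
    {π : Equiv.Perm (Fin m)}
    (h : ∀ τ : Equiv.Perm (Fin m), ∑ i, C i (π i) ≤ ∑ i, C i (τ i)) :
    selectionMatrix π ∈ argminSet (lsapFeasible m) (totalCost C) := by
  refine ⟨mem_lsapFeasible_iff.mpr ⟨π, rfl⟩, fun Z hZ => ?_⟩
  obtain ⟨τ, rfl⟩ := mem_lsapFeasible_iff.mp hZ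
  rw [totalCost_selectionMatrix, totalCost_selectionMatrix]
  exact h τ

theorem lsapProg_spec {m : ℕ} (C : Matrix (Fin m) (Fin m) ℝ) :
    RunsWithin lsapProg (lsapInput C) (50 * (m + 1) ^ 3) fun t =>
      t.output 1 m m ∈ argminSet (lsapFeasible m) (totalCost C) := by
  have hm : (lsapInput C).var 0 = m := by simp [Memory.var, lsapInput]
  refine ((copyCosts_spec hm).frame.seq (l := 40 * (m + 1) ^ 3 + (3 * m + 2)) fun t ht => ?_).mono
    ?_ fun t ht => ht
  · obtain ⟨⟨htm, htD⟩, hfr⟩ := ht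
    refine (assignmentProg_spec (D := t.real rD) htm rfl).frame.seq fun w hw => ?_
    obtain ⟨⟨π, hπ, hopt⟩, hfr'⟩ := hw
    refine (writeAssignment_spec (m := m) (by rw [hfr'.var vM (by decide), htm]) fun i j => ?_).mono
      le_rfl fun z hz => ?_
    · rw [hfr'.int 1 (by decide), hfr.int 1 (by decide)]
      simp [lsapInput]
    · have hout : z.output 1 m m = selectionMatrix π := by
        funext i j
        have := hz i i.2 j
        rw [← hπ i] at this
        simp only [Memory.output, this, selectionMatrix, Fin.ext_iff]
      rw [hout]
      refine selectionMatrix_mem_argminSet fun τ => ?_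
      have hC : ∀ i j : Fin m, t.real rD i j = C i j := fun i j => by
        rw [htD i i.2 j j.2]
        simp [lsapInput]
      simpa only [hC] using hopt τ
  · have : (m + 1) ^ 2 ≤ (m + 1) ^ 3 := Nat.pow_le_pow_right (by omega) (by omega)
    have h2 : m + 1 ≤ (m + 1) ^ 3 := Nat.le_self_pow (by omega) _
    omega

/-! ### Finding the parent components -/

theorem SearchResult.not_reach {n : ℕ} {E : ℕ → ℕ → Prop} {K : ℕ} {cand lab root : ℕ → ℕ} {cnt : ℕ}
    (h : SearchResult n E K cand lab root cnt) {t t' : ℕ} (ht : t < t') (ht' : t' < cnt) :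
    ¬ ReachBelow n E (root t) (root t') := fun hr => by
  obtain ⟨a, ha, -⟩ := h.root_spec
  obtain ⟨-, -, h1, h2⟩ := ha t (ht.trans ht')
  obtain ⟨-, -, -, h3⟩ := ha t' ht'
  have := (h.lab_mono _ h1 (by omega) _ hr).2.2
  omega

theorem SearchResult.exists_root {n : ℕ} {E : ℕ → ℕ → Prop} {K : ℕ} {cand lab root : ℕ → ℕ}
    {cnt : ℕ} (h : SearchResult n E K cand lab root cnt) {i : ℕ} (hi : i < K) (hn : cand i < n) :
    ∃ t < cnt, ReachBelow n E (root t) (cand i) := by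
  obtain ⟨t, ht⟩ := Nat.exists_eq_succ_of_ne_zero (h.lab_cand i hi)
  exact ⟨t, by have := h.lab_le _ hn; omega, h.reach _ hn t ht⟩

theorem SearchResult.cnt_le {n : ℕ} {E : ℕ → ℕ → Prop} {K : ℕ} {cand lab root : ℕ → ℕ} {cnt : ℕ}
    (h : SearchResult n E K cand lab root cnt) : cnt ≤ K := by
  obtain ⟨a, ha, hmono⟩ := h.root_spec
  have := Finset.card_le_card_of_injOn (s := Finset.range cnt) (t := Finset.range K) a
    (fun t ht => by simpa using (ha t (by simpa using ht)).1)
    (fun t ht t' ht' he => by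
      rcases lt_trichotomy t t' with hlt | hlt | hlt
      · have := hmono t' (by simpa using ht') t hlt; omega
      · exact hlt
      · have := hmono t (by simpa using ht) t' hlt; omega)
  simpa using this

theorem reachBelow_swap {n : ℕ} {E : ℕ → ℕ → Prop} {x y : ℕ} :
    ReachBelow n (fun x y => E y x) x y ↔ ReachBelow n E y x := by
  rw [ReachBelow, ReachBelow, ← Relation.reflTransGen_swap]
  have : Function.swap (EdgeBelow n fun x y => E y x) = EdgeBelow n E := by
    funext a b
    simp only [Function.swap, EdgeBelow]
    exact propext ⟨fun h => ⟨h.2.1, h.1, h.2.2⟩, fun h => ⟨h.2.1, h.1, h.2.2⟩⟩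
  rw [this]

/-- The vertices `root t`, `t < cnt`, represent the components of the graph `E` without outgoing
edges, and `lab x = t + 1` if `x` lies in the component of `root t`. -/
structure SinkLabels (n : ℕ) (E : ℕ → ℕ → Prop) (lab root : ℕ → ℕ) (cnt : ℕ) : Prop where
  root_lt : ∀ t < cnt, root t < n
  lab_root : ∀ t < cnt, lab (root t) = t + 1
  lab_le : ∀ x < n, lab x ≤ cnt
  antichain : ∀ t < cnt, ∀ t' < cnt, ReachBelow n E (root t) (root t') → t = t'
  exists_root : ∀ x < n, ∃ t < cnt, ReachBelow n E x (root t)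
  reach : ∀ x < n, ∀ t, lab x = t + 1 → ReachBelow n E (root t) x
  lab_ne_zero : ∀ t < cnt, ∀ x, ReachBelow n E (root t) x → lab x ≠ 0

/-- Three searches find the components without outgoing edges. The first one, in the reversed
graph, yields roots that reach everything, none of which reaches a later one. Searching again from
these roots in reversed order removes those that are reached from another root, so that an
antichain remains. The third search, in the graph itself, labels the components of this
antichain. -/
theorem sinkLabels_of_searchResults {n : ℕ} {E : ℕ → ℕ → Prop} {cand₁ cand₂ cand₃ lab₁ lab₂ lab₃
    root₁ root₂ root₃ : ℕ → ℕ} {cnt₁ cnt₂ cnt₃ : ℕ}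
    (h₁ : SearchResult n (fun x y => E y x) n cand₁ lab₁ root₁ cnt₁)
    (hc₁ : ∀ i < n, cand₁ i = i)
    (h₂ : SearchResult n (fun x y => E y x) cnt₁ cand₂ lab₂ root₂ cnt₂)
    (hc₂ : ∀ i < cnt₁, cand₂ i = root₁ (cnt₁ - 1 - i))
    (h₃ : SearchResult n E cnt₂ cand₃ lab₃ root₃ cnt₃) (hc₃ : ∀ i < cnt₂, cand₃ i = root₂ i) :
    SinkLabels n E lab₃ root₃ cnt₃ := by
  obtain ⟨a₂, ha₂, hmono₂⟩ := h₂.root_spec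
  obtain ⟨a₃, ha₃, hmono₃⟩ := h₃.root_spec
  obtain ⟨a₁, ha₁, -⟩ := h₁.root_spec
  have hanti₂ : ∀ t < cnt₂, ∀ t' < cnt₂, ReachBelow n E (root₂ t) (root₂ t') → t = t' := by
    intro t ht t' ht' hr
    rw [← reachBelow_swap] at hr
    rcases lt_trichotomy t t' with hlt | hlt | hlt
    · exfalso
      have hlt2 := hmono₂ t' ht' t hlt
      obtain ⟨h3, h4, -⟩ := ha₂ t ht
      obtain ⟨h5, h6, -⟩ := ha₂ t' ht'
      rw [← h4, ← h6, hc₂ _ h3, hc₂ _ h5] at hr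
      exact h₁.not_reach (by omega) (by omega) hr
    · exact hlt
    · exact absurd hr (h₂.not_reach hlt ht)
  have hdom₂ : ∀ x < n, ∃ t < cnt₂, ReachBelow n E x (root₂ t) := by
    intro x hx
    obtain ⟨t₁, ht₁, hr₁⟩ := h₁.exists_root hx (by rw [hc₁ x hx]; exact hx)
    rw [hc₁ x hx, reachBelow_swap] at hr₁
    have hi : cnt₁ - 1 - t₁ < cnt₁ := by omega
    have hci : cand₂ (cnt₁ - 1 - t₁) = root₁ t₁ := by
      rw [hc₂ _ hi]; congr 1; omega
    obtain ⟨t₂, ht₂, hr₂⟩ := h₂.exists_root hi (by rw [hci]; exact (ha₁ t₁ ht₁).2.2.1)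
    rw [hci, reachBelow_swap] at hr₂
    exact ⟨t₂, ht₂, hr₁.trans hr₂⟩
  -- every candidate of the third search becomes a root
  have hcand₃ : ∀ i < cnt₂, ∃ t < cnt₃, root₃ t = root₂ i := by
    intro i hi
    obtain ⟨t, ht, hr⟩ := h₃.exists_root hi (by rw [hc₃ i hi]; exact (ha₂ i hi).2.2.1)
    refine ⟨t, ht, ?_⟩
    obtain ⟨h3, h4, -⟩ := ha₃ t ht
    rw [← h4, hc₃ _ h3, hc₃ i hi] at hr
    rw [← h4, hc₃ _ h3, hanti₂ _ h3 i hi hr]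
  refine ⟨fun t ht => (ha₃ t ht).2.2.1, fun t ht => (ha₃ t ht).2.2.2, h₃.lab_le, ?_, ?_, h₃.reach,
    fun t ht x hr => ?_⟩
  · intro t ht t' ht' hr
    obtain ⟨h3, h4, -⟩ := ha₃ t ht
    obtain ⟨h5, h6, -⟩ := ha₃ t' ht'
    rw [← h4, ← h6, hc₃ _ h3, hc₃ _ h5] at hr
    have heq := hanti₂ _ h3 _ h5 hr
    rcases lt_trichotomy t t' with hlt | hlt | hlt
    · have := hmono₃ t' ht' t hlt; omega
    · exact hlt
    · have := hmono₃ t ht t' hlt; omega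
  · intro x hx
    obtain ⟨i, hi, hr⟩ := hdom₂ x hx
    obtain ⟨t, ht, he⟩ := hcand₃ i hi
    exact ⟨t, ht, he ▸ hr⟩
  · obtain ⟨-, -, h3, h4⟩ := ha₃ t ht
    exact (h₃.lab_mono _ h3 (by omega) x hr).2.1

theorem reachBelow_iff_reaches {n : ℕ} {A : Matrix (Fin n) (Fin n) ℕ} {E : ℕ → ℕ → Prop}
    (hE : ∀ x y : Fin n, E x y ↔ Edge A x y) (x y : Fin n) :
    ReachBelow n E x y ↔ Reaches A x y := by
  constructor
  · intro h
    have : ∀ b, ReachBelow n E x b → ∃ hb : b < n, Reaches A x ⟨b, hb⟩ := fun b hb => by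
      induction hb with
      | refl => exact ⟨x.2, Relation.ReflTransGen.refl⟩
      | tail _ hbc ih =>
        obtain ⟨hb, hr⟩ := ih
        exact ⟨hbc.2.1, hr.tail ((hE ⟨_, hb⟩ ⟨_, hbc.2.1⟩).mp hbc.2.2)⟩
    exact (this y h).2
  · intro h
    induction h with
    | refl => exact Relation.ReflTransGen.refl
    | tail _ hbc ih => exact ih.tail ⟨Fin.is_lt _, Fin.is_lt _, (hE _ _).mpr hbc⟩

/-- The label classes are the parent components. -/
theorem SinkLabels.enumeration {n : ℕ} {A : Matrix (Fin n) (Fin n) ℕ} {E : ℕ → ℕ → Prop}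
    (hE : ∀ x y : Fin n, E x y ↔ Edge A x y) {lab root : ℕ → ℕ} {cnt : ℕ}
    (h : SinkLabels n E lab root cnt) :
    Function.Injective (fun t : Fin cnt => {x : Fin n | lab x = t + 1}) ∧
      Set.range (fun t : Fin cnt => {x : Fin n | lab x = t + 1}) =
        {T : Set (Fin n) | IsParentSCC A T} := by
  let r : Fin cnt → Fin n := fun t => ⟨root t, h.root_lt t t.2⟩
  have hback : ∀ (t : Fin cnt) (z : Fin n), Reaches A (r t) z → Reaches A z (r t) := by
    intro t z hz
    obtain ⟨t', ht', hr⟩ := h.exists_root z z.2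
    have hr' : Reaches A z (r ⟨t', ht'⟩) := (reachBelow_iff_reaches hE z (r ⟨t', ht'⟩)).mp hr
    have : (t : ℕ) = t' := h.antichain t t.2 t' ht'
      ((reachBelow_iff_reaches hE (r t) (r ⟨t', ht'⟩)).mpr (hz.trans hr'))
    have he : t = ⟨t', ht'⟩ := Fin.ext this
    rw [he]; exact hr'
  have hclass : ∀ t : Fin cnt, {x : Fin n | lab x = t + 1} =
      {y | Reaches A (r t) y ∧ Reaches A y (r t)} := by
    intro t
    ext x
    constructor
    · intro hx
      have : Reaches A (r t) x := (reachBelow_iff_reaches hE (r t) x).mp (h.reach x x.2 t hx)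
      exact ⟨this, hback t x this⟩
    · rintro ⟨h1, h2⟩
      have h3 := h.lab_ne_zero t t.2 x ((reachBelow_iff_reaches hE (r t) x).mpr h1)
      obtain ⟨t', ht'⟩ := Nat.exists_eq_succ_of_ne_zero h3
      have hlt : t' < cnt := by have := h.lab_le x x.2; omega
      have h4 := h.reach x x.2 t' ht'
      have := h.antichain t' hlt t t.2
        (h4.trans ((reachBelow_iff_reaches hE x (r t)).mpr h2))
      show lab x = t + 1
      rw [ht', this]
  have hroot : ∀ t : Fin cnt, r t ∈ {x : Fin n | lab x = t + 1} := fun t => h.lab_root t t.2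
  refine ⟨fun t t' htt => ?_, ?_⟩
  · have h1 := hroot t
    have h2 : r t ∈ {x : Fin n | lab x = t' + 1} := by
      have htt' : {x : Fin n | lab x = t + 1} = {x : Fin n | lab x = t' + 1} := htt
      rw [← htt']; exact h1
    have h3 : lab (r t) = t + 1 := h1
    have h4 : lab (r t) = t' + 1 := h2
    exact Fin.ext (by omega)
  · ext T
    constructor
    · rintro ⟨t, rfl⟩
      show IsParentSCC A {x : Fin n | lab x = t + 1}
      rw [hclass]
      exact isParentSCC_of_forall_reaches (hback t)
    · intro hT
      obtain ⟨x, hx⟩ := IsParentSCC.nonempty hT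
      obtain ⟨t, ht, hr⟩ := h.exists_root x x.2
      have hr' : Reaches A x (r ⟨t, ht⟩) := (reachBelow_iff_reaches hE x (r ⟨t, ht⟩)).mp hr
      have hmem := (hT.reaches_iff hx).mp hr'
      exact ⟨⟨t, ht⟩, by rw [hT.1.eq_of_mem hmem]; exact hclass ⟨t, ht⟩⟩

/-! ### Solving the sensing cost problem -/

/-- Fill the adjacency matrix of the search with the values of `e`. -/
def copyAdj (e : IntExpr) : Prog :=
  .forUpTo vX vN (.forUpTo vY vN (.setInt vAdj (.var vX) (.var vY) e))

/-- The candidates of the first search are all vertices. -/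
def candidatesAll : Prog :=
  .forUpTo vY vN (.assignEntry vCand (.var vY) (.var vY)) ;; .assign vK (.var vN)

/-- The candidates of the second search are the roots of the first one, in reversed order. -/
def candidatesReversed : Prog :=
  (.assign vK (.var vCnt) ;; .assign vX (.var vCnt)) ;;
  .forUpTo vY vK
    (.assign vX (.pred (.var vX)) ;; .assignEntry vCand (.var vY) (.entry vRoot (.var vX)))

/-- The candidates of the third search are the roots of the second one. -/
def candidatesRoots : Prog :=
  .assign vK (.var vCnt) ;;
  .forUpTo vY vK (.assignEntry vCand (.var vY) (.entry vRoot (.var vY)))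

/-- Find the parent components: two searches in the reversed graph and one in the graph itself. -/
def componentsProg : Prog :=
  copyAdj (.read 1 (.var vX) (.var vY)) ;; candidatesAll ;; searchProg ;;
  candidatesReversed ;; searchProg ;;
  candidatesRoots ;; copyAdj (.read 1 (.var vY) (.var vX)) ;; searchProg

theorem copyAdj_spec {s : Memory} {n : ℕ} (hn : s.var vN = n) {e : IntExpr} {b : ℕ → ℕ → ℕ}
    (he : ∀ t : Memory, t.int 1 = s.int 1 → e.eval t = b (t.var vX) (t.var vY)) :
    RunsWithin (copyAdj e) s (7 * (n + 1) ^ 2) fun t =>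
      ∀ x < n, ∀ y < n, t.int vAdj x y = b x y := by
  refine (RunsWithin.forUpTo (N := n)
    (fun x t => ∀ k < x, ∀ y < n, t.int vAdj k y = b k y) (n * (1 + 2) + 2) hn
    (by simp [Prog.intMod]) (by simp [Prog.intMod]) (by simp) fun x hx t hfr htx hI => ?_).mono
    (by nlinarith) fun t ht => ht.1
  refine (RunsWithin.forUpTo (N := n)
    (fun y t => (∀ k < x, ∀ y < n, t.int vAdj k y = b k y) ∧
      ∀ l < y, t.int vAdj x l = b x l) 1
    (by rw [hfr.var vN (by simp [Prog.intMod]), hn])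
    (by simp [Prog.intMod]) (by simp [Prog.intMod]) ⟨by simpa using hI, by simp⟩
    fun y hy w hfr' hwy hw => RunsWithin.of_run rfl le_rfl ?_).mono le_rfl fun w hw k hk l hl => ?_
  · have hwx : w.var vX = x := by rw [hfr'.var vX (by simp [Prog.intMod]), htx]
    have hwe : e.eval w = b x y := by
      rw [he w, hwx, hwy]
      rw [hfr'.int 1 (by simp [Prog.intMod]), hfr.int 1 (by simp [Prog.intMod])]
    refine ⟨fun k hk l hl => ?_, fun l hl => ?_⟩
    · have : ¬ k = x := by omega
      simpa [Prog.run, hwx, hwy, this] using hw.1 k hk l hl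
    · by_cases hly : l = y
      · simp [Prog.run, hwx, hwy, hly, hwe]
      · simpa [Prog.run, hwx, hwy, hly] using hw.2 l (by omega)
  · rcases Nat.lt_succ_iff_lt_or_eq.mp hk with hk | rfl
    · simpa using hw.1.1 k hk l hl
    · simpa using hw.1.2 l hl

theorem candidatesAll_spec {s : Memory} {n : ℕ} (hn : s.var vN = n) :
    RunsWithin candidatesAll s (3 * n + 3) fun t => t.var vK = n ∧ ∀ i < n, t.vec vCand i = i := by
  refine ((RunsWithin.forUpTo (N := n) (fun y t => ∀ i < y, t.vec vCand i = i) 1 hn (by decide)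
    (by decide) (by simp) fun y hy t hfr hty hI => RunsWithin.of_run rfl le_rfl
      fun i hi => ?_).seq (l := 1) fun t ht => RunsWithin.of_run rfl le_rfl ?_).mono (by omega)
      fun t ht => ht
  · by_cases hiy : i = y
    · simp [Prog.run, hty, hiy]
    · simpa [Prog.run, hty, hiy] using hI i (by omega)
  · have : t.var vN = n := by rw [ht.2.var vN (by decide), hn]
    exact ⟨by simp [Prog.run, this], by simpa [Prog.run] using ht.1⟩

theorem candidatesReversed_spec {s : Memory} {k : ℕ} (hk : s.var vCnt = k) :
    RunsWithin candidatesReversed s (4 * k + 4) fun t => t.var vK = k ∧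
      ∀ i < k, t.vec vCand i = s.vec vRoot (k - 1 - i) := by
  have h0 : RunsWithin (.assign vK (.var vCnt) ;; .assign vX (.var vCnt)) s 2
      fun t => t = (s.writeInt vK 0 0 k).writeInt vX 0 0 k :=
    RunsWithin.of_run rfl (by decide) (by simp [Prog.run, hk])
  refine (h0.seq (l := k * (2 + 2) + 2) fun t ht => ?_).mono (by omega) fun t ht => ht
  subst ht
  refine (RunsWithin.forUpTo (N := k) (fun y t => t.var vX = k - y ∧
    ∀ i < y, t.vec vCand i = s.vec vRoot (k - 1 - i)) 2 (by simp) (by decide)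
    (by decide) (by simp) fun y hy t hfr hty hI => RunsWithin.of_run rfl (by decide)
      ⟨?_, fun i hi => ?_⟩).mono le_rfl
      fun t ht => ⟨by rw [ht.2.var vK (by decide)]; simp, ht.1.2⟩
  · simp [Prog.run, hI.1]; omega
  · have htr : t.vec vRoot = s.vec vRoot := by rw [hfr.vec vRoot (by decide)]; simp
    by_cases hiy : i = y
    · have : k - y - 1 = k - 1 - y := by omega
      simp [Prog.run, hty, hiy, hI.1, htr, this]
    · simpa [Prog.run, hty, hiy] using hI.2 i (by omega)

theorem candidatesRoots_spec {s : Memory} {k : ℕ} (hk : s.var vCnt = k) :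
    RunsWithin candidatesRoots s (3 * k + 3) fun t => t.var vK = k ∧
      ∀ i < k, t.vec vCand i = s.vec vRoot i := by
  have h0 : RunsWithin (.assign vK (.var vCnt)) s 1 fun t => t = s.writeInt vK 0 0 k :=
    RunsWithin.of_run rfl (by decide) (by simp [Prog.run, hk])
  refine (h0.seq (l := k * (1 + 2) + 2) fun t ht => ?_).mono (by omega) fun t ht => ht
  subst ht
  refine (RunsWithin.forUpTo (N := k) (fun y t =>
    ∀ i < y, t.vec vCand i = s.vec vRoot i) 1 (by simp) (by decide)
    (by decide) (by simp) fun y hy t hfr hty hI => RunsWithin.of_run rfl (by decide)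
      fun i hi => ?_).mono le_rfl
      fun t ht => ⟨by rw [ht.2.var vK (by decide)]; simp, ht.1⟩
  have htr : t.vec vRoot = s.vec vRoot := by rw [hfr.vec vRoot (by decide)]; simp
  by_cases hiy : i = y
  · simp [Prog.run, hty, hiy, htr]
  · simpa [Prog.run, hty, hiy] using hI i (by omega)

theorem componentsProg_spec {s : Memory} {n : ℕ} (hn : s.var vN = n) :
    RunsWithin componentsProg s (120 * (n + 1) ^ 2) fun t =>
      SinkLabels n (fun x y => s.int 1 y x ≠ 0) (t.vec vLab) (t.vec vRoot) (t.var vCnt) := by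
  set a := s.int 1 with ha
  have hsearch : ∀ K ≤ n, (n + K + 1) * (7 * n + 20) ≤ 24 * (n + 1) ^ 2 := fun K hK => by
    calc (n + K + 1) * (7 * n + 20) ≤ (n + n + 1) * (7 * n + 20) := by gcongr
      _ ≤ _ := by nlinarith
  have hlin : n + 1 ≤ (n + 1) ^ 2 := Nat.le_self_pow (by omega) _
  refine ((copyAdj_spec (b := fun x y => a x y) hn (fun t ht => by simp [ht, ha])).frame.seq
    (l := (3 * n + 3) + (24 * (n + 1) ^ 2 + ((4 * n + 4) + (24 * (n + 1) ^ 2 + ((3 * n + 3) +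
      (7 * (n + 1) ^ 2 + 24 * (n + 1) ^ 2)))))) fun t₁ ht₁ => ?_).mono (by omega) fun t ht => ht
  obtain ⟨hadj₁, hf₁⟩ := ht₁
  have hn₁ : t₁.var vN = n := by rw [hf₁.var vN (by decide), hn]
  refine (candidatesAll_spec hn₁).frame.seq fun t₂ ht₂ => ?_
  obtain ⟨⟨hK₂, hc₂⟩, hf₂⟩ := ht₂
  have hn₂ : t₂.var vN = n := by rw [hf₂.var vN (by decide), hn₁]
  have hadj₂ : ∀ x < n, ∀ y < n, t₂.int vAdj x y = a x y := by
    rw [hf₂.int vAdj (by decide)]; exact hadj₁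
  refine ((searchProg_spec (E := fun x y => a x y ≠ 0) hn₂ hK₂
    (fun x hx y hy => by rw [hadj₂ x hx y hy]) fun i hi => by rw [hc₂ i hi]; exact hi).frame.mono
    (hsearch n le_rfl) fun t ht => ht).seq fun t₃ ht₃ => ?_
  obtain ⟨hres₃, hf₃⟩ := ht₃
  have hk₁ := hres₃.cnt_le
  have hroot₃ : ∀ t < t₃.var vCnt, t₃.vec vRoot t < n := by
    obtain ⟨_, h, -⟩ := hres₃.root_spec
    exact fun t ht => (h t ht).2.2.1
  refine ((candidatesReversed_spec (s := t₃) rfl).frame.mono (by omega) fun t ht => ht).seq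
    fun t₄ ht₄ => ?_
  obtain ⟨⟨hK₄, hc₄⟩, hf₄⟩ := ht₄
  have hn₄ : t₄.var vN = n := by
    rw [hf₄.var vN (by decide), hf₃.var vN (by decide), hn₂]
  have hadj₄ : ∀ x < n, ∀ y < n, t₄.int vAdj x y = a x y := by
    rw [hf₄.int vAdj (by decide), hf₃.int vAdj (by decide)]; exact hadj₂
  refine ((searchProg_spec (E := fun x y => a x y ≠ 0) hn₄ hK₄
    (fun x hx y hy => by rw [hadj₄ x hx y hy]) fun i hi => by
      rw [hc₄ i hi]; exact hroot₃ _ (by omega)).frame.mono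
    (hsearch _ hk₁) fun t ht => ht).seq fun t₅ ht₅ => ?_
  obtain ⟨hres₅, hf₅⟩ := ht₅
  have hk₂ := hres₅.cnt_le.trans hk₁
  have hroot₅ : ∀ t < t₅.var vCnt, t₅.vec vRoot t < n := by
    obtain ⟨_, h, -⟩ := hres₅.root_spec
    exact fun t ht => (h t ht).2.2.1
  refine ((candidatesRoots_spec (s := t₅) rfl).frame.mono (by omega) fun t ht => ht).seq
    fun t₆ ht₆ => ?_
  obtain ⟨⟨hK₆, hc₆⟩, hf₆⟩ := ht₆
  have hn₆ : t₆.var vN = n := by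
    rw [hf₆.var vN (by decide), hf₅.var vN (by decide), hn₄]
  have ha₆ : t₆.int 1 = a := by
    rw [hf₆.int 1 (by decide), hf₅.int 1 (by decide), hf₄.int 1 (by decide),
      hf₃.int 1 (by decide), hf₂.int 1 (by decide), hf₁.int 1 (by decide)]
  refine (copyAdj_spec (b := fun x y => a y x) hn₆ (fun t ht => by simp [ht, ha₆])).frame.seq
    fun t₇ ht₇ => ?_
  obtain ⟨hadj₇, hf₇⟩ := ht₇
  rw [← hf₇.vec vCand (by decide)] at hc₆
  refine (searchProg_spec (E := fun x y => a y x ≠ 0) (K := t₅.var vCnt)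
    (by rw [hf₇.var vN (by decide), hn₆]) (by rw [hf₇.var vK (by decide), hK₆])
    (fun x hx y hy => by rw [hadj₇ x hx y hy]) fun i hi => by
      rw [hc₆ i hi]; exact hroot₅ i hi).mono (hsearch _ hk₂) fun t ht => ?_
  exact sinkLabels_of_searchResults (E := fun x y => a y x ≠ 0) hres₃ hc₂ hres₅ hc₄ ht hc₆

/-! ### Cheapest states -/

/-! The entry `(i, j)` of the integer array `vSel` is the state that sensor `i` measures if it is
assigned to component `j`. -/

notation "vSel" => (52 : ℕ)

/-- Compute row `vR` of the cost matrix of the assignment problem, and the cheapest states. -/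
def cheapestRow : Prog :=
  .forUpTo vJ vM
    (.setReal rD (.var vR) (.var vJ) (.read 0 (.var vR) (.entry vRoot (.var vJ))) ;;
      .setInt vSel (.var vR) (.var vJ) (.entry vRoot (.var vJ))) ;;
  .forUpTo vX vN
    (.ite (.isZero (.entry vLab (.var vX))) .skip
      (.ite (.realLt (.read 0 (.var vR) (.var vX))
          (.read rD (.var vR) (.pred (.entry vLab (.var vX)))))
        (.setReal rD (.var vR) (.pred (.entry vLab (.var vX))) (.read 0 (.var vR) (.var vX)) ;;
          .setInt vSel (.var vR) (.pred (.entry vLab (.var vX))) (.var vX))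
        .skip))

/-- Compute the cost matrix of the assignment problem and the matrix `vSel` of cheapest states. -/
def cheapestProg : Prog := .forUpTo vR vM cheapestRow

/-- `l` is a vertex with label `j + 1` and cost `d = c l`, not larger than the cost of any vertex
below `b` with this label. -/
def IsCheapest (n : ℕ) (lab : ℕ → ℕ) (c : ℕ → ℝ) (b j : ℕ) (d : ℝ) (l : ℕ) : Prop :=
  l < n ∧ lab l = j + 1 ∧ d = c l ∧ ∀ y < b, lab y = j + 1 → d ≤ c y

theorem cheapestRow_spec {s : Memory} {m n i : ℕ} (hm : s.var vM = m) (hn : s.var vN = n)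
    (hi : s.var vR = i) (hroot : ∀ j < m, s.vec vRoot j < n ∧ s.vec vLab (s.vec vRoot j) = j + 1) :
    RunsWithin cheapestRow s (4 * m + 6 * n + 4) fun t =>
      (∀ k, k ≠ i → t.real rD k = s.real rD k ∧ t.int vSel k = s.int vSel k) ∧
      ∀ j < m, IsCheapest n (s.vec vLab) (s.real 0 i) n j (t.real rD i j) (t.int vSel i j) := by
  refine ((RunsWithin.forUpTo (N := m) (fun j t =>
    (∀ k, k ≠ i → t.real rD k = s.real rD k ∧ t.int vSel k = s.int vSel k) ∧
    ∀ j' < j, IsCheapest n (s.vec vLab) (s.real 0 i) 0 j' (t.real rD i j') (t.int vSel i j')) 2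
    hm (by decide) (by decide) (by simp) fun j hj t hfr htj hI =>
      RunsWithin.of_run rfl (by decide) ?_).seq (l := n * (4 + 2) + 2) fun t ht => ?_).mono
      (by omega) fun t ht => ht
  · have hti : t.var vR = i := by rw [hfr.var vR (by decide), hi]
    have htr : t.vec vRoot = s.vec vRoot := hfr.vec _ (by decide)
    have ht0 : t.real 0 = s.real 0 := hfr.real _ (by decide)
    refine ⟨fun k hk => ?_, fun j' hj' => ?_⟩
    · simpa [Prog.run, hti, htj, htr, ht0, hk] using hI.1 k hk
    · by_cases hjj : j' = j
      · subst hjj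
        have := hroot j' hj
        simp [Prog.run, hti, htj, htr, ht0, IsCheapest, this]
      · simpa [Prog.run, hti, htj, hjj] using hI.2 j' (by omega)
  · obtain ⟨hI, hfr⟩ := ht
    refine (RunsWithin.forUpTo (N := n) (fun x t =>
      (∀ k, k ≠ i → t.real rD k = s.real rD k ∧ t.int vSel k = s.int vSel k) ∧
      ∀ j < m, IsCheapest n (s.vec vLab) (s.real 0 i) x j (t.real rD i j) (t.int vSel i j)) 4
      (by rw [hfr.var vN (by decide), hn]) (by decide) (by decide) (by simpa using hI)
      fun x hx w hfr' hwx hw => RunsWithin.of_run rfl (by decide) ?_).mono le_rfl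
      fun w hw => hw.1
    have hwi : w.var vR = i := by rw [hfr'.var vR (by decide), hfr.var vR (by decide), hi]
    have hwl : w.vec vLab = s.vec vLab := by
      rw [hfr'.vec vLab (by decide), hfr.vec vLab (by decide)]
    have hw0 : w.real 0 = s.real 0 := by
      rw [hfr'.real 0 (by decide), hfr.real 0 (by decide)]
    -- a column whose entry is not touched stays cheapest if the new vertex is not cheaper
    have keep : ∀ j < m, (s.vec vLab x = j + 1 → w.real rD i j ≤ s.real 0 i x) →
        IsCheapest n (s.vec vLab) (s.real 0 i) (x + 1) j (w.real rD i j) (w.int vSel i j) := by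
      intro j hj hle
      obtain ⟨h1, h2, h3, h4⟩ := hw.2 j hj
      refine ⟨h1, h2, h3, fun y hy hly => ?_⟩
      rcases Nat.lt_succ_iff_lt_or_eq.mp hy with hy | rfl
      · exact h4 y hy hly
      · exact hle hly
    by_cases hl : s.vec vLab x = 0
    · simp only [Prog.run, Test.Holds, IntExpr.eval_entry, IntExpr.eval_var, IntExpr.eval_const,
        hwx, hwl, hl, le_refl, if_true]
      refine ⟨by simpa using hw.1, fun j hj => ?_⟩
      simpa using keep j hj fun h => by omega
    · have hl' : ¬ s.vec vLab x ≤ 0 := by omega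
      by_cases hlt : s.real 0 i x < w.real rD i (s.vec vLab x - 1)
      · simp only [Prog.run, Test.Holds, IntExpr.eval_entry, IntExpr.eval_var,
          IntExpr.eval_const, IntExpr.eval_pred, RealExpr.eval_read, hwx, hwl, hwi, hw0, hl',
          if_false, not_le.mpr hlt, not_false_eq_true, if_true, Memory.writeReal_var,
          Memory.writeReal_vec]
        refine ⟨fun k hk => by simpa [hk] using hw.1 k hk, fun j hj => ?_⟩
        by_cases hjl : j = s.vec vLab x - 1
        · have hlj : s.vec vLab x = j + 1 := by omega
          obtain ⟨-, -, -, h4⟩ := hw.2 j hj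
          rw [← hjl] at hlt ⊢
          simp only [Memory.writeInt_real, Memory.writeReal_real_self, and_self, if_true,
            Memory.writeInt_int_ne _ _ _ _ (show vSel ≠ vX by decide), Memory.writeInt_int]
          refine ⟨hx, hlj, rfl, fun y hy hly => ?_⟩
          rcases Nat.lt_succ_iff_lt_or_eq.mp hy with hy | rfl
          · exact hlt.le.trans (h4 y hy hly)
          · exact le_rfl
        · simpa [hjl] using keep j hj fun h => by omega
      · simp only [Prog.run, Test.Holds, IntExpr.eval_entry, IntExpr.eval_var,
          IntExpr.eval_const, IntExpr.eval_pred, RealExpr.eval_read, hwx, hwl, hwi, hw0, hl',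
          if_false, not_lt.mp hlt, not_true_eq_false]
        refine ⟨by simpa using hw.1, fun j hj => ?_⟩
        have hkeep := keep j hj fun h => by simpa [h] using not_lt.mp hlt
        simpa using hkeep

theorem cheapestProg_spec {s : Memory} {m n : ℕ} (hm : s.var vM = m) (hn : s.var vN = n)
    (hroot : ∀ j < m, s.vec vRoot j < n ∧ s.vec vLab (s.vec vRoot j) = j + 1) :
    RunsWithin cheapestProg s (m * (4 * m + 6 * n + 6) + 2) fun t =>
      ∀ i < m, ∀ j < m,
        IsCheapest n (s.vec vLab) (s.real 0 i) n j (t.real rD i j) (t.int vSel i j) := by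
  refine (RunsWithin.forUpTo (N := m) (fun i t => ∀ k < i, ∀ j < m,
    IsCheapest n (s.vec vLab) (s.real 0 k) n j (t.real rD k j) (t.int vSel k j))
    (4 * m + 6 * n + 4) hm (by decide) (by decide) (by simp) fun i hi t hfr hti hI => ?_).mono
    le_rfl fun t ht => ht.1
  have htl : t.vec vLab = s.vec vLab := hfr.vec _ (by decide)
  have htr : t.vec vRoot = s.vec vRoot := hfr.vec _ (by decide)
  have ht0 : t.real 0 = s.real 0 := hfr.real _ (by decide)
  refine (cheapestRow_spec (by rw [hfr.var vM (by decide), hm])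
    (by rw [hfr.var vN (by decide), hn]) hti (by rw [htl, htr]; exact hroot)).mono le_rfl
    fun w hw k hk j hj => ?_
  rw [htl, ht0] at hw
  rcases Nat.lt_succ_iff_lt_or_eq.mp hk with hk | rfl
  · have := hI k hk j hj
    rw [← (hw.1 k (by omega)).1, ← (hw.1 k (by omega)).2] at this
    simpa using this
  · simpa using hw.2 j hj

/-! ### The complete program -/

/-- Measure the cheapest state of the assigned component with every sensor. -/
def writeMeasurements : Prog :=
  .forUpTo vR vM
    (.setInt 2 (.var vR) (.read vSel (.var vR) (.entry vQ (.var vR))) (.const 1))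

/-- The program that solves the sensing cost problem. -/
def sensingProg : Prog :=
  (.assign vN (.var 0) ;; .assign vM (.read 0 (.const 0) (.const 1))) ;;
  componentsProg ;; cheapestProg ;; assignmentProg ;; writeMeasurements

theorem writeMeasurements_spec {s : Memory} {m : ℕ} (hm : s.var vM = m)
    (h0 : ∀ i j, s.int 2 i j = 0) :
    RunsWithin writeMeasurements s (3 * m + 2) fun t =>
      ∀ i < m, ∀ j, t.int 2 i j = if s.int vSel i (s.vec vQ i) = j then 1 else 0 := by
  refine (RunsWithin.forUpTo (N := m)
    (fun i t => ∀ k j, t.int 2 k j = if k < i ∧ s.int vSel k (s.vec vQ k) = j then 1 else 0) 1 hm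
    (by decide) (by decide) (by simp [h0])
    fun i hi t hfr hti hI => RunsWithin.of_run rfl le_rfl fun k j => ?_).mono (by omega)
    fun t ht i hi j => by simpa [hi] using ht.1 i j
  have htq : t.vec vQ = s.vec vQ := hfr.vec vQ (by decide)
  have hts : t.int vSel = s.int vSel := hfr.int vSel (by decide)
  by_cases hki : k = i
  · subst hki
    have hn : t.int 2 k j = 0 := by simpa using hI k j
    by_cases hj : j = s.int vSel k (s.vec vQ k)
    · simp [Prog.run, hti, htq, hts, hj]
    · simp [Prog.run, hti, htq, hts, hj, hn, Ne.symm hj]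
  · have : k < i + 1 ↔ k < i := by omega
    simp [Prog.run, hti, hki, this, hI k j]

theorem card_le_of_enumeration {n m : ℕ} {A : Matrix (Fin n) (Fin n) ℕ} {S : Fin m → Set (Fin n)}
    (hinj : Function.Injective S) (hS : Set.range S = {T : Set (Fin n) | IsParentSCC A T}) :
    m ≤ n := by
  choose r hr using fun j => IsParentSCC.nonempty (A := A) (hS.subset (Set.mem_range_self j))
  have := Fintype.card_le_of_injective r fun j k h =>
    eq_of_mem_enumeration hinj hS (hr j) (by rw [h]; exact hr k)
  simpa using this

theorem sensingProg_spec {n m : ℕ} {A : Matrix (Fin n) (Fin n) ℕ} (c : Matrix (Fin m) (Fin n) ℝ)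
    (hA : StructurallyFullRank A) (hmin : IsMinSensorNumber A m) :
    RunsWithin sensingProg (sensingInput A c)
      (120 * (n + 1) ^ 2 + m * (4 * m + 6 * n + 6) + 40 * (m + 1) ^ 3 + 3 * m + 6) fun t =>
      t.output 2 m n ∈ argminSet (sensingFeasible A m) (totalCost c) := by
  have hcard := ncard_parentSCC hA hmin
  set s := sensingInput A c with hs
  have hn : s.var 0 = n := by simp [hs, Memory.var, sensingInput]
  have hm : s.int 0 0 1 = m := by simp [hs, sensingInput]
  have ha : ∀ x y : Fin n, s.int 1 x y = A x y := fun x y => by simp [hs, sensingInput]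
  have hc : ∀ (i : Fin m) (x : Fin n), s.real 0 i x = c i x := fun i x => by
    simp [hs, sensingInput]
  have h2 : ∀ i j, s.int 2 i j = 0 := fun i j => by simp [hs, sensingInput]
  have hinit : RunsWithin (.assign vN (.var 0) ;; .assign vM (.read 0 (.const 0) (.const 1))) s 2
      fun t => t.var vN = n ∧ t.var vM = m :=
    RunsWithin.of_run rfl (by decide) ⟨by simp [Prog.run, hn], by simp [Prog.run, hm]⟩
  refine (hinit.frame.seq (l := 120 * (n + 1) ^ 2 + ((m * (4 * m + 6 * n + 6) + 2) +
    (40 * (m + 1) ^ 3 + (3 * m + 2)))) fun t₁ ht₁ => ?_).mono (by omega) fun t ht => ht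
  obtain ⟨⟨hn₁, hm₁⟩, hf₁⟩ := ht₁
  refine (componentsProg_spec hn₁).frame.seq fun t₂ ht₂ => ?_
  obtain ⟨hlab, hf₂⟩ := ht₂
  have hE : ∀ x y : Fin n, (t₁.int 1 y x ≠ 0) ↔ Edge A x y := fun x y => by
    rw [hf₁.int 1 (by decide), ha, Edge]
  obtain ⟨hinj, hrange⟩ := hlab.enumeration hE
  have hcnt : t₂.var vCnt = m := by
    have h3 := Set.ncard_range_of_injective hinj
    rw [hrange, hcard, Nat.card_fin] at h3
    exact h3.symm
  rw [hcnt] at hlab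
  obtain ⟨hinj, hrange⟩ := hlab.enumeration hE
  set S : Fin m → Set (Fin n) := fun t => {x : Fin n | t₂.vec vLab x = t + 1} with hSdef
  refine (cheapestProg_spec (m := m) (n := n) (by rw [hf₂.var vM (by decide), hm₁])
    (by rw [hf₂.var vN (by decide), hn₁])
    fun j hj => ⟨hlab.root_lt j hj, hlab.lab_root j hj⟩).frame.seq fun t₃ ht₃ => ?_
  obtain ⟨hch, hf₃⟩ := ht₃
  have hc₂ : t₂.real 0 = s.real 0 := by rw [hf₂.real 0 (by decide), hf₁.real 0 (by decide)]
  rw [hc₂] at hch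
  have hm₃ : t₃.var vM = m := by
    rw [hf₃.var vM (by decide), hf₂.var vM (by decide), hm₁]
  -- the computed matrix is the cost matrix of the assignment problem
  let sel : Fin m → Fin m → Fin n := fun i j => ⟨t₃.int vSel i j, (hch i i.2 j j.2).1⟩
  have hsel : ∀ i j : Fin m, sel i j ∈ S j ∧ c i (sel i j) = sccCost c S i j ∧
      t₃.real rD i j = sccCost c S i j := fun i j => by
    obtain ⟨h3, h4, h5, h6⟩ := hch i i.2 j j.2
    have hmem : sel i j ∈ S j := h4
    have hval : t₃.real rD i j = c i (sel i j) := by rw [h5, ← hc]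
    have hleast : IsLeast (c i '' S j) (c i (sel i j)) := by
      refine ⟨⟨_, hmem, rfl⟩, ?_⟩
      rintro _ ⟨x, hx, rfl⟩
      rw [← hval, ← hc]
      exact h6 x x.2 hx
    have := hleast.unique (isLeast_sccCost hrange c i j)
    exact ⟨hmem, this, by rw [hval, this]⟩
  refine (assignmentProg_spec (D := t₃.real rD) hm₃ rfl).frame.seq fun t₄ ht₄ => ?_
  obtain ⟨⟨π, hπ, hopt⟩, hf₄⟩ := ht₄
  have hZ : selectionMatrix π ∈ argminSet (lsapFeasible m) (totalCost (sccCost c S)) := by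
    refine selectionMatrix_mem_argminSet fun τ => ?_
    have : ∀ i j : Fin m, t₃.real rD i j = sccCost c S i j := fun i j => (hsel i j).2.2
    simpa only [this] using hopt τ
  refine (writeMeasurements_spec (m := m) (by rw [hf₄.var vM (by decide), hm₃])
    fun i j => ?_).mono le_rfl fun t₅ ht₅ => ?_
  · rw [hf₄.int 2 (by decide), hf₃.int 2 (by decide), hf₂.int 2 (by decide),
      hf₁.int 2 (by decide), h2]
  · have hout : t₅.output 2 m n = measureSelected sel (selectionMatrix π) := by
      rw [measureSelected_selectionMatrix]
      funext i l
      have := ht₅ i i.2 l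
      rw [← hπ i, hf₄.int vSel (by decide)] at this
      simp only [Memory.output, this, selectionMatrix, Fin.ext_iff, sel]
    rw [hout]
    have hsel' : ∀ i j, sel i j ∈ S j ∧ c i (sel i j) = sccCost c S i j :=
      fun i j => ⟨(hsel i j).1, (hsel i j).2.1⟩
    exact ((argminSet_correspondence
      (fun H hH => inducedAssignment_mem_and_le hA hinj hrange c hH)
      fun Z hZ => measureSelected_mem_and_eq hA hinj hrange c hsel' hZ).1 _ hZ.1).mpr hZ

/-- `O(n ^ 2 + m ^ 3)`, with explicit constants. -/
theorem sensing_bound_le {n m : ℕ} (hmn : m ≤ n) :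
    120 * (n + 1) ^ 2 + m * (4 * m + 6 * n + 6) + 40 * (m + 1) ^ 3 + 3 * m + 6 ≤
      1000 * (n ^ 2 + m ^ 3 + 1) := by
  have h1 : m * (4 * m + 6 * n + 6) ≤ n * (4 * n + 6 * n + 6) := by gcongr
  have h2 : m ≤ m ^ 3 := Nat.le_self_pow (by omega) _
  have h3 : m ^ 2 ≤ m ^ 3 := by
    rcases Nat.eq_zero_or_pos m with rfl | hm
    · simp
    · exact Nat.pow_le_pow_right hm (by omega)
  have h4 : n ≤ n ^ 2 := Nat.le_self_pow (by omega) _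
  nlinarith

end SensingLSAP

theorem mainTheorem1 :
    -- the sensing cost problem is equivalent to the assignment problem with cost matrix `C`
    (∀ (n m : ℕ) (A : Matrix (Fin n) (Fin n) ℕ) (c : Matrix (Fin m) (Fin n) ℝ),
      IsZeroOne A → StructurallyFullRank A → IsMinSensorNumber A m →
      {S : Set (Fin n) | IsParentSCC A S}.ncard = m ∧
      measurementSet A m = sensingFeasible A m ∧
      (argminSet (sensingFeasible A m) (totalCost c)).Nonempty ∧
      ∀ S : Fin m → Set (Fin n), Function.Injective S →
        Set.range S = {T : Set (Fin n) | IsParentSCC A T} →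
        -- `C i j` is an attained minimum
        (∀ i j, IsLeast (c i '' S j) (sccCost c S i j)) ∧
        -- every feasible `H` induces an assignment that costs no more
        (∀ H ∈ sensingFeasible A m,
          inducedAssignment S H ∈ lsapFeasible m ∧
          totalCost (sccCost c S) (inducedAssignment S H) ≤ totalCost c H) ∧
        -- every assignment, realized by cheapest states, is a feasible `H` of the same cost
        (∀ ℓ : Fin m → Fin m → Fin n,
          (∀ i j, ℓ i j ∈ S j ∧ c i (ℓ i j) = sccCost c S i j) →
          ∀ Z ∈ lsapFeasible m,
            measureSelected ℓ Z ∈ sensingFeasible A m ∧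
            inducedAssignment S (measureSelected ℓ Z) = Z ∧
            totalCost c (measureSelected ℓ Z) = totalCost (sccCost c S) Z ∧
            (measureSelected ℓ Z ∈ argminSet (sensingFeasible A m) (totalCost c) ↔
              Z ∈ argminSet (lsapFeasible m) (totalCost (sccCost c S)))) ∧
        -- the optimal solutions correspond
        (∀ H, H ∈ argminSet (sensingFeasible A m) (totalCost c) ↔
          H ∈ sensingFeasible A m ∧
          inducedAssignment S H ∈ argminSet (lsapFeasible m) (totalCost (sccCost c S)) ∧
          totalCost c H = totalCost (sccCost c S) (inducedAssignment S H)) ∧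
        -- the optimal values agree
        (∀ v : ℝ, IsLeast (totalCost c '' sensingFeasible A m) v ↔
          IsLeast (totalCost (sccCost c S) '' lsapFeasible m) v)) ∧
    -- the assignment problem is solved exactly in `O(m ^ 3)` steps
    (∃ (p : Prog) (K : ℕ), ∀ (m : ℕ) (C : Matrix (Fin m) (Fin m) ℝ),
      ∃ (t : Memory) (k : ℕ), Exec p (lsapInput C) t k ∧ k ≤ K * (m ^ 3 + 1) ∧
        t.output 1 m m ∈ argminSet (lsapFeasible m) (totalCost C)) ∧
    -- the sensing cost problem is solved exactly in `O(n ^ 2 + m ^ 3)` steps, where `n ^ 2`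
    -- covers reading the data, finding the parent components and computing `C`
    (∃ (p : Prog) (K : ℕ), ∀ (n m : ℕ) (A : Matrix (Fin n) (Fin n) ℕ)
      (c : Matrix (Fin m) (Fin n) ℝ),
      IsZeroOne A → StructurallyFullRank A → IsMinSensorNumber A m →
      ∃ (t : Memory) (k : ℕ), Exec p (sensingInput A c) t k ∧ k ≤ K * (n ^ 2 + m ^ 3 + 1) ∧
        t.output 2 m n ∈ argminSet (sensingFeasible A m) (totalCost c)) := by
  refine ⟨fun n m A c _ hA hm => ?_, ⟨lsapProg, 400, fun m C => ?_⟩,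
    ⟨sensingProg, 1000, fun n m A c _ hA hm => ?_⟩⟩
  · obtain ⟨S₀, hinj₀, hS₀⟩ := exists_enumeration_parentSCC hA hm
    have hne : (sensingFeasible A m).Nonempty := by
      rw [← measurementSet_eq_sensingFeasible hA hinj₀ hS₀]
      exact hm.1
    refine ⟨ncard_parentSCC hA hm, measurementSet_eq_sensingFeasible hA hinj₀ hS₀,
      argminSet_nonempty (finite_sensingFeasible A) hne _, fun S hinj hS => ?_⟩
    have hΦ := fun H hH => inducedAssignment_mem_and_le hA hinj hS c (H := H) hH
    have hΨ : ∀ ℓ : Fin m → Fin m → Fin n, _ → ∀ Z ∈ lsapFeasible m, _ :=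
      fun ℓ hℓ Z hZ => measureSelected_mem_and_eq hA hinj hS c (ℓ := ℓ) hℓ hZ
    obtain ⟨ℓ₀, hℓ₀⟩ := exists_cheapest hS c
    obtain ⟨-, hopt, hval⟩ := argminSet_correspondence hΦ (hΨ ℓ₀ hℓ₀)
    refine ⟨isLeast_sccCost hS c, hΦ, fun ℓ hℓ Z hZ => ?_, hopt, hval⟩
    obtain ⟨h1, h2, h3⟩ := hΨ ℓ hℓ Z hZ
    exact ⟨h1, h2, h3, (argminSet_correspondence hΦ (hΨ ℓ hℓ)).1 Z hZ⟩
  · obtain ⟨t, k, he, hk, ht⟩ := lsapProg_spec C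
    refine ⟨t, k, he, hk.trans ?_, ht⟩
    have h2 : m ≤ m ^ 3 := Nat.le_self_pow (by omega) _
    have h3 : m ^ 2 ≤ m ^ 3 := by
      rcases Nat.eq_zero_or_pos m with rfl | hm
      · simp
      · exact Nat.pow_le_pow_right hm (by omega)
    nlinarith
  · obtain ⟨S, hinj, hS⟩ := exists_enumeration_parentSCC hA hm
    obtain ⟨t, k, he, hk, ht⟩ := sensingProg_spec c hA hm
    exact ⟨t, k, he, hk.trans (sensing_bound_le (card_le_of_enumeration hinj hS)), ht⟩
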